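/- Let $m$ be Lebesgue measure on $(0,\infty)$ and let $\mathcal X$ be the linear space of all (real- or complex-valued) measurable functions on $(0,\infty)$, modulo equality a.e. For $0<r\le\infty$ let $L_r\subset\mathcal X$ be the usual Lebesgue space with quasi-norm $\|\cdot\|_r$, and let $L_0$ be the space of all $f\in\mathcal X$ with $\|f\|_0:=m(\operatorname{supp} f)<\infty$. For $f\in\mathcal X$ put $\mu(t,f)=\inf\{s\ge 0: m(\{|f|>s\})\le t\}$, $t>0$. Head majorization is the relation on $L_1+L_\infty$ given by $g\prec\prec f$ iff $\int_0^t\mu(s,g)\,ds\le\int_0^t\mu(s,f)\,ds$ for all $t>0$; tail majorization is the relation on $L_0+L_1$ given by $g\prec\prec_{\rm tl} f$ iff $\int_t^\infty\mu(s,g)\,ds\le\int_t^\infty\mu(s,f)\,ds$ for all $t>0$ (both relations include the requirement that $f$ and $g$ belong to the indicated space). A quasi-Banach function space is a linear subspace $E\subset\mathcal X$ with a complete quasi-norm $\|\cdot\|_E$ such that $f\in E$, $g\in\mathcal X$, $|g|\le|f|$ a.e. imply $g\in E$ and $\|g\|_E\le\|f\|_E$. For $X,Y\in\{L_r:0\le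 r\le\infty\}$, $E$ is called an interpolation space for the couple $(X,Y)$ if $X\cap Y\subset E\subset X+Y$ and every linear operator $T:X+Y\to X+Y$ that restricts to bounded operators $X\to X$ and $Y\to Y$ also restricts to a bounded operator $E\to E$; here bounded on a space $Z$ means $T(Z)\subset Z$ and $\|Tf\|_Z\le C\|f\|_Z$ for all $f\in Z$ with some finite $C$ (for $Z=L_0$: $m(\operatorname{supp}Tf)\le C\,m(\operatorname{supp}f)$). Theorem. Let $E\ne\{0\}$ be a quasi-Banach function space on $(0,\infty)$ (not assumed symmetric), and let $0<p<q<\infty$. Then: (a) $E$ is an interpolation space for $(L_p,L_\infty)$ if and only if there is $c>0$ such that for all $f\in E$ and $g\in L_p+L_\infty$: $|g|^p\prec\prec|f|^p$ implies $g\in E$ and $\|g\|_E\le c\|f\|_E$. (b) $E$ is an interpolation space for $(L_0,L_q)$ if and only if there is $c>0$ such that for all $f\in E$ and $g\in L_0+L_q$: $|g|^q\prec\prec_{\rm tl}|f|^q$ implies $g\in E$ and $\|g\|_E\le c\|f\|_E$. (c) $E$ is an interpolation space for both couples $(L_0,L_q)$ and $(L_p,L_\infty)$ if and only if it is an interpolation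 space for the couple $(L_p,L_q)$. -/

import Mathlib

open MeasureTheory Set Filter Topology
open scoped ENNReal NNReal

noncomputable section

namespace LpInterpolation

/-- Lebesgue measure on the half-line `(0, ∞)`. -/
abbrev halfLine : Measure ℝ := volume.restrict (Ioi 0)

/-- The linear space of all (classes modulo a.e. equality of) measurable functions on `(0, ∞)`. -/
abbrev Meas (𝕜 : Type*) [RCLike 𝕜] : Type _ := ℝ →ₘ[halfLine] 𝕜

/-- The space `L_p` on `(0, ∞)`, for `0 < p ≤ ∞`. -/
abbrev LSpace (𝕜 : Type*) [RCLike 𝕜] (p : ℝ≥0∞) : Submodule 𝕜 (Meas 𝕜) :=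
  Lp.LpSubmodule 𝕜 𝕜 p halfLine

/-- The quasi-norm of `L_p`. -/
def LNorm {𝕜 : Type*} [RCLike 𝕜] (p : ℝ≥0∞) (f : Meas 𝕜) : ℝ≥0∞ :=
  eLpNorm f p halfLine

/-- The group norm of `L_0`: the measure of the support. -/
def suppNorm {𝕜 : Type*} [RCLike 𝕜] (f : Meas 𝕜) : ℝ≥0∞ :=
  halfLine (Function.support f)

/-- The space `L_0` of measurable functions whose support has finite measure. -/
def L0Space (𝕜 : Type*) [RCLike 𝕜] : Submodule 𝕜 (Meas 𝕜) where
  carrier := {f | suppNorm f < ∞}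
  zero_mem' := by
    have h : halfLine (Function.support ((0 : Meas 𝕜) : ℝ → 𝕜)) = 0 := by
      have h0 : ((0 : Meas 𝕜) : ℝ → 𝕜) =ᵐ[halfLine] 0 := AEEqFun.coeFn_zero
      exact ae_iff.1 h0
    exact lt_of_eq_of_lt h ENNReal.zero_lt_top
  add_mem' := by
    intro f g hf hg
    have h : halfLine (Function.support ((f + g : Meas 𝕜) : ℝ → 𝕜)) ≤
        halfLine (Function.support (f : ℝ → 𝕜) ∪ Function.support (g : ℝ → 𝕜)) := by
      apply measure_mono_ae
      filter_upwards [AEEqFun.coeFn_add f g] with x hx hmem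
      have h1 : (f + g : Meas 𝕜) x ≠ 0 := hmem
      rw [hx] at h1
      exact Function.support_add (f : ℝ → 𝕜) (g : ℝ → 𝕜) h1
    exact lt_of_le_of_lt (h.trans (measure_union_le _ _)) (ENNReal.add_lt_top.2 ⟨hf, hg⟩)
  smul_mem' := by
    intro c f hf
    have h : halfLine (Function.support ((c • f : Meas 𝕜) : ℝ → 𝕜)) ≤
        halfLine (Function.support (f : ℝ → 𝕜)) := by
      apply measure_mono_ae
      filter_upwards [AEEqFun.coeFn_smul c f] with x hx hmem
      have h1 : (c • f : Meas 𝕜) x ≠ 0 := hmem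
      rw [hx] at h1
      exact fun h0 => h1 (by simp [h0])
    exact lt_of_le_of_lt h hf

/-- A quasi-Banach function space on `(0, ∞)`: a linear space of measurable functions with a
complete quasi-norm such that `|g| ≤ |f|`, `f ∈ E` imply `g ∈ E` and `‖g‖ ≤ ‖f‖`.
Only the values of `qnorm` on `carrier` are meaningful. -/
structure QuasiBanachFunctionSpace (𝕜 : Type*) [RCLike 𝕜] where
  carrier : Submodule 𝕜 (Meas 𝕜)
  qnorm : Meas 𝕜 → ℝ
  qnorm_nonneg : ∀ f ∈ carrier, 0 ≤ qnorm f
  qnorm_eq_zero_iff : ∀ f ∈ carrier, qnorm f = 0 ↔ f = 0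
  qnorm_smul : ∀ (c : 𝕜), ∀ f ∈ carrier, qnorm (c • f) = ‖c‖ * qnorm f
  quasi_triangle : ∃ C : ℝ, ∀ f ∈ carrier, ∀ g ∈ carrier,
    qnorm (f + g) ≤ C * (qnorm f + qnorm g)
  complete : ∀ u : ℕ → Meas 𝕜, (∀ n, u n ∈ carrier) →
    (∀ ε > 0, ∃ N, ∀ m ≥ N, ∀ n ≥ N, qnorm (u m - u n) < ε) →
    ∃ f ∈ carrier, Tendsto (fun n => qnorm (u n - f)) atTop (𝓝 0)
  solid : ∀ f ∈ carrier, ∀ g : Meas 𝕜, (∀ᵐ x ∂halfLine, ‖g x‖ ≤ ‖f x‖) →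
    g ∈ carrier ∧ qnorm g ≤ qnorm f

variable {𝕜 : Type*} [RCLike 𝕜]

/-- The linear operator `T : V → V` restricts to a bounded operator `Z → Z`, where `Z ⊆ V` carries
the (quasi- or group) norm `N`. -/
def RestrictsToBounded {V : Submodule 𝕜 (Meas 𝕜)} (T : V →ₗ[𝕜] V)
    (Z : Submodule 𝕜 (Meas 𝕜)) (N : Meas 𝕜 → ℝ≥0∞) : Prop :=
  ∃ C : ℝ≥0, ∀ f : V, (f : Meas 𝕜) ∈ Z →
    (T f : Meas 𝕜) ∈ Z ∧ N (T f : Meas 𝕜) ≤ C * N (f : Meas 𝕜)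

/-- `E` is an interpolation space for the couple `(X, Y)`, where `X`, `Y` carry the norms
`NX`, `NY`: `X ∩ Y ⊆ E ⊆ X + Y`, and every linear operator on `X + Y` that restricts to bounded
operators on `X` and on `Y` restricts to a bounded operator on `E`. -/
def IsInterpolationSpace (E : QuasiBanachFunctionSpace 𝕜)
    (X : Submodule 𝕜 (Meas 𝕜)) (NX : Meas 𝕜 → ℝ≥0∞)
    (Y : Submodule 𝕜 (Meas 𝕜)) (NY : Meas 𝕜 → ℝ≥0∞) : Prop :=
  X ⊓ Y ≤ E.carrier ∧ E.carrier ≤ X ⊔ Y ∧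
    ∀ T : (X ⊔ Y : Submodule 𝕜 (Meas 𝕜)) →ₗ[𝕜] (X ⊔ Y : Submodule 𝕜 (Meas 𝕜)),
      RestrictsToBounded T X NX → RestrictsToBounded T Y NY →
        RestrictsToBounded T E.carrier (fun f => ENNReal.ofReal (E.qnorm f))

/-- `E` is an interpolation space for the couple `(L_p, L_q)`, `0 < p, q ≤ ∞`. -/
def IsInterpolationLpLq (E : QuasiBanachFunctionSpace 𝕜) (p q : ℝ≥0∞) : Prop :=
  IsInterpolationSpace E (LSpace 𝕜 p) (LNorm p) (LSpace 𝕜 q) (LNorm q)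

/-- `E` is an interpolation space for the couple `(L_0, L_q)`, `0 < q ≤ ∞`. -/
def IsInterpolationL0Lq (E : QuasiBanachFunctionSpace 𝕜) (q : ℝ≥0∞) : Prop :=
  IsInterpolationSpace E (L0Space 𝕜) suppNorm (LSpace 𝕜 q) (LNorm q)

/-- The right-continuous decreasing rearrangement
`μ(t, f) = inf {s ≥ 0 : m {|f| > s} ≤ t}`. -/
def rearrangement (f : Meas 𝕜) (t : ℝ) : ℝ≥0∞ :=
  sInf {s : ℝ≥0∞ | halfLine {x | s < ‖f x‖ₑ} ≤ ENNReal.ofReal t}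

/-- The function `|f| ^ p`. -/
def absPow (f : Meas 𝕜) (p : ℝ) : Meas ℝ :=
  AEEqFun.compMeasurable (fun z : 𝕜 => ‖z‖ ^ p) (by fun_prop) f

/-- Head majorization `g ≺≺ f`, a relation on `L_1 + L_∞`. -/
def HeadMaj (g f : Meas 𝕜) : Prop :=
  g ∈ LSpace 𝕜 1 ⊔ LSpace 𝕜 ∞ ∧ f ∈ LSpace 𝕜 1 ⊔ LSpace 𝕜 ∞ ∧
    ∀ t : ℝ, 0 < t →
      ∫⁻ s in Ioc 0 t, rearrangement g s ≤ ∫⁻ s in Ioc 0 t, rearrangement f s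

/-- Tail majorization `g ≺≺_tl f`, a relation on `L_0 + L_1`. -/
def TailMaj (g f : Meas 𝕜) : Prop :=
  g ∈ L0Space 𝕜 ⊔ LSpace 𝕜 1 ∧ f ∈ L0Space 𝕜 ⊔ LSpace 𝕜 1 ∧
    ∀ t : ℝ, 0 < t →
      ∫⁻ s in Ioi t, rearrangement g s ≤ ∫⁻ s in Ioi t, rearrangement f s

end LpInterpolation

end

open MeasureTheory Set Filter Topology
open scoped ENNReal NNReal

noncomputable section

namespace LpInterpolation

/-! Everything passes through weighted composition operators f ↦ a · (f ∘ φ), described by a gauge ω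
through the condition ∫ ω(a) (w ∘ φ) ≤ ∫ w for all w ≥ 0. With ω(r) = r^p / C and a ≤ C they are
bounded on L_p and L_∞, and also on L_q for every q > p. With ω(r) = (1_{r ≠ 0} + r^q) / C they are
bounded on L_0 and L_q, and also on L_p for p < q, since r^p ≤ 1 + r^q.

Interpolation implies monotonicity. An interpolation space E admits every operator of the relevant
gauge class. The bound is uniform over the class: otherwise a sequence of bad operators could be
glued, along a partition into blocks of infinite measure, into one operator of the same class that
is unbounded on E (`exists_uniform_bound`). Unweighted compositions then show that E is
rearrangement invariant up to a constant. If f and g are decreasing and |g|^p is head majorized by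
|f|^p, monotone transport of |g|^p dx into a multiple of |f|^p dx gives φ for which a = g / (f ∘ φ)
is an admissible weight (`exists_head_transport`), so g lies in E. For tails the transport moves
points to the right (`exists_tail_transport`); where g > f the weight is at least 1, so that 1 + a^q
≤ 2 a^q.

Monotonicity implies interpolation. Cutting f at the level μ(t, f) shows that an operator T bounded
on L_p and L_∞ satisfies head(Tf) ≤ L head(f). For (L_0, L_q) one gets tail(Tf)(Ns) ≤ L tail(f)(s),
and the dilation is absorbed by replacing f with N disjoint copies of itself
(`TailMonotone.exists_copies`). The inclusions X ∩ Y ⊆ E ⊆ X + Y also follow from monotonicity, by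
comparison with a nonzero element of E and by truncation.

Part (c). Operators of both gauge classes are bounded on L_p and L_q, so interpolation for (L_p,
L_q) gives both monotonicity properties, hence both interpolation properties. Conversely, if T is
bounded on L_p and L_q, then at each t either the head or the tail estimate for Tf holds
(`exists_head_or_tail_map_le`). The transport lemmas need their comparison only on the set of points
being transported, so μ(Tf) is a function supported on one set plus a function supported on another,
each dominated in E. -/

/-! ### Distribution functions and decreasing rearrangements -/

/-- The distribution function of `u` on the half-line. -/
def distr (u : ℝ → ℝ≥0∞) (s : ℝ≥0∞) : ℝ≥0∞ := halfLine {x | s < u x}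

/-- The decreasing rearrangement of a nonnegative function on the half-line. -/
def rearr (u : ℝ → ℝ≥0∞) (t : ℝ) : ℝ≥0∞ := sInf {s | distr u s ≤ ENNReal.ofReal t}

theorem distr_antitone (u : ℝ → ℝ≥0∞) : Antitone (distr u) := fun _ _ h =>
  measure_mono fun _ hx => lt_of_le_of_lt h hx

theorem distr_mono_ae {u v : ℝ → ℝ≥0∞} (h : u ≤ᵐ[halfLine] v) (s : ℝ≥0∞) :
    distr u s ≤ distr v s := by
  apply measure_mono_ae
  filter_upwards [h] with x hx h1
  exact lt_of_lt_of_le h1 hx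

/-- Right continuity: {u > s} is the increasing union of {u > v n} for v n decreasing to s. Hence
the infimum defining `rearr` is attained. -/
theorem distr_le_of_forall_gt {u : ℝ → ℝ≥0∞} {s c : ℝ≥0∞} (h : ∀ s' > s, distr u s' ≤ c) :
    distr u s ≤ c := by
  rcases eq_or_ne s ∞ with rfl | hs
  · simp [distr]
  obtain ⟨v, hv, hvs, hlim⟩ :=
    exists_seq_strictAnti_tendsto' (α := ℝ≥0∞) (x := s) (y := ∞) hs.lt_top
  have hU : {x | s < u x} = ⋃ n, {x | v n < u x} := by
    ext x
    simp only [mem_ofPred_eq, mem_iUnion]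
    constructor
    · intro hx
      exact ((hlim.eventually (gt_mem_nhds hx))).exists
    · rintro ⟨n, hn⟩
      exact (hvs n).1.trans hn
  unfold distr
  rw [hU, Monotone.measure_iUnion]
  · exact iSup_le fun n => h _ (hvs n).1
  · intro i j hij x hx
    exact lt_of_le_of_lt (hv.antitone hij) hx

/-- The Galois connection between `rearr` and `distr`, from which the other properties of the
rearrangement are derived. -/
theorem rearr_le_iff {u : ℝ → ℝ≥0∞} {t : ℝ} {s : ℝ≥0∞} :
    rearr u t ≤ s ↔ distr u s ≤ ENNReal.ofReal t := by
  constructor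
  · intro h
    apply distr_le_of_forall_gt
    intro s' hs'
    obtain ⟨r, hr, hrs⟩ := sInf_lt_iff.1 (lt_of_le_of_lt h hs')
    exact (distr_antitone u hrs.le).trans hr
  · intro h
    exact sInf_le h

theorem lt_rearr_iff {u : ℝ → ℝ≥0∞} {t : ℝ} {s : ℝ≥0∞} :
    s < rearr u t ↔ ENNReal.ofReal t < distr u s := by
  rw [← not_le, rearr_le_iff, not_le]

theorem distr_rearr_self_le (u : ℝ → ℝ≥0∞) (t : ℝ) :
    distr u (rearr u t) ≤ ENNReal.ofReal t := rearr_le_iff.1 le_rfl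

theorem rearr_antitone (u : ℝ → ℝ≥0∞) : Antitone (rearr u) := fun _ _ h =>
  rearr_le_iff.2 ((distr_rearr_self_le u _).trans (ENNReal.ofReal_le_ofReal h))

theorem measurable_rearr (u : ℝ → ℝ≥0∞) : Measurable (rearr u) := (rearr_antitone u).measurable

theorem rearr_mono_ae {u v : ℝ → ℝ≥0∞} (h : u ≤ᵐ[halfLine] v) (t : ℝ) :
    rearr u t ≤ rearr v t :=
  rearr_le_iff.2 ((distr_mono_ae h _).trans (distr_rearr_self_le v t))

theorem rearr_le_of_ae_le {u : ℝ → ℝ≥0∞} {c : ℝ≥0∞} (h : ∀ᵐ x ∂halfLine, u x ≤ c) (t : ℝ) :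
    rearr u t ≤ c := by
  rw [rearr_le_iff]
  have : distr u c = 0 := by
    unfold distr
    rw [ae_iff] at h
    simpa using h
  simp [this]

theorem distr_add_le {u v w : ℝ → ℝ≥0∞} (h : ∀ᵐ x ∂halfLine, w x ≤ u x + v x) (a b : ℝ≥0∞) :
    distr w (a + b) ≤ distr u a + distr v b := by
  refine (measure_mono_ae ?_).trans (measure_union_le _ _)
  filter_upwards [h] with x hx h1
  by_contra hcon
  have hcon' : ¬ (a < u x ∨ b < v x) := hcon
  push Not at hcon'
  exact absurd (lt_of_lt_of_le h1 (hx.trans (add_le_add hcon'.1 hcon'.2))) (lt_irrefl _)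

theorem rearr_add_le {u v w : ℝ → ℝ≥0∞} (h : ∀ᵐ x ∂halfLine, w x ≤ u x + v x) {s t : ℝ}
    (hs : 0 ≤ s) (ht : 0 ≤ t) : rearr w (s + t) ≤ rearr u s + rearr v t := by
  rw [rearr_le_iff, ENNReal.ofReal_add hs ht]
  exact (distr_add_le h _ _).trans
    (add_le_add (distr_rearr_self_le u s) (distr_rearr_self_le v t))

theorem rearr_half_add_le {u v w : ℝ → ℝ≥0∞} (h : ∀ᵐ x ∂halfLine, w x ≤ u x + v x) {t : ℝ}
    (ht : 0 ≤ t) : rearr w t ≤ rearr u (t / 2) + rearr v (t / 2) := by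
  have h2 : 0 ≤ t / 2 := by positivity
  simpa using rearr_add_le h h2 h2

theorem distr_rpow (u : ℝ → ℝ≥0∞) {p : ℝ} (hp : 0 < p) (s : ℝ≥0∞) :
    distr (fun x => u x ^ p) s = distr u (s ^ p⁻¹) := by
  unfold distr
  congr 1
  ext x
  simp only [mem_ofPred_eq]
  rw [ENNReal.rpow_inv_lt_iff hp]

theorem rearr_rpow (u : ℝ → ℝ≥0∞) {p : ℝ} (hp : 0 < p) (t : ℝ) :
    rearr (fun x => u x ^ p) t = rearr u t ^ p := by
  apply eq_of_forall_ge_iff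
  intro s
  rw [rearr_le_iff, distr_rpow u hp, ← rearr_le_iff, ENNReal.le_rpow_inv_iff hp]

theorem rearr_const_mul_le (u : ℝ → ℝ≥0∞) (c : ℝ≥0) (t : ℝ) :
    rearr (fun x => c * u x) t ≤ c * rearr u t := by
  rw [rearr_le_iff]
  refine le_trans (measure_mono ?_) (distr_rearr_self_le u t)
  intro x hx
  have hx' : (c : ℝ≥0∞) * rearr u t < c * u x := hx
  exact lt_of_mul_lt_mul_left' hx'

theorem halfLine_setOf_ofReal_lt (c : ℝ≥0∞) : halfLine {t | ENNReal.ofReal t < c} = c := by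
  rw [Measure.restrict_apply (measurableSet_lt (by fun_prop) measurable_const)]
  rcases eq_or_ne c ∞ with rfl | hc
  · have : {t : ℝ | ENNReal.ofReal t < ∞} ∩ Ioi 0 = Ioi 0 := by ext; simp
    rw [this, Real.volume_Ioi]
  · lift c to ℝ≥0 using hc
    have : {t : ℝ | ENNReal.ofReal t < c} ∩ Ioi 0 = Ioo 0 (c : ℝ) := by
      ext t
      simp only [mem_inter_iff, mem_ofPred_eq, mem_Ioi, mem_Ioo]
      constructor
      · rintro ⟨h1, h2⟩
        refine ⟨h2, ?_⟩
        rw [← ENNReal.ofReal_coe_nnreal] at h1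
        exact (ENNReal.ofReal_lt_ofReal_iff_of_nonneg h2.le).1 h1
      · rintro ⟨h1, h2⟩
        refine ⟨?_, h1⟩
        rw [← ENNReal.ofReal_coe_nnreal]
        exact (ENNReal.ofReal_lt_ofReal_iff_of_nonneg h1.le).2 h2
    rw [this, Real.volume_Ioo]
    simp

/-- By the Galois connection the superlevel set of `rearr u` at s is, within the half-line, an
initial interval of length `distr u s`. -/
theorem distr_rearr (u : ℝ → ℝ≥0∞) (s : ℝ≥0∞) : distr (rearr u) s = distr u s := by
  unfold distr
  simp_rw [lt_rearr_iff]
  exact halfLine_setOf_ofReal_lt _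

/-- Layer cake: `u x` is the length of {s : s < u x}, and Tonelli exchanges the two integrals. -/
theorem lintegral_eq_lintegral_distr {u : ℝ → ℝ≥0∞} (hu : Measurable u) :
    ∫⁻ x, u x ∂halfLine = ∫⁻ s : ℝ, distr u (ENNReal.ofReal s) ∂halfLine := by
  have h1 : ∀ x, u x = ∫⁻ s : ℝ, indicator {s : ℝ | ENNReal.ofReal s < u x} 1 s ∂halfLine := by
    intro x
    rw [lintegral_indicator_one (measurableSet_lt (by fun_prop) measurable_const),
      halfLine_setOf_ofReal_lt]
  have h2 : ∀ s : ℝ, distr u (ENNReal.ofReal s) =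
      ∫⁻ x, indicator {s : ℝ | ENNReal.ofReal s < u x} 1 s ∂halfLine := by
    intro s
    have : (fun x => indicator {s : ℝ | ENNReal.ofReal s < u x} (1 : ℝ → ℝ≥0∞) s) =
        indicator {x | ENNReal.ofReal s < u x} 1 := by
      ext x
      simp [indicator]
    rw [this, lintegral_indicator_one (measurableSet_lt measurable_const hu)]
    rfl
  simp_rw [h2]
  conv_lhs => enter [2, x]; rw [h1 x]
  rw [lintegral_lintegral_swap]
  apply Measurable.aemeasurable
  have : (Function.uncurry fun x s => indicator {s : ℝ | ENNReal.ofReal s < u x}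
      (1 : ℝ → ℝ≥0∞) s) = indicator {z : ℝ × ℝ | ENNReal.ofReal z.2 < u z.1} 1 := by
    ext ⟨x, s⟩
    simp [indicator, Function.uncurry]
  rw [this]
  exact measurable_one.indicator (measurableSet_lt (by fun_prop) (by fun_prop))

theorem lintegral_rearr {u : ℝ → ℝ≥0∞} (hu : Measurable u) :
    ∫⁻ t, rearr u t ∂halfLine = ∫⁻ x, u x ∂halfLine := by
  rw [lintegral_eq_lintegral_distr hu, lintegral_eq_lintegral_distr (measurable_rearr u)]
  simp_rw [distr_rearr]

theorem lintegral_rearr_rpow {u : ℝ → ℝ≥0∞} (hu : Measurable u) {p : ℝ} (hp : 0 < p) :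
    ∫⁻ t, rearr u t ^ p ∂halfLine = ∫⁻ x, u x ^ p ∂halfLine := by
  rw [← lintegral_rearr (hu.pow_const p)]
  simp_rw [rearr_rpow u hp]

/-! ### Quantile functions and monotone transport -/

/-- An atomless measure carried by `(0, ∞)` and finite on bounded sets. -/
structure IsHeadFinite (ρ : Measure ℝ) : Prop where
  noAtoms : ∀ x, ρ {x} = 0
  Iic_zero : ρ (Iic 0) = 0
  Iic_lt_top : ∀ x, ρ (Iic x) < ∞

/-- The cumulative distribution function of a measure carried by `(0, ∞)`. -/
def cumul (ρ : Measure ℝ) (x : ℝ) : ℝ := (ρ (Iic x)).toReal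

/-- The interval `(0, ρ univ)`. -/
def massInterval (ρ : Measure ℝ) : Set ℝ := {s | 0 < s ∧ ENNReal.ofReal s < ρ univ}

open Classical in
/-- The quantile function of a measure, extended by zero outside `massInterval`. -/
def quantile (ρ : Measure ℝ) (s : ℝ) : ℝ :=
  if s ∈ massInterval ρ then sInf {x | s ≤ cumul ρ x} else 0

theorem measurableSet_massInterval (ρ : Measure ℝ) : MeasurableSet (massInterval ρ) :=
  (measurableSet_lt measurable_const measurable_id).inter
    (measurableSet_lt ENNReal.measurable_ofReal measurable_const)

namespace IsHeadFinite

variable {ρ : Measure ℝ}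

theorem ofReal_cumul (h : IsHeadFinite ρ) (x : ℝ) : ENNReal.ofReal (cumul ρ x) = ρ (Iic x) :=
  ENNReal.ofReal_toReal (h.Iic_lt_top x).ne

theorem cumul_mono (h : IsHeadFinite ρ) : Monotone (cumul ρ) := fun _ y hxy =>
  ENNReal.toReal_mono (h.Iic_lt_top y).ne (measure_mono (Iic_subset_Iic.2 hxy))

theorem cumul_of_nonpos (h : IsHeadFinite ρ) {x : ℝ} (hx : x ≤ 0) : cumul ρ x = 0 := by
  have : ρ (Iic x) = 0 := measure_mono_null (Iic_subset_Iic.2 hx) h.Iic_zero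
  simp [cumul, this]

theorem cumul_nonneg (x : ℝ) : 0 ≤ cumul ρ x := ENNReal.toReal_nonneg

theorem continuous_cumul (h : IsHeadFinite ρ) : Continuous (cumul ρ) := by
  rw [continuous_iff_continuousAt]
  intro x
  refine (ENNReal.tendsto_toReal (h.Iic_lt_top x).ne).comp ?_
  have h1 : ∀ y, ρ (Iic y) = ∫⁻ z, (Iic y).indicator 1 z ∂ρ := fun y =>
    (lintegral_indicator_one measurableSet_Iic).symm
  simp_rw [h1]
  refine tendsto_lintegral_filter_of_dominated_convergence ((Iic (x + 1)).indicator 1)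
    (.of_forall fun y => measurable_one.indicator measurableSet_Iic) ?_ ?_ ?_
  · filter_upwards [Iio_mem_nhds (lt_add_one x)] with y hy
    refine .of_forall fun z => indicator_le_indicator_of_subset ?_ (by simp) z
    exact Iic_subset_Iic.2 (le_of_lt hy)
  · rw [lintegral_indicator_one measurableSet_Iic]
    exact (h.Iic_lt_top _).ne
  · have h2 : ∀ᵐ z ∂ρ, z ≠ x := by
      rw [ae_iff]
      simpa using h.noAtoms x
    filter_upwards [h2] with z hz
    apply tendsto_const_nhds.congr'
    rcases lt_or_gt_of_ne hz with hz | hz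
    · filter_upwards [Ioi_mem_nhds hz] with y hy
      have hy' : z ≤ y := le_of_lt hy
      simp [indicator, hz.le, hy']
    · filter_upwards [Iio_mem_nhds hz] with y hy
      have hy' : ¬ z ≤ y := not_le.2 hy
      simp [indicator, not_le.2 hz, hy']

theorem Ioc_eq (h : IsHeadFinite ρ) {a b : ℝ} (hab : a ≤ b) :
    ρ (Ioc a b) = ENNReal.ofReal (cumul ρ b - cumul ρ a) := by
  rw [← Iic_sdiff_Iic, measure_sdiff (Iic_subset_Iic.2 hab) measurableSet_Iic.nullMeasurableSet
    (h.Iic_lt_top a).ne, ENNReal.ofReal_sub _ (cumul_nonneg a), h.ofReal_cumul, h.ofReal_cumul]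

theorem exists_lt_cumul (h : IsHeadFinite ρ) {s : ℝ} (hs : s ∈ massInterval ρ) :
    ∃ x, s < cumul ρ x := by
  have hU : (⋃ n : ℕ, Iic (n : ℝ)) = univ := by
    ext x
    simpa using exists_nat_ge x
  have h2 := hs.2
  rw [← hU, Monotone.measure_iUnion (fun i j hij => Iic_subset_Iic.2 (by exact_mod_cast hij)),
    lt_iSup_iff] at h2
  obtain ⟨n, hn⟩ := h2
  refine ⟨n, ?_⟩
  rw [← h.ofReal_cumul] at hn
  exact (ENNReal.ofReal_lt_ofReal_iff_of_nonneg hs.1.le).1 hn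

theorem ofReal_cumul_le (h : IsHeadFinite ρ) (x : ℝ) : ENNReal.ofReal (cumul ρ x) ≤ ρ univ := by
  rw [h.ofReal_cumul]
  exact measure_mono (subset_univ _)

/-- Without atoms `cumul` is continuous, so the infimum belongs to {x | s ≤ cumul ρ x}, and the
intermediate value theorem excludes a jump over s. -/
theorem cumul_quantile (h : IsHeadFinite ρ) {s : ℝ} (hs : s ∈ massInterval ρ) :
    cumul ρ (quantile ρ s) = s := by
  obtain ⟨b, hb⟩ := h.exists_lt_cumul hs
  have hbdd : BddBelow {x | s ≤ cumul ρ x} := by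
    refine ⟨0, fun x hx => ?_⟩
    by_contra hneg
    have := h.cumul_of_nonpos (not_le.1 hneg).le
    have hx' : s ≤ cumul ρ x := hx
    linarith [hs.1]
  have hclosed : IsClosed {x | s ≤ cumul ρ x} := isClosed_le continuous_const h.continuous_cumul
  have hmem := hclosed.csInf_mem ⟨b, hb.le⟩ hbdd
  rw [quantile, if_pos hs]
  refine le_antisymm ?_ hmem
  have h0 : cumul ρ 0 = 0 := h.cumul_of_nonpos le_rfl
  have hb0 : (0 : ℝ) ≤ b := by
    by_contra hneg
    have := h.cumul_of_nonpos (not_le.1 hneg).le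
    linarith [hs.1]
  obtain ⟨y, hy, hys⟩ := intermediate_value_Icc hb0 h.continuous_cumul.continuousOn
    (show s ∈ Icc (cumul ρ 0) (cumul ρ b) from ⟨h0.trans_le hs.1.le, hb.le⟩)
  exact (h.cumul_mono (csInf_le hbdd (show s ≤ cumul ρ y from hys.ge))).trans hys.le

theorem quantile_le_iff (h : IsHeadFinite ρ) {s x : ℝ} (hs : s ∈ massInterval ρ) :
    quantile ρ s ≤ x ↔ s ≤ cumul ρ x := by
  constructor
  · intro hx
    rw [← h.cumul_quantile hs]
    exact h.cumul_mono hx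
  · intro hx
    rw [quantile, if_pos hs]
    refine csInf_le ⟨0, fun x hx => ?_⟩ hx
    by_contra hneg
    have := h.cumul_of_nonpos (not_le.1 hneg).le
    have hx' : s ≤ cumul ρ x := hx
    linarith [hs.1]

theorem quantile_pos (h : IsHeadFinite ρ) {s : ℝ} (hs : s ∈ massInterval ρ) : 0 < quantile ρ s := by
  by_contra hneg
  have h1 := (h.quantile_le_iff hs).1 (not_lt.1 hneg)
  rw [h.cumul_of_nonpos le_rfl] at h1
  exact absurd hs.1 (not_lt.2 h1)

theorem measurable_quantile (h : IsHeadFinite ρ) : Measurable (quantile ρ) := by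
  classical
  refine measurable_of_Iic fun x => ?_
  have : quantile ρ ⁻¹' Iic x = (massInterval ρ).ite {s | s ≤ cumul ρ x} {_s | (0 : ℝ) ≤ x} := by
    ext s
    by_cases hs : s ∈ massInterval ρ
    · simp [Set.ite, hs, h.quantile_le_iff hs]
    · simp [Set.ite, hs, quantile]
  rw [this]
  exact (measurableSet_massInterval ρ).ite measurableSet_Iic (MeasurableSet.const _)

theorem map_quantile (h : IsHeadFinite ρ) :
    (volume.restrict (massInterval ρ)).map (quantile ρ) = ρ := by
  symm
  have : IsLocallyFiniteMeasure ρ := ⟨fun x => ⟨Iic (x + 1), Iic_mem_nhds (by linarith),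
    h.Iic_lt_top _⟩⟩
  refine Measure.ext_of_Ioc _ _ fun a b hab => ?_
  rw [Measure.map_apply h.measurable_quantile measurableSet_Ioc,
    Measure.restrict_apply (h.measurable_quantile measurableSet_Ioc), h.Ioc_eq hab.le]
  apply le_antisymm
  · rw [← Real.volume_Ioo]
    apply measure_mono
    rintro s ⟨hs1, hs2⟩
    have hs : s ∈ massInterval ρ := ⟨(cumul_nonneg a).trans_lt hs1,
      ((ENNReal.ofReal_lt_ofReal_iff_of_nonneg ((cumul_nonneg a).trans hs1.le)).2 hs2).trans_le
        (h.ofReal_cumul_le b)⟩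
    refine ⟨⟨?_, (h.quantile_le_iff hs).2 hs2.le⟩, hs⟩
    by_contra hcon
    exact absurd ((h.quantile_le_iff hs).1 (not_lt.1 hcon)) (not_le.2 hs1)
  · rw [← Real.volume_Ioc]
    apply measure_mono
    rintro s ⟨⟨hs1, hs2⟩, hs⟩
    refine ⟨?_, (h.quantile_le_iff hs).1 hs2⟩
    by_contra hcon
    exact absurd ((h.quantile_le_iff hs).2 (not_lt.1 hcon)) (not_le.2 hs1)

/-- The probability integral transform: `ρ` is the image of Lebesgue measure under `quantile ρ`,
which `cumul ρ` inverts from the left. -/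
theorem map_cumul (h : IsHeadFinite ρ) : ρ.map (cumul ρ) = volume.restrict (massInterval ρ) := by
  have h0 : ρ.map (cumul ρ) =
      ((volume.restrict (massInterval ρ)).map (quantile ρ)).map (cumul ρ) := by
    rw [h.map_quantile]
  rw [h0, Measure.map_map h.continuous_cumul.measurable h.measurable_quantile]
  conv_rhs => rw [← Measure.map_id (μ := volume.restrict (massInterval ρ))]
  apply Measure.map_congr
  filter_upwards [ae_restrict_mem (measurableSet_massInterval ρ)] with s hs
  exact h.cumul_quantile hs

theorem ae_cumul_mem (h : IsHeadFinite ρ) : ∀ᵐ x ∂ρ, cumul ρ x ∈ massInterval ρ := by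
  have h1 : ∀ᵐ s ∂(ρ.map (cumul ρ)), s ∈ massInterval ρ := by
    rw [h.map_cumul]
    exact ae_restrict_mem (measurableSet_massInterval ρ)
  exact ae_of_ae_map h.continuous_cumul.measurable.aemeasurable h1

end IsHeadFinite

/-- The monotone transport of `ρ₁` to `c • ρ₂`. -/
def transport (ρ₁ ρ₂ : Measure ℝ) (c : ℝ) (x : ℝ) : ℝ := quantile ρ₂ (cumul ρ₁ x / c)

theorem measurable_transport {ρ₁ ρ₂ : Measure ℝ} (h₁ : IsHeadFinite ρ₁) (h₂ : IsHeadFinite ρ₂)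
    (c : ℝ) : Measurable (transport ρ₁ ρ₂ c) :=
  h₂.measurable_quantile.comp (h₁.continuous_cumul.measurable.div_const c)

theorem lintegral_comp_div {k : ℝ → ℝ≥0∞} (hk : Measurable k) {c : ℝ} (hc : 0 < c) :
    ∫⁻ s, k (s / c) = ENNReal.ofReal c * ∫⁻ s, k s := by
  have hkc : Measurable fun s => k (s / c) := hk.comp (measurable_id.div_const c)
  have h1 := Real.smul_map_volume_mul_left hc.ne'
  conv_lhs => rw [← h1]
  rw [lintegral_smul_measure, lintegral_map hkc (by fun_prop), abs_of_pos hc, smul_eq_mul]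
  simp [hc.ne']

/-- `cumul ρ₁` carries ρ₁ to Lebesgue measure on an interval, division by c costs the factor c, and
`quantile ρ₂` carries Lebesgue measure to ρ₂. The hypothesis on U keeps the argument of the quantile
where it is not the default value 0. -/
theorem lintegral_transport_le {ρ₁ ρ₂ : Measure ℝ} (h₁ : IsHeadFinite ρ₁) (h₂ : IsHeadFinite ρ₂)
    {c : ℝ} (hc : 0 < c) {U : Set ℝ}
    (hU : ∀ᵐ x ∂ρ₁, x ∈ U → cumul ρ₁ x / c ∈ massInterval ρ₂)
    {w : ℝ → ℝ≥0∞} (hw : Measurable w) :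
    ∫⁻ x in U, w (transport ρ₁ ρ₂ c x) ∂ρ₁ ≤ ENNReal.ofReal c * ∫⁻ x, w x ∂ρ₂ := by
  set k : ℝ → ℝ≥0∞ := (massInterval ρ₂).indicator (fun s => w (quantile ρ₂ s)) with hk
  have hkm : Measurable k := (hw.comp h₂.measurable_quantile).indicator
    (measurableSet_massInterval ρ₂)
  have hkc : Measurable fun s => k (s / c) := hkm.comp (measurable_id.div_const c)
  calc ∫⁻ x in U, w (transport ρ₁ ρ₂ c x) ∂ρ₁
      ≤ ∫⁻ x in U, k (cumul ρ₁ x / c) ∂ρ₁ := by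
        refine setLIntegral_mono_ae (hkc.comp h₁.continuous_cumul.measurable).aemeasurable ?_
        filter_upwards [hU] with x hx hxU
        rw [hk, indicator_of_mem (hx hxU)]
        rfl
    _ ≤ ∫⁻ x, k (cumul ρ₁ x / c) ∂ρ₁ := setLIntegral_le_lintegral U _
    _ = ∫⁻ s, k (s / c) ∂(ρ₁.map (cumul ρ₁)) := by
        rw [lintegral_map hkc h₁.continuous_cumul.measurable]
    _ ≤ ∫⁻ s, k (s / c) := by
        rw [h₁.map_cumul]
        exact setLIntegral_le_lintegral _ _
    _ = ENNReal.ofReal c * ∫⁻ x, w x ∂ρ₂ := by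
        rw [lintegral_comp_div hkm hc]
        conv_rhs => rw [← h₂.map_quantile]
        rw [lintegral_map hw h₂.measurable_quantile,
          lintegral_indicator (measurableSet_massInterval ρ₂)]

/-! ### Matching equimeasurable functions along dyadic levels -/

theorem isHeadFinite_restrict (A : Set ℝ) : IsHeadFinite (halfLine.restrict A) where
  noAtoms x := measure_singleton x
  Iic_zero := by
    refine le_antisymm ((Measure.restrict_apply_le A _).trans ?_) zero_le
    rw [Measure.restrict_apply measurableSet_Iic, Iic_inter_Ioi]
    simp
  Iic_lt_top x := by
    refine (Measure.restrict_apply_le A _).trans_lt ?_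
    rw [Measure.restrict_apply measurableSet_Iic, inter_comm, Ioi_inter_Iic, Real.volume_Ioc]
    exact ENNReal.ofReal_lt_top

theorem lintegral_matching_le {A B : Set ℝ} (h : halfLine A ≤ halfLine B)
    {w : ℝ → ℝ≥0∞} (hw : Measurable w) :
    ∫⁻ x in A, w (transport (halfLine.restrict A) (halfLine.restrict B) 1 x) ∂halfLine ≤
      ∫⁻ x in B, w x ∂halfLine := by
  have h1 := lintegral_transport_le (isHeadFinite_restrict A) (isHeadFinite_restrict B)
    one_pos (U := univ) ?_ hw
  · simpa using h1
  · filter_upwards [(isHeadFinite_restrict A).ae_cumul_mem] with x hx _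
    rw [div_one]
    refine ⟨hx.1, hx.2.trans_le ?_⟩
    simpa using h

/-- The integral inequality of the matching, tested on the indicator of the complement of B, has
right-hand side zero. -/
theorem ae_matching_mem {A B : Set ℝ} (hB : MeasurableSet B) (h : halfLine A ≤ halfLine B) :
    ∀ᵐ x ∂(halfLine.restrict A),
      transport (halfLine.restrict A) (halfLine.restrict B) 1 x ∈ B := by
  have hw : Measurable (Bᶜ.indicator (1 : ℝ → ℝ≥0∞)) := measurable_one.indicator hB.compl
  have h1 := lintegral_matching_le h hw
  have h2 : ∫⁻ x in B, Bᶜ.indicator (1 : ℝ → ℝ≥0∞) x ∂halfLine = 0 := by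
    rw [lintegral_indicator_one hB.compl, Measure.restrict_apply hB.compl]
    simp
  rw [h2, nonpos_iff_eq_zero] at h1
  filter_upwards [(lintegral_eq_zero_iff (hw.comp (measurable_transport (isHeadFinite_restrict A)
    (isHeadFinite_restrict B) 1))).1 h1] with x hx
  by_contra hcon
  have hx' : Bᶜ.indicator (1 : ℝ → ℝ≥0∞) (transport (halfLine.restrict A) (halfLine.restrict B) 1 x)
    = 0 := hx
  rw [indicator_of_mem hcon] at hx'
  exact one_ne_zero hx'

theorem measurable_comp_index {ι β : Type*} [Countable ι] [MeasurableSpace ι]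
    [MeasurableSingletonClass ι] [MeasurableSpace β] {ψ : ι → ℝ → β} (hψ : ∀ i, Measurable (ψ i))
    {α : ℝ → ι} (hα : Measurable α) : Measurable fun x => ψ (α x) x :=
  (measurable_from_prod_countable_left (f := fun z : ℝ × ι => ψ z.2 z.1) hψ).comp
    (measurable_id.prodMk hα)

/-- Each piece {α = i} is matched separately into `B i`; as the targets are disjoint, the integral
bounds add up without loss. -/
theorem exists_matching {P : Set ℝ} (hP : MeasurableSet P) {α : ℝ → ℤ} (hα : Measurable α)
    {B : ℤ → Set ℝ} (hB : ∀ i, MeasurableSet (B i)) (hd : Pairwise (Function.onFun Disjoint B))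
    (hm : ∀ i, halfLine (P ∩ α ⁻¹' {i}) ≤ halfLine (B i)) :
    ∃ φ : ℝ → ℝ, Measurable φ ∧
      (∀ w : ℝ → ℝ≥0∞, Measurable w →
        ∫⁻ x in P, w (φ x) ∂halfLine ≤ ∫⁻ x, w x ∂halfLine) ∧
      ∀ᵐ x ∂halfLine, x ∈ P → φ x ∈ B (α x) := by
  set A : ℤ → Set ℝ := fun i => P ∩ α ⁻¹' {i} with hA
  have hAm : ∀ i, MeasurableSet (A i) := fun i => hP.inter (hα (measurableSet_singleton i))
  have hAd : Pairwise (Function.onFun Disjoint A) := by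
    intro i j hij
    refine Set.disjoint_left.2 ?_
    rintro x ⟨_, h1⟩ ⟨_, h2⟩
    exact hij (h1.symm.trans h2)
  have hAU : ⋃ i, A i = P := by
    ext x
    simp [hA]
  set ψ : ℤ → ℝ → ℝ := fun i =>
    transport (halfLine.restrict (A i)) (halfLine.restrict (B i)) 1 with hψ
  have hψm : ∀ i, Measurable (ψ i) := fun i =>
    measurable_transport (isHeadFinite_restrict _) (isHeadFinite_restrict _) 1
  have hφm : Measurable fun x => ψ (α x) x :=
    measurable_comp_index hψm hα
  refine ⟨fun x => ψ (α x) x, hφm, fun w hw => ?_, ?_⟩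
  · have hi : ∀ i, ∫⁻ x in A i, w (ψ (α x) x) ∂halfLine ≤ ∫⁻ x in B i, w x ∂halfLine := by
      intro i
      have h1 : ∫⁻ x in A i, w (ψ (α x) x) ∂halfLine = ∫⁻ x in A i, w (ψ i x) ∂halfLine := by
        refine setLIntegral_congr_fun (hAm i) fun x hx => ?_
        have hx' : α x = i := hx.2
        simp only [hx']
      rw [h1]
      exact lintegral_matching_le (hm i) hw
    calc ∫⁻ x in P, w (ψ (α x) x) ∂halfLine
        = ∑' i, ∫⁻ x in A i, w (ψ (α x) x) ∂halfLine := by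
          rw [← hAU, lintegral_iUnion hAm hAd]
      _ ≤ ∑' i, ∫⁻ x in B i, w x ∂halfLine :=
          ENNReal.tsum_le_tsum hi
      _ = ∫⁻ x in ⋃ i, B i, w x ∂halfLine := (lintegral_iUnion hB hd _).symm
      _ ≤ ∫⁻ x, w x ∂halfLine := setLIntegral_le_lintegral _ _
  · have h1 : ∀ i, ∀ᵐ x ∂halfLine, x ∈ A i → ψ i x ∈ B i := fun i =>
      (ae_restrict_iff' (hAm i)).1 (ae_matching_mem (hB i) (hm i))
    filter_upwards [ae_all_iff.2 h1] with x hx hxP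
    exact hx (α x) ⟨hxP, rfl⟩

theorem exists_dyadic {y : ℝ≥0∞} (h : y ≠ 0 ∧ y ≠ ∞) :
    ∃ n : ℤ, y ∈ Ioc ((2 : ℝ≥0∞) ^ n) (2 ^ (n + 1)) :=
  ENNReal.exists_mem_Ioc_zpow h.1 h.2 ENNReal.one_lt_two ENNReal.ofNat_ne_top

open Classical in
/-- The integer `n` with `2 ^ n < y ≤ 2 ^ (n + 1)`. -/
def dyadic (y : ℝ≥0∞) : ℤ := if h : y ≠ 0 ∧ y ≠ ∞ then (exists_dyadic h).choose else 0

theorem dyadic_mem {y : ℝ≥0∞} (h0 : y ≠ 0) (h1 : y ≠ ∞) :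
    y ∈ Ioc ((2 : ℝ≥0∞) ^ dyadic y) (2 ^ (dyadic y + 1)) := by
  have h : y ≠ 0 ∧ y ≠ ∞ := ⟨h0, h1⟩
  rw [dyadic, dif_pos h]
  exact (exists_dyadic h).choose_spec

theorem pairwise_disjoint_dyadic :
    Pairwise (Function.onFun Disjoint fun n : ℤ => Ioc ((2 : ℝ≥0∞) ^ n) (2 ^ (n + 1))) :=
  (ENNReal.monotone_zpow one_le_two).pairwise_disjoint_on_Ioc_succ

theorem dyadic_eq {y : ℝ≥0∞} {n : ℤ} (h : y ∈ Ioc ((2 : ℝ≥0∞) ^ n) (2 ^ (n + 1))) :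
    dyadic y = n := by
  have h0 : y ≠ 0 := (zero_le.trans_lt h.1).ne'
  have h1 : y ≠ ∞ := (h.2.trans_lt (ENNReal.zpow_lt_top two_ne_zero ENNReal.ofNat_ne_top _)).ne
  by_contra hne
  exact Set.disjoint_left.1 (pairwise_disjoint_dyadic hne) (dyadic_mem h0 h1) h

theorem measurable_dyadic : Measurable dyadic := by
  refine measurable_to_countable' fun n => ?_
  have : dyadic ⁻¹' {n} = Ioc ((2 : ℝ≥0∞) ^ n) (2 ^ (n + 1)) ∪
      (dyadic ⁻¹' {n} ∩ ({0, ∞} : Set ℝ≥0∞)) := by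
    ext y
    constructor
    · intro hy
      by_cases h : y = 0 ∨ y = ∞
      · exact Or.inr ⟨hy, h⟩
      · push Not at h
        have hy' : dyadic y = n := hy
        exact Or.inl (hy' ▸ dyadic_mem h.1 h.2)
    · rintro (hy | hy)
      · exact dyadic_eq hy
      · exact hy.1
  rw [this]
  exact measurableSet_Ioc.union
    ((Set.Finite.subset (by simp) inter_subset_right).measurableSet)

/-- The part of the half-line on which the dyadic level of `u` is not preceded by
a set of infinite measure. -/
def finiteRank (u : ℝ → ℝ≥0∞) : Set ℝ :=
  {x | u x ≠ 0 ∧ u x ≠ ∞ ∧ distr u (2 ^ (dyadic (u x) + 1)) ≠ ∞}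

theorem measurableSet_finiteRank {u : ℝ → ℝ≥0∞} (hu : Measurable u) :
    MeasurableSet (finiteRank u) := by
  have h1 : Measurable fun x => distr u (2 ^ (dyadic (u x) + 1)) := by
    have h2 : Measurable fun n : ℤ => distr u (2 ^ (n + 1)) := measurable_from_top
    exact h2.comp (measurable_dyadic.comp hu)
  exact (hu (measurableSet_singleton 0).compl).inter
    ((hu (measurableSet_singleton ∞).compl).inter (h1 (measurableSet_singleton ∞).compl))

theorem halfLine_preimage_Ioc {u : ℝ → ℝ≥0∞} (hu : Measurable u) {a b : ℝ≥0∞} (hab : a ≤ b)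
    (hb : distr u b ≠ ∞) : halfLine (u ⁻¹' Ioc a b) = distr u a - distr u b := by
  have : u ⁻¹' Ioc a b = {x | a < u x} \ {x | b < u x} := by
    ext x
    simp
  have hsub : {x | b < u x} ⊆ {x | a < u x} := fun x hx => hab.trans_lt hx
  rw [this, measure_sdiff hsub (measurableSet_lt measurable_const hu).nullMeasurableSet hb]
  rfl

/-- Corresponding dyadic level sets of u and v have equal measure, and values within one dyadic
level agree up to a factor 2. Restricting to `finiteRank` makes the measure of a level set a
difference of distribution functions with finite subtrahend. -/
theorem exists_dyadic_matching {u v : ℝ → ℝ≥0∞} (hu : Measurable u) (hv : Measurable v)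
    (huv : ∀ s, distr u s = distr v s) :
    ∃ φ : ℝ → ℝ, Measurable φ ∧
      (∀ w : ℝ → ℝ≥0∞, Measurable w →
        ∫⁻ x in finiteRank u, w (φ x) ∂halfLine ≤ ∫⁻ x, w x ∂halfLine) ∧
      ∀ᵐ x ∂halfLine, x ∈ finiteRank u → u x ≤ 2 * v (φ x) := by
  have hm : ∀ n, halfLine (finiteRank u ∩ (fun x => dyadic (u x)) ⁻¹' {n}) ≤
      halfLine (v ⁻¹' Ioc (2 ^ n) (2 ^ (n + 1))) := by
    intro n
    rcases (finiteRank u ∩ (fun x => dyadic (u x)) ⁻¹' {n}).eq_empty_or_nonempty with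
      he | ⟨x, hx, hxn⟩
    · rw [he]
      simp
    · have hxn' : dyadic (u x) = n := hxn
      have hfin := hx.2.2
      rw [hxn'] at hfin
      have hle : (2 : ℝ≥0∞) ^ n ≤ 2 ^ (n + 1) :=
        ENNReal.monotone_zpow one_le_two (by lia)
      rw [halfLine_preimage_Ioc hv hle (huv _ ▸ hfin), ← huv, ← huv,
        ← halfLine_preimage_Ioc hu hle hfin]
      apply measure_mono
      rintro y ⟨hy, hyn⟩
      have hyn' : dyadic (u y) = n := hyn
      exact hyn' ▸ dyadic_mem hy.1 hy.2.1
  obtain ⟨φ, h1, h2, h3⟩ := exists_matching (measurableSet_finiteRank hu)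
    (measurable_dyadic.comp hu) (fun n => hv measurableSet_Ioc)
    (fun i j hij => (pairwise_disjoint_dyadic hij).preimage v) hm
  refine ⟨φ, h1, h2, ?_⟩
  filter_upwards [h3] with x hx hxP
  have hx1 := (hx hxP).1
  have hx2 := (dyadic_mem hxP.1 hxP.2.1).2
  refine hx2.trans ?_
  rw [ENNReal.zpow_add two_ne_zero ENNReal.ofNat_ne_top, zpow_one, mul_comm]
  exact mul_le_mul_right hx1.le 2

/-- A map that carries the half-line into itself and realizes the rearrangement of `u`
up to a factor `2`. -/
theorem exists_rearr_le_comp {u : ℝ → ℝ≥0∞} (hu : Measurable u)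
    (hfin : ∀ t, 0 < t → rearr u t ≠ ∞) :
    ∃ φ : ℝ → ℝ, Measurable φ ∧
      (∀ w : ℝ → ℝ≥0∞, Measurable w →
        ∫⁻ t in {t | rearr u t ≠ 0}, w (φ t) ∂halfLine ≤ ∫⁻ x, w x ∂halfLine) ∧
      ∀ᵐ t ∂halfLine, rearr u t ≠ 0 → rearr u t ≤ 2 * u (φ t) := by
  obtain ⟨φ, h1, h2, h3⟩ := exists_dyadic_matching (measurable_rearr u) hu (distr_rearr u)
  -- Any level at or above `rearr u t` is exceeded on a set of measure at most t, so no point of the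
  -- rearrangement is preceded by infinite measure.
  have hmem : ∀ t ∈ Ioi (0 : ℝ), rearr u t ≠ 0 → t ∈ finiteRank (rearr u) := by
    intro t ht h0
    refine ⟨h0, hfin t ht, ?_⟩
    rw [distr_rearr]
    exact ((rearr_le_iff.1 (dyadic_mem h0 (hfin t ht)).2).trans_lt ENNReal.ofReal_lt_top).ne
  refine ⟨φ, h1, fun w hw => (lintegral_mono' (Measure.restrict_mono_ae ?_) le_rfl).trans (h2 w hw),
    ?_⟩
  · filter_upwards [ae_restrict_mem measurableSet_Ioi] with t ht
    exact hmem t ht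
  · filter_upwards [h3, ae_restrict_mem measurableSet_Ioi] with t ht ht0 h0
    exact ht (hmem t ht0 h0)

/-- A map that realizes a function as a composition with its rearrangement up to a factor `2`. -/
theorem exists_le_rearr_comp {u : ℝ → ℝ≥0∞} (hu : Measurable u) (hfin : ∀ x, u x ≠ ∞) :
    ∃ φ : ℝ → ℝ, Measurable φ ∧
      (∀ w : ℝ → ℝ≥0∞, Measurable w →
        ∫⁻ x, w (φ x) ∂halfLine ≤ 2 * ∫⁻ x, w x ∂halfLine) ∧
      ∀ᵐ x ∂halfLine, u x ≤ 2 * rearr u (φ x) := by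
  classical
  obtain ⟨φ, h1, h2, h3⟩ := exists_dyadic_matching hu (measurable_rearr u)
    (fun s => (distr_rearr u s).symm)
  have hPm := measurableSet_finiteRank hu
  -- Off `finiteRank u`, wherever u is nonzero, the upper end of its dyadic level is exceeded on a
  -- set of infinite measure, so the rearrangement is above that end everywhere and the identity map
  -- serves. The two pieces account for the factor 2 in the integral bound.
  refine ⟨(finiteRank u).piecewise φ id, h1.piecewise hPm measurable_id, fun w hw => ?_, ?_⟩
  · rw [← lintegral_add_compl _ hPm, two_mul]
    refine add_le_add (le_of_eq_of_le ?_ (h2 w hw))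
      (le_of_eq_of_le ?_ (setLIntegral_le_lintegral (finiteRank u)ᶜ w))
    · refine setLIntegral_congr_fun hPm fun x hx => ?_
      simp [hx]
    · refine setLIntegral_congr_fun hPm.compl fun x hx => ?_
      simp [show x ∉ finiteRank u from hx]
  · filter_upwards [h3] with x hx
    by_cases hxP : x ∈ finiteRank u
    · simpa [hxP] using hx hxP
    · simp only [hxP, not_false_eq_true, piecewise_eq_of_notMem, id]
      rcases eq_or_ne (u x) 0 with h0 | h0
      · simp [h0]
      · have hinf : distr u (2 ^ (dyadic (u x) + 1)) = ∞ := by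
          by_contra hne
          exact hxP ⟨h0, hfin x, hne⟩
        have h4 : (2 : ℝ≥0∞) ^ (dyadic (u x) + 1) < rearr u x := by
          rw [lt_rearr_iff, hinf]
          exact ENNReal.ofReal_lt_top
        refine ((dyadic_mem h0 (hfin x)).2.trans h4.le).trans ?_
        exact le_mul_of_one_le_left zero_le one_le_two

/-! ### Gauge classes of weighted composition operators -/

variable {𝕜 : Type*} [RCLike 𝕜]

/-- Admissible data for a class of weighted composition operators: the weights are at most `M`,
and `ω` measures the size of a weight. -/
structure IsGauge (ω : ℝ≥0 → ℝ≥0∞) (M : ℝ≥0∞) : Prop where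
  measurable : Measurable ω
  ne_zero : ∀ r, r ≠ 0 → ω r ≠ 0
  zero : ω 0 = 0
  one_le : ω 1 ≤ 1
  one_le_bound : 1 ≤ M

/-- The pairs `(a, φ)` for which `f ↦ a • f ∘ φ` is controlled by the gauge `ω`, `M`. -/
structure GaugeClass (ω : ℝ≥0 → ℝ≥0∞) (M : ℝ≥0∞) (a : ℝ → ℝ≥0) (φ : ℝ → ℝ) : Prop where
  measurable_weight : Measurable a
  measurable_map : Measurable φ
  weight_le : ∀ x, (a x : ℝ≥0∞) ≤ M
  lintegral_le : ∀ w : ℝ → ℝ≥0∞, Measurable w →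
    ∫⁻ x, ω (a x) * w (φ x) ∂halfLine ≤ ∫⁻ x, w x ∂halfLine

/-- Tested on the indicator of a null set, the gauge condition says that φ is nonsingular where the
weight is nonzero. This makes the operator insensitive to the choice of representatives, hence
linear on classes. -/
theorem GaugeClass.ae_comp {ω : ℝ≥0 → ℝ≥0∞} {M : ℝ≥0∞} {a : ℝ → ℝ≥0} {φ : ℝ → ℝ}
    (h : GaugeClass ω M a φ) (hω : IsGauge ω M) {Q : ℝ → Prop} (hQ : ∀ᵐ y ∂halfLine, Q y) :
    ∀ᵐ x ∂halfLine, a x ≠ 0 → Q (φ x) := by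
  set N := toMeasurable halfLine {y | ¬ Q y} with hN
  have hNm : MeasurableSet N := measurableSet_toMeasurable _ _
  have hN0 : halfLine N = 0 := by
    rw [hN, measure_toMeasurable]
    exact ae_iff.1 hQ
  have hw : Measurable (N.indicator (1 : ℝ → ℝ≥0∞)) := measurable_one.indicator hNm
  have h1 := h.lintegral_le _ hw
  rw [lintegral_indicator_one hNm, hN0, nonpos_iff_eq_zero] at h1
  have h2 := (lintegral_eq_zero_iff ((hω.measurable.comp h.measurable_weight).mul
    (hw.comp h.measurable_map))).1 h1
  filter_upwards [h2] with x hx ha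
  by_contra hcon
  have hmem : φ x ∈ N := subset_toMeasurable _ _ hcon
  have hx' : ω (a x) * N.indicator (1 : ℝ → ℝ≥0∞) (φ x) = 0 := hx
  rw [indicator_of_mem hmem, Pi.one_apply, mul_one] at hx'
  exact hω.ne_zero _ ha hx'

open Classical in
/-- The weighted composition operator `f ↦ a • f ∘ φ` (zero unless `a`, `φ` are measurable). -/
def wcomp (a : ℝ → ℝ≥0) (φ : ℝ → ℝ) (f : Meas 𝕜) : Meas 𝕜 :=
  if h : Measurable a ∧ Measurable φ then
    AEEqFun.mk (fun x => (((a x : ℝ)) : 𝕜) * f (φ x))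
      (((RCLike.measurable_ofReal.comp (measurable_coe_nnreal_real.comp h.1)).mul
        (f.stronglyMeasurable.measurable.comp h.2)).aestronglyMeasurable)
  else 0

theorem GaugeClass.coeFn_wcomp {ω : ℝ≥0 → ℝ≥0∞} {M : ℝ≥0∞} {a : ℝ → ℝ≥0} {φ : ℝ → ℝ}
    (h : GaugeClass ω M a φ) (f : Meas 𝕜) :
    wcomp a φ f =ᵐ[halfLine] fun x => ((a x : ℝ) : 𝕜) * f (φ x) := by
  rw [wcomp, dif_pos ⟨h.measurable_weight, h.measurable_map⟩]
  exact AEEqFun.coeFn_mk _ _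

theorem GaugeClass.enorm_wcomp {ω : ℝ≥0 → ℝ≥0∞} {M : ℝ≥0∞} {a : ℝ → ℝ≥0} {φ : ℝ → ℝ}
    (h : GaugeClass ω M a φ) (f : Meas 𝕜) :
    ∀ᵐ x ∂halfLine, ‖wcomp a φ f x‖ₑ = a x * ‖f (φ x)‖ₑ := by
  filter_upwards [h.coeFn_wcomp f] with x hx
  rw [hx, enorm_mul]
  congr 1
  rw [← ofReal_norm, RCLike.norm_ofReal, NNReal.abs_eq, ENNReal.ofReal_coe_nnreal]

/-- The weighted composition operator as a linear map. -/
def GaugeClass.toLinearMap (𝕜 : Type*) [RCLike 𝕜] {ω : ℝ≥0 → ℝ≥0∞} {M : ℝ≥0∞} {a : ℝ → ℝ≥0}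
    {φ : ℝ → ℝ} (h : GaugeClass ω M a φ) (hω : IsGauge ω M) : Meas 𝕜 →ₗ[𝕜] Meas 𝕜 where
  toFun := wcomp a φ
  map_add' f g := by
    apply AEEqFun.ext
    filter_upwards [h.coeFn_wcomp f, h.coeFn_wcomp g, h.coeFn_wcomp (f + g),
      AEEqFun.coeFn_add (wcomp a φ f) (wcomp a φ g),
      h.ae_comp hω (AEEqFun.coeFn_add f g)] with x h1 h2 h3 h4 h5
    rw [h3, h4, Pi.add_apply, h1, h2]
    by_cases ha : a x = 0
    · simp [ha]
    · rw [h5 ha, Pi.add_apply, mul_add]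
  map_smul' c f := by
    apply AEEqFun.ext
    filter_upwards [h.coeFn_wcomp f, h.coeFn_wcomp (c • f),
      AEEqFun.coeFn_smul c (wcomp a φ f), h.ae_comp hω (AEEqFun.coeFn_smul c f)]
      with x h1 h3 h4 h5
    rw [RingHom.id_apply, h3, h4, Pi.smul_apply, h1]
    by_cases ha : a x = 0
    · simp [ha]
    · rw [h5 ha, Pi.smul_apply, smul_eq_mul, smul_eq_mul, mul_left_comm]

/-! ### Gluing operators along blocks and uniform boundedness -/

/-- The index of the block containing `x` in a partition of the half-line into countably many
sets of infinite measure. -/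
def blockIndex (x : ℝ) : ℕ := (Nat.unpair ⌊x⌋₊).1

/-- A partition of the half-line into countably many sets of infinite measure. -/
def block (n : ℕ) : Set ℝ := blockIndex ⁻¹' {n}

theorem measurable_blockIndex : Measurable blockIndex := by
  have h : Measurable fun k : ℕ => (Nat.unpair k).1 := measurable_from_top
  exact h.comp Nat.measurable_floor

theorem measurableSet_block (n : ℕ) : MeasurableSet (block n) :=
  measurable_blockIndex (measurableSet_singleton n)

theorem pairwise_disjoint_block : Pairwise (Function.onFun Disjoint block) := fun i j hij =>
  Disjoint.preimage _ (by simpa using hij)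

theorem iUnion_block : ⋃ n, block n = univ := by
  ext x
  simp [block]

/-- The block contains the disjoint unit intervals starting at `Nat.pair n k` for all k. -/
theorem halfLine_block (n : ℕ) : halfLine (block n) = ∞ := by
  have hsub : (⋃ k : ℕ, Ioo (Nat.pair n k : ℝ) (Nat.pair n k + 1)) ⊆ block n ∩ Ioi 0 := by
    refine iUnion_subset fun k x hx => ⟨?_, ?_⟩
    · have h0 : (0 : ℝ) ≤ x := (Nat.cast_nonneg _).trans hx.1.le
      have : ⌊x⌋₊ = Nat.pair n k := (Nat.floor_eq_iff h0).2 ⟨hx.1.le, hx.2⟩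
      simp [block, blockIndex, this]
    · exact (Nat.cast_nonneg _).trans_lt hx.1
  have hd : Pairwise (Function.onFun Disjoint
      fun k : ℕ => Ioo (Nat.pair n k : ℝ) (Nat.pair n k + 1)) := by
    intro i j hij
    refine Set.disjoint_left.2 fun x hx hy => hij ?_
    have h0 : (0 : ℝ) ≤ x := (Nat.cast_nonneg _).trans hx.1.le
    have h1 := (Nat.floor_eq_iff h0).2 ⟨hx.1.le, hx.2⟩
    have h2 := (Nat.floor_eq_iff h0).2 ⟨hy.1.le, hy.2⟩
    exact (Nat.pair_eq_pair.1 (h1.symm.trans h2)).2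
  rw [Measure.restrict_apply (measurableSet_block n), eq_top_iff]
  refine le_trans ?_ (measure_mono hsub)
  rw [measure_iUnion hd fun k => measurableSet_Ioo]
  simp [Real.volume_Ioo]

/-- Lebesgue measure on a block. -/
abbrev blockMeasure (n : ℕ) : Measure ℝ := halfLine.restrict (block n)

theorem isHeadFinite_blockMeasure (n : ℕ) : IsHeadFinite (blockMeasure n) :=
  isHeadFinite_restrict _

theorem massInterval_blockMeasure (n : ℕ) : massInterval (blockMeasure n) = Ioi 0 := by
  ext s
  simp only [massInterval, Measure.restrict_apply_univ, halfLine_block]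
  simp

theorem map_cumul_block (n : ℕ) : (blockMeasure n).map (cumul (blockMeasure n)) = halfLine := by
  rw [(isHeadFinite_blockMeasure n).map_cumul, massInterval_blockMeasure]

theorem map_quantile_block (n : ℕ) :
    halfLine.map (quantile (blockMeasure n)) = blockMeasure n := by
  have := (isHeadFinite_blockMeasure n).map_quantile
  rwa [massInterval_blockMeasure] at this

theorem measurable_cumul_block (n : ℕ) : Measurable (cumul (blockMeasure n)) :=
  (isHeadFinite_blockMeasure n).continuous_cumul.measurable

theorem measurable_quantile_block (n : ℕ) : Measurable (quantile (blockMeasure n)) :=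
  (isHeadFinite_blockMeasure n).measurable_quantile

theorem lintegral_cumul_block (n : ℕ) {w : ℝ → ℝ≥0∞} (hw : Measurable w) :
    ∫⁻ x in block n, w (cumul (blockMeasure n) x) ∂halfLine = ∫⁻ x, w x ∂halfLine := by
  rw [← lintegral_map hw (measurable_cumul_block n), map_cumul_block]

theorem lintegral_quantile_block (n : ℕ) {w : ℝ → ℝ≥0∞} (hw : Measurable w) :
    ∫⁻ x, w (quantile (blockMeasure n) x) ∂halfLine = ∫⁻ x in block n, w x ∂halfLine := by
  rw [← lintegral_map hw (measurable_quantile_block n), map_quantile_block]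

theorem ae_quantile_mem_block (n : ℕ) :
    ∀ᵐ s ∂halfLine, quantile (blockMeasure n) s ∈ block n := by
  have h1 : ∀ᵐ x ∂(halfLine.map (quantile (blockMeasure n))), x ∈ block n := by
    rw [map_quantile_block]
    exact ae_restrict_mem (measurableSet_block n)
  exact ae_of_ae_map (measurable_quantile_block n).aemeasurable h1

theorem cumul_quantile_block (n : ℕ) {s : ℝ} (hs : 0 < s) :
    cumul (blockMeasure n) (quantile (blockMeasure n) s) = s :=
  (isHeadFinite_blockMeasure n).cumul_quantile (by rw [massInterval_blockMeasure]; exact hs)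

theorem ae_pos : ∀ᵐ s ∂halfLine, 0 < s := ae_restrict_mem measurableSet_Ioi

section Gluing

variable {ω : ℝ≥0 → ℝ≥0∞} {M : ℝ≥0∞}

/-- The operator that copies a function on the half-line onto the n-th block, which is isomorphic to
the half-line through `cumul`. -/
theorem gaugeClass_spread (hω : IsGauge ω M) (n : ℕ) :
    GaugeClass ω M ((block n).indicator 1) (cumul (blockMeasure n)) where
  measurable_weight := measurable_one.indicator (measurableSet_block n)
  measurable_map := measurable_cumul_block n
  weight_le x := by
    by_cases hx : x ∈ block n <;> simp [hx, hω.one_le_bound]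
  lintegral_le w hw := by
    rw [← lintegral_cumul_block n hw, ← lintegral_indicator (measurableSet_block n)]
    refine lintegral_mono fun x => ?_
    by_cases hx : x ∈ block n
    · simpa [hx] using mul_le_mul_left hω.one_le (w (cumul (blockMeasure n) x))
    · simp [hx, hω.zero]

/-- The operator that reads the n-th block back as a function on the whole half-line. -/
theorem gaugeClass_gather (hω : IsGauge ω M) (n : ℕ) :
    GaugeClass ω M 1 (quantile (blockMeasure n)) where
  measurable_weight := measurable_one
  measurable_map := measurable_quantile_block n
  weight_le x := by simpa using hω.one_le_bound
  lintegral_le w hw := by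
    refine le_trans ?_ (setLIntegral_le_lintegral (block n) w)
    rw [← lintegral_quantile_block n hw]
    refine lintegral_mono fun x => ?_
    simpa using mul_le_mul_left hω.one_le (w (quantile (blockMeasure n) x))

/-- The weight obtained by transplanting `a n` to the `n`-th block. -/
def glueWeight (a : ℕ → ℝ → ℝ≥0) (x : ℝ) : ℝ≥0 :=
  a (blockIndex x) (cumul (blockMeasure (blockIndex x)) x)

/-- The map obtained by transplanting `φ n` to the `n`-th block. -/
def glueMap (φ : ℕ → ℝ → ℝ) (x : ℝ) : ℝ :=
  quantile (blockMeasure (blockIndex x))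
    (φ (blockIndex x) (cumul (blockMeasure (blockIndex x)) x))

/-- The weight bound is pointwise, and the integral condition holds block by block and sums over
disjoint blocks. So a gauge class is closed under placing countably many of its members side by
side, with the same constants. -/
theorem gaugeClass_glue (hω : IsGauge ω M) {a : ℕ → ℝ → ℝ≥0} {φ : ℕ → ℝ → ℝ}
    (h : ∀ n, GaugeClass ω M (a n) (φ n)) : GaugeClass ω M (glueWeight a) (glueMap φ) where
  measurable_weight := measurable_comp_index
    (fun n => (h n).measurable_weight.comp (measurable_cumul_block n)) measurable_blockIndex
  measurable_map := measurable_comp_index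
    (fun n => (measurable_quantile_block n).comp
      ((h n).measurable_map.comp (measurable_cumul_block n))) measurable_blockIndex
  weight_le x := (h _).weight_le _
  lintegral_le w hw := by
    have hn : ∀ n, ∫⁻ x in block n, ω (glueWeight a x) * w (glueMap φ x) ∂halfLine ≤
        ∫⁻ x in block n, w x ∂halfLine := by
      intro n
      have h1 : ∫⁻ x in block n, ω (glueWeight a x) * w (glueMap φ x) ∂halfLine =
          ∫⁻ s, ω (a n s) * w (quantile (blockMeasure n) (φ n s)) ∂halfLine := by
        have hm : Measurable fun s => ω (a n s) * w (quantile (blockMeasure n) (φ n s)) :=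
          (hω.measurable.comp (h n).measurable_weight).mul
            (hw.comp ((measurable_quantile_block n).comp (h n).measurable_map))
        rw [← lintegral_cumul_block n hm]
        refine setLIntegral_congr_fun (measurableSet_block n) fun x hx => ?_
        have hx' : blockIndex x = n := hx
        simp only [glueWeight, glueMap, hx']
      rw [h1, ← lintegral_quantile_block n hw]
      exact (h n).lintegral_le _ (hw.comp (measurable_quantile_block n))
    calc ∫⁻ x, ω (glueWeight a x) * w (glueMap φ x) ∂halfLine
        = ∑' n, ∫⁻ x in block n, ω (glueWeight a x) * w (glueMap φ x) ∂halfLine := by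
          rw [← lintegral_iUnion measurableSet_block pairwise_disjoint_block, iUnion_block,
            setLIntegral_univ]
      _ ≤ ∑' n, ∫⁻ x in block n, w x ∂halfLine := ENNReal.tsum_le_tsum hn
      _ = ∫⁻ x, w x ∂halfLine := by
          rw [← lintegral_iUnion measurableSet_block pairwise_disjoint_block, iUnion_block,
            setLIntegral_univ]

theorem wcomp_gather_glue_spread (hω : IsGauge ω M) {a : ℕ → ℝ → ℝ≥0} {φ : ℕ → ℝ → ℝ}
    (h : ∀ n, GaugeClass ω M (a n) (φ n)) (n : ℕ) (f : Meas 𝕜) :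
    wcomp 1 (quantile (blockMeasure n)) (wcomp (glueWeight a) (glueMap φ)
      (wcomp ((block n).indicator 1) (cumul (blockMeasure n)) f)) = wcomp (a n) (φ n) f := by
  have hP := gaugeClass_spread hω n
  have hQ := gaugeClass_gather hω n
  have hT := gaugeClass_glue hω h
  set Pf := wcomp ((block n).indicator 1) (cumul (blockMeasure n)) f with hPf
  apply AEEqFun.ext
  filter_upwards [hQ.coeFn_wcomp (wcomp (glueWeight a) (glueMap φ) Pf),
    hQ.ae_comp hω (hT.coeFn_wcomp Pf),
    hQ.ae_comp hω (hT.ae_comp hω (hP.coeFn_wcomp f)), (h n).coeFn_wcomp f,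
    ae_quantile_mem_block n, ae_pos, (h n).ae_comp hω (ae_quantile_mem_block n),
    (h n).ae_comp hω ae_pos] with s h1 h2 h3 h4 h5 h6 h7 h8
  have h2' := h2 (by simp)
  have h3' := h3 (by simp)
  have hidx : blockIndex (quantile (blockMeasure n) s) = n := h5
  have hw : glueWeight a (quantile (blockMeasure n) s) = a n s := by
    simp only [glueWeight, hidx, cumul_quantile_block n h6]
  have hm : glueMap φ (quantile (blockMeasure n) s) = quantile (blockMeasure n) (φ n s) := by
    simp only [glueMap, hidx, cumul_quantile_block n h6]
  rw [h1, h2', h4, hw]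
  by_cases ha : a n s = 0
  · simp [ha]
  · rw [h3' (by rwa [hw]), hm, cumul_quantile_block n (h8 ha), indicator_of_mem (h7 ha)]
    simp

/-- `T` maps `E` to itself with norm at most `K`. -/
def QuasiBanachFunctionSpace.BoundedBy (E : QuasiBanachFunctionSpace 𝕜) (T : Meas 𝕜 → Meas 𝕜)
    (K : ℝ) : Prop :=
  ∀ f ∈ E.carrier, T f ∈ E.carrier ∧ E.qnorm (T f) ≤ K * E.qnorm f

theorem QuasiBanachFunctionSpace.BoundedBy.mono {E : QuasiBanachFunctionSpace 𝕜}
    {T : Meas 𝕜 → Meas 𝕜} {K L : ℝ} (h : E.BoundedBy T K) (hKL : K ≤ L) : E.BoundedBy T L :=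
  fun f hf => ⟨(h f hf).1, (h f hf).2.trans
    (mul_le_mul_of_nonneg_right hKL (E.qnorm_nonneg f hf))⟩

/-- If all weighted composition operators of a gauge class are bounded on `E`, then they are
uniformly bounded. -/
theorem exists_uniform_bound (E : QuasiBanachFunctionSpace 𝕜) (hω : IsGauge ω M)
    (hE : ∀ a φ, GaugeClass ω M a φ → ∃ K, E.BoundedBy (wcomp a φ) K) :
    ∃ K, 0 ≤ K ∧ ∀ a φ, GaugeClass ω M a φ → E.BoundedBy (wcomp a φ) K := by
  by_contra! hcon
  have hE' : ∀ a φ, GaugeClass ω M a φ → ∃ K, 0 ≤ K ∧ E.BoundedBy (wcomp a φ) K := by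
    intro a φ h
    obtain ⟨K, hK⟩ := hE a φ h
    exact ⟨max K 0, le_max_right _ _, hK.mono (le_max_left _ _)⟩
  choose P hP0 hP using fun n => hE' _ _ (gaugeClass_spread hω n)
  choose Q hQ0 hQ using fun n => hE' _ _ (gaugeClass_gather hω n)
  -- P n and Q n bound the spread and gather operators of block n. Violating this product bound
  -- forces the glued operator to have norm at least n, for every n.
  choose a φ h hn using fun n : ℕ => hcon (Q n * (n * P n))
    (mul_nonneg (hQ0 n) (mul_nonneg n.cast_nonneg (hP0 n)))
  obtain ⟨K, hK0, hK⟩ := hE' _ _ (gaugeClass_glue hω h)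
  obtain ⟨n, hKn⟩ := exists_nat_ge K
  apply hn n
  intro f hf
  rw [← wcomp_gather_glue_spread hω h n f]
  obtain ⟨m1, e1⟩ := hP n f hf
  obtain ⟨m2, e2⟩ := hK _ m1
  obtain ⟨m3, e3⟩ := hQ n _ m2
  refine ⟨m3, e3.trans ?_⟩
  rw [mul_assoc]
  refine mul_le_mul_of_nonneg_left ?_ (hQ0 n)
  refine e2.trans ?_
  rw [mul_assoc]
  exact mul_le_mul hKn e1 (E.qnorm_nonneg _ m1) n.cast_nonneg

end Gluing

/-! ### Transport between decreasing densities -/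

theorem setLIntegral_Iic_halfLine (k : ℝ → ℝ≥0∞) (x : ℝ) :
    ∫⁻ s in Iic x, k s ∂halfLine = ∫⁻ s in Ioc 0 x, k s := by
  rw [Measure.restrict_restrict measurableSet_Iic, inter_comm, Ioi_inter_Iic]

theorem withDensity_Iic (k : ℝ → ℝ≥0∞) (x : ℝ) :
    halfLine.withDensity k (Iic x) = ∫⁻ s in Ioc 0 x, k s := by
  rw [withDensity_apply _ measurableSet_Iic, setLIntegral_Iic_halfLine]

theorem isHeadFinite_withDensity {k : ℝ → ℝ≥0∞} (hk : ∀ x, 0 < x → ∫⁻ s in Ioc 0 x, k s < ∞) :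
    IsHeadFinite (halfLine.withDensity k) where
  noAtoms x := withDensity_absolutelyContinuous _ _ (measure_singleton x)
  Iic_zero := by rw [withDensity_Iic, Ioc_self, setLIntegral_empty]
  Iic_lt_top x := by
    rw [withDensity_Iic]
    rcases le_or_gt x 0 with hx | hx
    · simp [Ioc_eq_empty (not_lt.2 hx)]
    · exact hk x hx

/-- The inversion of the half-line exchanges tails and heads, so the transport of head-finite
measures also serves densities integrable only away from 0. -/
theorem map_inv_withDensity_Iic (k : ℝ → ℝ≥0∞) {x : ℝ} (hx : 0 < x) :
    (halfLine.withDensity k).map Inv.inv (Iic x⁻¹) = ∫⁻ s in Ioi x, k s := by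
  rw [Measure.map_apply measurable_inv measurableSet_Iic,
    withDensity_apply _ (measurable_inv measurableSet_Iic),
    Measure.restrict_restrict (measurable_inv measurableSet_Iic)]
  have : (Inv.inv ⁻¹' Iic x⁻¹ ∩ Ioi 0 : Set ℝ) = Ici x := by
    ext y
    simp only [mem_inter_iff, mem_preimage, mem_Iic, mem_Ioi, mem_Ici]
    constructor
    · rintro ⟨h1, h2⟩
      exact (inv_le_inv₀ h2 hx).1 h1
    · intro h1
      exact ⟨(inv_le_inv₀ (hx.trans_le h1) hx).2 h1, hx.trans_le h1⟩
  rw [this]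
  exact setLIntegral_congr Ioi_ae_eq_Ici.symm

theorem isHeadFinite_map_inv {k : ℝ → ℝ≥0∞} (hk : ∀ x, 0 < x → ∫⁻ s in Ioi x, k s < ∞) :
    IsHeadFinite ((halfLine.withDensity k).map Inv.inv) where
  noAtoms x := by
    rw [Measure.map_apply measurable_inv (measurableSet_singleton x)]
    refine withDensity_absolutelyContinuous _ _ ?_
    have : (Inv.inv ⁻¹' {x} : Set ℝ) = {x⁻¹} := by
      ext y
      simp
    rw [this]
    exact measure_singleton _
  Iic_zero := by
    rw [Measure.map_apply measurable_inv measurableSet_Iic]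
    refine withDensity_absolutelyContinuous _ _ ?_
    rw [Measure.restrict_apply (measurable_inv measurableSet_Iic)]
    have : (Inv.inv ⁻¹' Iic 0 ∩ Ioi 0 : Set ℝ) = ∅ := by
      ext y
      simp
    rw [this, measure_empty]
  Iic_lt_top x := by
    have h1 : (0 : ℝ) < max x 1 := lt_max_of_lt_right one_pos
    refine (measure_mono (Iic_subset_Iic.2 (le_max_left x 1))).trans_lt ?_
    rw [← inv_inv (max x 1), map_inv_withDensity_Iic k (inv_pos.2 h1)]
    exact hk _ (inv_pos.2 h1)

theorem ofReal_mul_le_lintegral_Ioc {k : ℝ → ℝ≥0∞} (hk : Antitone k) {x : ℝ} (y : ℝ) :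
    ENNReal.ofReal (x - y) * k x ≤ ∫⁻ s in Ioc y x, k s := by
  calc ENNReal.ofReal (x - y) * k x = ∫⁻ _ in Ioc y x, k x := by
        rw [setLIntegral_const, Real.volume_Ioc, mul_comm]
    _ ≤ ∫⁻ s in Ioc y x, k s :=
        setLIntegral_mono' measurableSet_Ioc fun s hs => hk hs.2

theorem lintegral_Ioc_le_ofReal_mul {k : ℝ → ℝ≥0∞} (hk : Antitone k) {x : ℝ} (y : ℝ) :
    ∫⁻ s in Ioc y x, k s ≤ ENNReal.ofReal (x - y) * k y := by
  calc ∫⁻ s in Ioc y x, k s ≤ ∫⁻ _ in Ioc y x, k y :=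
        setLIntegral_mono' measurableSet_Ioc fun s hs => hk hs.1.le
    _ = ENNReal.ofReal (x - y) * k y := by
        rw [setLIntegral_const, Real.volume_Ioc, mul_comm]

theorem ne_top_of_head_lt_top {k : ℝ → ℝ≥0∞} (hk : Antitone k)
    (hfin : ∀ x, 0 < x → ∫⁻ s in Ioc 0 x, k s < ∞) {x : ℝ} (hx : 0 < x) : k x ≠ ∞ := by
  intro h
  have h1 := (ofReal_mul_le_lintegral_Ioc hk (x := x) 0).trans_lt (hfin x hx)
  rw [h, sub_zero, ENNReal.mul_top (by simpa using hx)] at h1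
  exact lt_irrefl _ h1

theorem ne_top_of_tail_lt_top {k : ℝ → ℝ≥0∞} (hk : Antitone k)
    (hfin : ∀ x, 0 < x → ∫⁻ s in Ioi x, k s < ∞) {x : ℝ} (hx : 0 < x) : k x ≠ ∞ := by
  intro h
  have h1 := ((ofReal_mul_le_lintegral_Ioc hk (x := x) (x / 2)).trans
    (lintegral_mono_set Ioc_subset_Ioi_self)).trans_lt (hfin (x / 2) (by positivity))
  rw [h, ENNReal.mul_top (by simpa using hx)] at h1
  exact lt_irrefl _ h1

/-- Head transport: where the primitive of `k` is at most `C` times that of `l`, the measure `k dx`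
is carried into `2 C l dx` by a map along which `l` dominates `k / (2 C)`. -/
theorem exists_head_transport {k l : ℝ → ℝ≥0∞} (hk : Antitone k) (hl : Antitone l)
    (hkf : ∀ x, 0 < x → ∫⁻ s in Ioc 0 x, k s < ∞) (hlf : ∀ x, 0 < x → ∫⁻ s in Ioc 0 x, l s < ∞)
    {C : ℝ≥0} (hC : 1 ≤ C) {U : Set ℝ}
    (hU : ∀ x ∈ U, 0 < x ∧ k x ≠ 0 ∧ ∫⁻ s in Ioc 0 x, k s ≤ C * ∫⁻ s in Ioc 0 x, l s) :
    ∃ φ : ℝ → ℝ, Measurable φ ∧ (∀ x ∈ U, 0 < φ x ∧ k x ≤ 2 * C * l (φ x)) ∧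
      ∀ w : ℝ → ℝ≥0∞, Measurable w →
        ∫⁻ x in U, k x * w (φ x) ∂halfLine ≤ 2 * C * ∫⁻ x, l x * w x ∂halfLine := by
  have h₁ := isHeadFinite_withDensity hkf
  have h₂ := isHeadFinite_withDensity hlf
  set ρ₁ := halfLine.withDensity k
  set ρ₂ := halfLine.withDensity l
  have hC0 : (0 : ℝ) < C := lt_of_lt_of_le one_pos hC
  have hc : (0 : ℝ) < 2 * C := by positivity
  have hcr₁ : ∀ x, cumul ρ₁ x = (∫⁻ s in Ioc 0 x, k s).toReal := fun x => by
    rw [cumul, withDensity_Iic]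
  have hcr₂ : ∀ x, cumul ρ₂ x = (∫⁻ s in Ioc 0 x, l s).toReal := fun x => by
    rw [cumul, withDensity_Iic]
  have hle : ∀ x ∈ U, cumul ρ₁ x ≤ C * cumul ρ₂ x := by
    intro x hx
    obtain ⟨h0, -, h1⟩ := hU x hx
    rw [hcr₁, hcr₂]
    have := ENNReal.toReal_mono (ENNReal.mul_ne_top ENNReal.coe_ne_top (hlf x h0).ne) h1
    simpa using this
  have hxk : ∀ x ∈ U, x * (k x).toReal ≤ cumul ρ₁ x := by
    intro x hx
    obtain ⟨h0, -, -⟩ := hU x hx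
    have h1 := ofReal_mul_le_lintegral_Ioc hk (x := x) 0
    have := ENNReal.toReal_mono (hkf x h0).ne h1
    rw [hcr₁]
    simpa [ENNReal.toReal_mul, ENNReal.toReal_ofReal h0.le] using this
  have hkpos : ∀ x ∈ U, 0 < (k x).toReal := fun x hx =>
    ENNReal.toReal_pos (hU x hx).2.1 (ne_top_of_head_lt_top hk hkf (hU x hx).1)
  have hpos : ∀ x ∈ U, 0 < cumul ρ₁ x := fun x hx =>
    (mul_pos (hU x hx).1 (hkpos x hx)).trans_le (hxk x hx)
  -- C comes from the hypothesis. The extra 2 makes the inequality strict, so that the quantile is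
  -- not a default value, and places φ x far enough to the left of x to leave a definite amount of
  -- l-mass between them.
  have hlt : ∀ x ∈ U, cumul ρ₁ x / (2 * C) < cumul ρ₂ x := by
    intro x hx
    rw [div_lt_iff₀ hc]
    nlinarith [hle x hx, hpos x hx]
  have hmem : ∀ x ∈ U, cumul ρ₁ x / (2 * C) ∈ massInterval ρ₂ := by
    intro x hx
    have h0 := div_pos (hpos x hx) hc
    exact ⟨h0, ((ENNReal.ofReal_lt_ofReal_iff_of_nonneg h0.le).2 (hlt x hx)).trans_le
      (h₂.ofReal_cumul_le x)⟩
  refine ⟨transport ρ₁ ρ₂ (2 * C), measurable_transport h₁ h₂ _, fun x hx => ?_, fun w hw => ?_⟩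
  · have hφ0 : 0 < transport ρ₁ ρ₂ (2 * C) x := h₂.quantile_pos (hmem x hx)
    refine ⟨hφ0, ?_⟩
    have hφx : transport ρ₁ ρ₂ (2 * C) x ≤ x := (h₂.quantile_le_iff (hmem x hx)).2 (hlt x hx).le
    have hcφ : cumul ρ₂ (transport ρ₁ ρ₂ (2 * C) x) = cumul ρ₁ x / (2 * C) :=
      h₂.cumul_quantile (hmem x hx)
    set y := transport ρ₁ ρ₂ (2 * C) x
    have hly : l y ≠ ∞ := ne_top_of_head_lt_top hl hlf hφ0
    have h1 : cumul ρ₂ x - cumul ρ₂ y ≤ (x - y) * (l y).toReal := by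
      have h2 : ENNReal.ofReal (cumul ρ₂ x - cumul ρ₂ y) ≤ ENNReal.ofReal (x - y) * l y := by
        rw [← h₂.Ioc_eq hφx, withDensity_apply _ measurableSet_Ioc,
          Measure.restrict_restrict measurableSet_Ioc]
        exact (lintegral_mono_set inter_subset_left).trans (lintegral_Ioc_le_ofReal_mul hl y)
      rw [← ENNReal.ofReal_toReal hly, ← ENNReal.ofReal_mul (sub_nonneg.2 hφx)] at h2
      exact (ENNReal.ofReal_le_ofReal_iff
        (mul_nonneg (sub_nonneg.2 hφx) ENNReal.toReal_nonneg)).1 h2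
    have hx0 := (hU x hx).1
    have h3 : C * cumul ρ₂ y = cumul ρ₁ x / 2 := by
      rw [hcφ]
      field_simp
    -- With y = φ x and cumulative masses K, Λ of k, l: C (Λ x - Λ y) ≥ K x / 2 ≥ x k(x) / 2,
    -- whereas monotonicity of l gives Λ x - Λ y ≤ (x - y) l(y) ≤ x l(y).
    have h4 : x * (k x).toReal ≤ x * (2 * C * (l y).toReal) := by
      have h5 : (C : ℝ) * ((x - y) * (l y).toReal) ≤ C * (x * (l y).toReal) := by
        gcongr
        linarith
      have h6 := mul_le_mul_of_nonneg_left h1 hC0.le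
      nlinarith [hxk x hx, hle x hx]
    have h7 : (k x).toReal ≤ 2 * C * (l y).toReal := le_of_mul_le_mul_left h4 hx0
    rw [← ENNReal.ofReal_toReal (ne_top_of_head_lt_top hk hkf hx0), ← ENNReal.ofReal_toReal hly]
    refine (ENNReal.ofReal_le_ofReal h7).trans (le_of_eq ?_)
    rw [ENNReal.ofReal_mul hc.le, ENNReal.ofReal_mul zero_le_two, ENNReal.ofReal_ofNat,
      ENNReal.ofReal_coe_nnreal]
  · have h3 := lintegral_transport_le h₁ h₂ hc (U := U) (.of_forall hmem) hw
    rw [ENNReal.ofReal_mul zero_le_two, ENNReal.ofReal_ofNat, ENNReal.ofReal_coe_nnreal,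
      lintegral_withDensity_eq_lintegral_mul _ hl.measurable hw] at h3
    refine le_of_eq_of_le ?_ h3
    have hwt : Measurable fun x => w (transport ρ₁ ρ₂ (2 * C) x) :=
      hw.comp (measurable_transport h₁ h₂ _)
    rw [restrict_withDensity', lintegral_withDensity_eq_lintegral_mul _ hk.measurable hwt]
    rfl

/-- Tail transport: where the tail integral of `k` is at most `C` times that of `l`, the measure
`k dx` is carried into `2 C l dx` by a map that moves points to the right. -/
theorem exists_tail_transport {k l : ℝ → ℝ≥0∞} (hk : Antitone k) (hl : Antitone l)
    (hkf : ∀ x, 0 < x → ∫⁻ s in Ioi x, k s < ∞) (hlf : ∀ x, 0 < x → ∫⁻ s in Ioi x, l s < ∞)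
    {C : ℝ≥0} (hC : 1 ≤ C) {U : Set ℝ}
    (hU : ∀ x ∈ U, 0 < x ∧ ∫⁻ s in Ioi x, k s ≠ 0 ∧
      ∫⁻ s in Ioi x, k s ≤ C * ∫⁻ s in Ioi x, l s) :
    ∃ φ : ℝ → ℝ, Measurable φ ∧ (∀ x ∈ U, x ≤ φ x) ∧
      ∀ w : ℝ → ℝ≥0∞, Measurable w →
        ∫⁻ x in U, k x * w (φ x) ∂halfLine ≤ 2 * C * ∫⁻ x, l x * w x ∂halfLine := by
  have h₁ := isHeadFinite_map_inv hkf
  have h₂ := isHeadFinite_map_inv hlf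
  set ρ₁ := (halfLine.withDensity k).map Inv.inv
  set ρ₂ := (halfLine.withDensity l).map Inv.inv
  have hC0 : (0 : ℝ) < C := lt_of_lt_of_le one_pos hC
  have hc : (0 : ℝ) < 2 * C := by positivity
  have hcr₁ : ∀ x ∈ U, cumul ρ₁ x⁻¹ = (∫⁻ s in Ioi x, k s).toReal := fun x hx => by
    rw [cumul, map_inv_withDensity_Iic k (hU x hx).1]
  have hcr₂ : ∀ x ∈ U, cumul ρ₂ x⁻¹ = (∫⁻ s in Ioi x, l s).toReal := fun x hx => by
    rw [cumul, map_inv_withDensity_Iic l (hU x hx).1]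
  have hle : ∀ x ∈ U, cumul ρ₁ x⁻¹ ≤ C * cumul ρ₂ x⁻¹ := by
    intro x hx
    obtain ⟨h0, -, h1⟩ := hU x hx
    rw [hcr₁ x hx, hcr₂ x hx]
    have := ENNReal.toReal_mono (ENNReal.mul_ne_top ENNReal.coe_ne_top (hlf x h0).ne) h1
    simpa using this
  have hpos : ∀ x ∈ U, 0 < cumul ρ₁ x⁻¹ := fun x hx => by
    rw [hcr₁ x hx]
    exact ENNReal.toReal_pos (hU x hx).2.1 (hkf x (hU x hx).1).ne
  have hlt : ∀ x ∈ U, cumul ρ₁ x⁻¹ / (2 * C) < cumul ρ₂ x⁻¹ := by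
    intro x hx
    rw [div_lt_iff₀ hc]
    nlinarith [hle x hx, hpos x hx]
  have hmem : ∀ x ∈ U, cumul ρ₁ x⁻¹ / (2 * C) ∈ massInterval ρ₂ := by
    intro x hx
    have h0 := div_pos (hpos x hx) hc
    exact ⟨h0, ((ENNReal.ofReal_lt_ofReal_iff_of_nonneg h0.le).2 (hlt x hx)).trans_le
      (h₂.ofReal_cumul_le _)⟩
  have hτ : Measurable (transport ρ₁ ρ₂ (2 * C)) := measurable_transport h₁ h₂ _
  -- The transport is conjugated by inversion: it moves points to the left in the inverted
  -- coordinate, hence to the right in the original one.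
  refine ⟨fun x => (transport ρ₁ ρ₂ (2 * C) x⁻¹)⁻¹, (hτ.comp measurable_inv).inv,
    fun x hx => ?_, fun w hw => ?_⟩
  · have hφ0 : 0 < transport ρ₁ ρ₂ (2 * C) x⁻¹ := h₂.quantile_pos (hmem x hx)
    have hφx : transport ρ₁ ρ₂ (2 * C) x⁻¹ ≤ x⁻¹ :=
      (h₂.quantile_le_iff (hmem x hx)).2 (hlt x hx).le
    exact (le_inv_comm₀ (hU x hx).1 hφ0).2 hφx
  · have hwi : Measurable fun y => w y⁻¹ := hw.comp measurable_inv
    have hwt : Measurable fun y => w (transport ρ₁ ρ₂ (2 * C) y)⁻¹ := hwi.comp hτ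
    have hwi' : Measurable fun x => w (transport ρ₁ ρ₂ (2 * C) x⁻¹)⁻¹ := hwt.comp measurable_inv
    have hUi : ∀ y ∈ Inv.inv ⁻¹' U, cumul ρ₁ y / (2 * C) ∈ massInterval ρ₂ := by
      intro y hy
      have := hmem _ hy
      rwa [inv_inv] at this
    have h3 := lintegral_transport_le h₁ h₂ hc (U := Inv.inv ⁻¹' U) (.of_forall hUi) hwi
    have hemb : MeasurableEmbedding (Inv.inv : ℝ → ℝ) := (MeasurableEquiv.inv ℝ).measurableEmbedding
    rw [ENNReal.ofReal_mul zero_le_two, ENNReal.ofReal_ofNat, ENNReal.ofReal_coe_nnreal,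
      lintegral_map hwi measurable_inv, hemb.restrict_map, lintegral_map hwt
      measurable_inv] at h3
    simp only [inv_inv] at h3
    rw [lintegral_withDensity_eq_lintegral_mul _ hl.measurable hw] at h3
    have hUU : (Inv.inv ⁻¹' (Inv.inv ⁻¹' U) : Set ℝ) = U := by
      ext y
      simp
    rw [hUU, restrict_withDensity', lintegral_withDensity_eq_lintegral_mul _ hk.measurable
      hwi'] at h3
    exact h3

/-! ### Domination by elements of E -/

/-- The function `|f|` as a `𝕜`-valued function. -/
def absMeas (f : Meas 𝕜) : Meas 𝕜 :=
  AEEqFun.compMeasurable (fun z : 𝕜 => ((‖z‖ : ℝ) : 𝕜))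
    (RCLike.measurable_ofReal.comp measurable_norm) f

theorem coeFn_absMeas (f : Meas 𝕜) :
    absMeas f =ᵐ[halfLine] fun x => ((‖f x‖ : ℝ) : 𝕜) :=
  AEEqFun.coeFn_compMeasurable _ _ f

theorem measurable_enorm_coe (f : Meas 𝕜) : Measurable fun x => ‖f x‖ₑ :=
  f.stronglyMeasurable.enorm

namespace QuasiBanachFunctionSpace

variable {E : QuasiBanachFunctionSpace 𝕜}

/-- The function `w` is dominated by an element of `E` of quasi-norm at most `K`. -/
def Dom (E : QuasiBanachFunctionSpace 𝕜) (w : ℝ → ℝ≥0∞) (K : ℝ) : Prop :=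
  ∃ f ∈ E.carrier, E.qnorm f ≤ K ∧ ∀ᵐ x ∂halfLine, w x ≤ ‖f x‖ₑ

theorem dom_self {f : Meas 𝕜} (hf : f ∈ E.carrier) : E.Dom (fun x => ‖f x‖ₑ) (E.qnorm f) :=
  ⟨f, hf, le_rfl, .of_forall fun _ => le_rfl⟩

theorem Dom.mono {w w' : ℝ → ℝ≥0∞} {K K' : ℝ} (h : E.Dom w K)
    (hw : ∀ᵐ x ∂halfLine, w' x ≤ w x) (hK : K ≤ K') : E.Dom w' K' := by
  obtain ⟨f, hf, h1, h2⟩ := h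
  refine ⟨f, hf, h1.trans hK, ?_⟩
  filter_upwards [h2, hw] with x hx hx'
  exact hx'.trans hx

theorem Dom.mem {g : Meas 𝕜} {K : ℝ} (h : E.Dom (fun x => ‖g x‖ₑ) K) :
    g ∈ E.carrier ∧ E.qnorm g ≤ K := by
  obtain ⟨f, hf, h1, h2⟩ := h
  have h3 := E.solid f hf g (by
    filter_upwards [h2] with x hx
    exact enorm_le_iff_norm_le.1 hx)
  exact ⟨h3.1, h3.2.trans h1⟩

theorem Dom.const_mul {w : ℝ → ℝ≥0∞} {K : ℝ} (h : E.Dom w K) (c : ℝ≥0) :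
    E.Dom (fun x => c * w x) (c * K) := by
  obtain ⟨f, hf, h1, h2⟩ := h
  refine ⟨((c : ℝ) : 𝕜) • f, E.carrier.smul_mem _ hf, ?_, ?_⟩
  · rw [E.qnorm_smul _ f hf, RCLike.norm_ofReal, NNReal.abs_eq]
    exact mul_le_mul_of_nonneg_left h1 c.2
  · filter_upwards [h2, AEEqFun.coeFn_smul ((c : ℝ) : 𝕜) f] with x hx hx'
    rw [hx', Pi.smul_apply, enorm_smul]
    have : ‖((c : ℝ) : 𝕜)‖ₑ = c := by
      rw [← ofReal_norm, RCLike.norm_ofReal, NNReal.abs_eq, ENNReal.ofReal_coe_nnreal]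
    rw [this]
    gcongr

theorem absMeas_mem {f : Meas 𝕜} (hf : f ∈ E.carrier) :
    absMeas f ∈ E.carrier ∧ E.qnorm (absMeas f) ≤ E.qnorm f := by
  refine E.solid f hf _ ?_
  filter_upwards [coeFn_absMeas f] with x hx
  rw [hx, RCLike.norm_ofReal, abs_norm]

/-- The dominating elements are replaced by their absolute values, so that their sum suffers no
cancellation. -/
theorem exists_dom_add (E : QuasiBanachFunctionSpace 𝕜) :
    ∃ C : ℝ, 0 ≤ C ∧ ∀ {w₁ w₂ : ℝ → ℝ≥0∞} {K₁ K₂ : ℝ}, E.Dom w₁ K₁ → E.Dom w₂ K₂ →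
      E.Dom (fun x => w₁ x + w₂ x) (C * (K₁ + K₂)) := by
  obtain ⟨C, hC⟩ := E.quasi_triangle
  refine ⟨max C 0, le_max_right _ _, ?_⟩
  rintro w₁ w₂ K₁ K₂ ⟨f, hf, h1, h2⟩ ⟨g, hg, h3, h4⟩
  obtain ⟨hf1, hf2⟩ := absMeas_mem hf
  obtain ⟨hg1, hg2⟩ := absMeas_mem hg
  refine ⟨absMeas f + absMeas g, E.carrier.add_mem hf1 hg1, ?_, ?_⟩
  · refine (hC _ hf1 _ hg1).trans ?_
    have h5 : 0 ≤ E.qnorm (absMeas f) + E.qnorm (absMeas g) :=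
      add_nonneg (E.qnorm_nonneg _ hf1) (E.qnorm_nonneg _ hg1)
    exact mul_le_mul (le_max_left _ _) (add_le_add (hf2.trans h1) (hg2.trans h3)) h5
      (le_max_right _ _)
  · filter_upwards [h2, h4, AEEqFun.coeFn_add (absMeas f) (absMeas g), coeFn_absMeas f,
      coeFn_absMeas g] with x h2 h4 h5 h6 h7
    rw [h5, Pi.add_apply, h6, h7, ← RCLike.ofReal_add]
    refine (add_le_add h2 h4).trans (le_of_eq ?_)
    rw [← ofReal_norm, ← ofReal_norm, ← ofReal_norm, RCLike.norm_ofReal,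
      ← ENNReal.ofReal_add (norm_nonneg _) (norm_nonneg _),
      abs_of_nonneg (add_nonneg (norm_nonneg _) (norm_nonneg _))]

theorem Dom.wcomp {w : ℝ → ℝ≥0∞} {K L : ℝ} (h : E.Dom w K) {ω : ℝ≥0 → ℝ≥0∞} {M : ℝ≥0∞}
    (hω : IsGauge ω M) {a : ℝ → ℝ≥0} {φ : ℝ → ℝ} (hc : GaugeClass ω M a φ) (hL : 0 ≤ L)
    (hb : E.BoundedBy (LpInterpolation.wcomp a φ) L) :
    E.Dom (fun x => a x * w (φ x)) (L * K) := by
  obtain ⟨f, hf, h1, h2⟩ := h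
  refine ⟨_, (hb f hf).1, (hb f hf).2.trans (mul_le_mul_of_nonneg_left h1 hL), ?_⟩
  filter_upwards [hc.enorm_wcomp f, hc.ae_comp hω h2] with x h3 h4
  rw [h3]
  by_cases ha : a x = 0
  · simp [ha]
  · gcongr
    exact h4 ha

end QuasiBanachFunctionSpace

/-! ### Stability under the head and tail gauge classes -/

/-- The gauge of operators bounded on both `L_p` and `L_∞`. -/
def headGauge (p : ℝ) (C : ℝ≥0) (r : ℝ≥0) : ℝ≥0∞ := (r : ℝ≥0∞) ^ p / C

/-- The gauge of operators bounded on both `L_0` and `L_q`. -/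
def tailGauge (q : ℝ) (C : ℝ≥0) (r : ℝ≥0) : ℝ≥0∞ := ((if r = 0 then 0 else 1) + (r : ℝ≥0∞) ^ q) / C

theorem isGauge_headGauge {p : ℝ} (hp : 0 < p) {C : ℝ≥0} (hC : 1 ≤ C) :
    IsGauge (headGauge p C) C where
  measurable := (measurable_coe_nnreal_ennreal.pow_const p).div_const _
  ne_zero r hr := by simp [headGauge, hr, hp.not_gt]
  zero := by simp [headGauge, hp]
  one_le := by
    simp only [headGauge, ENNReal.coe_one, ENNReal.one_rpow, one_div]
    exact ENNReal.inv_le_one.2 (by exact_mod_cast hC)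
  one_le_bound := by exact_mod_cast hC

theorem isGauge_tailGauge {q : ℝ} (hq : 0 < q) {C : ℝ≥0} (hC : 2 ≤ C) :
    IsGauge (tailGauge q C) ∞ where
  measurable := ((Measurable.ite (measurableSet_singleton 0) measurable_const
    measurable_const).add (measurable_coe_nnreal_ennreal.pow_const q)).div_const _
  ne_zero r hr := by simp [tailGauge, hr]
  zero := by simp [tailGauge, hq]
  one_le := by
    simp only [tailGauge, ENNReal.coe_one, ENNReal.one_rpow, one_ne_zero, if_false,
      one_add_one_eq_two]
    refine ENNReal.div_le_of_le_mul ?_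
    rw [one_mul]
    exact_mod_cast hC
  one_le_bound := le_top

/-- All operators of the head gauge classes are bounded on `E`. -/
def HeadStable (E : QuasiBanachFunctionSpace 𝕜) (p : ℝ) : Prop :=
  ∀ C : ℝ≥0, 1 ≤ C → ∃ K, 0 ≤ K ∧
    ∀ a φ, GaugeClass (headGauge p C) C a φ → E.BoundedBy (wcomp a φ) K

/-- All operators of the tail gauge classes are bounded on `E`. -/
def TailStable (E : QuasiBanachFunctionSpace 𝕜) (q : ℝ) : Prop :=
  ∀ C : ℝ≥0, 2 ≤ C → ∃ K, 0 ≤ K ∧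
    ∀ a φ, GaugeClass (tailGauge q C) ∞ a φ → E.BoundedBy (wcomp a φ) K

/-- `E` is stable under composition with maps that at most double the measure. -/
def SymStable (E : QuasiBanachFunctionSpace 𝕜) : Prop :=
  ∃ K, 0 ≤ K ∧ ∀ (P : Set ℝ) (φ : ℝ → ℝ), MeasurableSet P → Measurable φ →
    (∀ w : ℝ → ℝ≥0∞, Measurable w →
      ∫⁻ x in P, w (φ x) ∂halfLine ≤ 2 * ∫⁻ x, w x ∂halfLine) →
    ∀ w B, E.Dom w B → E.Dom (P.indicator fun x => w (φ x)) (K * B)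

/-- Composition with φ on P is the operator with weight 1 on P and 0 elsewhere; the gauge value of
at most 1/2 at 1 pays for the doubling of measure. -/
theorem symStable_of_gauge {E : QuasiBanachFunctionSpace 𝕜} {ω : ℝ≥0 → ℝ≥0∞} {M : ℝ≥0∞}
    (hω : IsGauge ω M) (h1 : ω 1 ≤ 2⁻¹)
    (h : ∃ K, 0 ≤ K ∧ ∀ a φ, GaugeClass ω M a φ → E.BoundedBy (wcomp a φ) K) : SymStable E := by
  obtain ⟨K, hK0, hK⟩ := h
  refine ⟨K, hK0, fun P φ hP hφ hφ_int w B hw => ?_⟩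
  have hc : GaugeClass ω M (P.indicator 1) φ :=
    { measurable_weight := measurable_one.indicator hP
      measurable_map := hφ
      weight_le := fun x => by by_cases hx : x ∈ P <;> simp [hx, hω.one_le_bound]
      lintegral_le := fun w hw => by
        calc ∫⁻ x, ω (P.indicator 1 x) * w (φ x) ∂halfLine
            ≤ ∫⁻ x, P.indicator (fun x => 2⁻¹ * w (φ x)) x ∂halfLine := by
              refine lintegral_mono fun x => ?_
              by_cases hx : x ∈ P
              · simp only [hx, indicator_of_mem, Pi.one_apply]
                gcongr
              · simp [hx, hω.zero]
          _ = 2⁻¹ * ∫⁻ x in P, w (φ x) ∂halfLine := by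
              rw [lintegral_indicator hP]
              exact lintegral_const_mul _ (hw.comp hφ)
          _ ≤ 2⁻¹ * (2 * ∫⁻ x, w x ∂halfLine) := by gcongr; exact hφ_int w hw
          _ = ∫⁻ x, w x ∂halfLine := by
              rw [← mul_assoc, ENNReal.inv_mul_cancel two_ne_zero ENNReal.ofNat_ne_top, one_mul] }
  refine (hw.wcomp hω hc hK0 (hK _ _ hc)).mono (.of_forall fun x => ?_) le_rfl
  by_cases hx : x ∈ P <;> simp [hx]

theorem HeadStable.symStable {E : QuasiBanachFunctionSpace 𝕜} {p : ℝ} (hp : 0 < p)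
    (h : HeadStable E p) : SymStable E :=
  symStable_of_gauge (isGauge_headGauge hp one_le_two) (by simp [headGauge]) (h 2 one_le_two)

theorem TailStable.symStable {E : QuasiBanachFunctionSpace 𝕜} {q : ℝ} (hq : 0 < q)
    (h : TailStable E q) : SymStable E := by
  -- The tail gauge takes the value 2 / C at 1, so C = 4 gives the required 1/2.
  have h4 : (2 : ℝ≥0) ≤ 4 := by norm_num
  refine symStable_of_gauge (isGauge_tailGauge hq h4) ?_ (h 4 h4)
  simp only [tailGauge, ENNReal.coe_one, ENNReal.one_rpow, one_ne_zero, if_false,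
    one_add_one_eq_two]
  refine ENNReal.div_le_of_le_mul ?_
  have : ((4 : ℝ≥0) : ℝ≥0∞) = 2 * 2 := by norm_num
  rw [this, ← mul_assoc, ENNReal.inv_mul_cancel two_ne_zero ENNReal.ofNat_ne_top, one_mul]

/-- Up to a factor 2, f and its rearrangement are compositions of one another with admissible maps.
With `SymStable.exists_mem_of_dom_rearr`, this reduces questions about E to decreasing functions. -/
theorem SymStable.exists_dom_rearr {E : QuasiBanachFunctionSpace 𝕜} (h : SymStable E) :
    ∃ K, 0 ≤ K ∧ ∀ f ∈ E.carrier, (∀ t, 0 < t → rearr (fun x => ‖f x‖ₑ) t ≠ ∞) →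
      E.Dom (rearr fun x => ‖f x‖ₑ) (K * E.qnorm f) := by
  obtain ⟨K, hK0, hK⟩ := h
  refine ⟨2 * K, by positivity, fun f hf hfin => ?_⟩
  obtain ⟨φ, h1, h2, h3⟩ := exists_rearr_le_comp (measurable_enorm_coe f) hfin
  have hPm : MeasurableSet {t | rearr (fun x => ‖f x‖ₑ) t ≠ 0} :=
    measurable_rearr _ (measurableSet_singleton 0).compl
  have h4 := hK _ φ hPm h1 (fun w hw => (h2 w hw).trans
    (le_mul_of_one_le_left zero_le one_le_two)) _ _ (E.dom_self hf)
  refine (h4.const_mul 2).mono ?_ (le_of_eq (by simp [mul_assoc]))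
  filter_upwards [h3] with t ht
  by_cases h0 : rearr (fun x => ‖f x‖ₑ) t = 0
  · simp [h0]
  · rw [indicator_of_mem (show t ∈ {t | rearr (fun x => ‖f x‖ₑ) t ≠ 0} from h0)]
    exact_mod_cast ht h0

theorem SymStable.exists_mem_of_dom_rearr {E : QuasiBanachFunctionSpace 𝕜} (h : SymStable E) :
    ∃ K, 0 ≤ K ∧ ∀ (g : Meas 𝕜) (B : ℝ), E.Dom (rearr fun x => ‖g x‖ₑ) B →
      g ∈ E.carrier ∧ E.qnorm g ≤ K * B := by
  obtain ⟨K, hK0, hK⟩ := h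
  refine ⟨2 * K, by positivity, fun g B hB => ?_⟩
  obtain ⟨φ, h1, h2, h3⟩ := exists_le_rearr_comp (measurable_enorm_coe g) (fun x => enorm_ne_top)
  have h4 := hK univ φ MeasurableSet.univ h1 (fun w hw => by simpa using h2 w hw) _ _ hB
  apply QuasiBanachFunctionSpace.Dom.mem
  refine (h4.const_mul 2).mono ?_ (le_of_eq (by simp [mul_assoc]))
  filter_upwards [h3] with t ht
  simpa using ht

/-- The function u is recovered from v by the operator with weight a = u / (v ∘ φ), φ being the head
transport of u^p dx into v^p dx. The gauge condition is the transport inequality applied to w / v^p.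
The comparison of integrals is needed only at the points of U, which part (c) exploits. -/
theorem HeadStable.exists_dom_indicator {E : QuasiBanachFunctionSpace 𝕜} {p : ℝ} (hp : 0 < p)
    (h : HeadStable E p) {C : ℝ≥0} (hC : 1 ≤ C) :
    ∃ K, 0 ≤ K ∧ ∀ (u v : ℝ → ℝ≥0∞) (U : Set ℝ) (B : ℝ), Antitone u → Antitone v →
      (∀ x, 0 < x → ∫⁻ s in Ioc 0 x, u s ^ p < ∞) →
      (∀ x, 0 < x → ∫⁻ s in Ioc 0 x, v s ^ p < ∞) → MeasurableSet U →
      (∀ x ∈ U, 0 < x → ∫⁻ s in Ioc 0 x, u s ^ p ≤ C * ∫⁻ s in Ioc 0 x, v s ^ p) →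
      E.Dom v B → E.Dom (U.indicator u) (K * B) := by
  classical
  set D : ℝ≥0 := max (2 * C) ((2 * C) ^ p⁻¹) with hD
  have h2C : 1 ≤ 2 * C := hC.trans (le_mul_of_one_le_left zero_le one_le_two)
  have hD1 : 1 ≤ D := h2C.trans (le_max_left _ _)
  obtain ⟨K, hK0, hK⟩ := h D hD1
  refine ⟨K, hK0, fun u v U B hu hv huf hvf hUm hU hB => ?_⟩
  have hkanti : Antitone fun s => u s ^ p := fun x y hxy => ENNReal.rpow_le_rpow (hu hxy) hp.le
  have hlanti : Antitone fun s => v s ^ p := fun x y hxy => ENNReal.rpow_le_rpow (hv hxy) hp.le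
  set W : Set ℝ := {x | x ∈ U ∧ 0 < x ∧ u x ≠ 0} with hW
  have hWm : MeasurableSet W := hUm.inter
    (measurableSet_Ioi.inter (hu.measurable (measurableSet_singleton 0).compl))
  obtain ⟨φ, hφm, hφ, hφi⟩ := exists_head_transport hkanti hlanti huf hvf hC (U := W)
    (fun x hx => ⟨hx.2.1, by simp [hx.2.2, hp.not_gt], hU x hx.1 hx.2.1⟩)
  have hufin : ∀ x ∈ W, u x ≠ ∞ := fun x hx h0 =>
    ne_top_of_head_lt_top hkanti huf hx.2.1 (by simp [h0, hp])
  have hvfin : ∀ x ∈ W, v (φ x) ≠ ∞ := fun x hx h0 =>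
    ne_top_of_head_lt_top hlanti hvf (hφ x hx).1 (by simp [h0, hp])
  have huv : ∀ x ∈ W, u x ≤ (2 * C : ℝ≥0∞) ^ p⁻¹ * v (φ x) := by
    intro x hx
    have h1 := ENNReal.rpow_le_rpow (hφ x hx).2 (inv_nonneg.2 hp.le)
    rwa [ENNReal.mul_rpow_of_nonneg _ _ (inv_nonneg.2 hp.le), ENNReal.rpow_rpow_inv hp.ne',
      ENNReal.rpow_rpow_inv hp.ne'] at h1
  have hv0 : ∀ x ∈ W, v (φ x) ≠ 0 := by
    intro x hx h0
    have h1 := huv x hx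
    rw [h0, mul_zero, nonpos_iff_eq_zero] at h1
    exact hx.2.2 h1
  set a : ℝ → ℝ≥0 := W.indicator fun x => (u x / v (φ x)).toNNReal with ha
  have haW : ∀ x ∈ W, (a x : ℝ≥0∞) = u x / v (φ x) := by
    intro x hx
    rw [ha, indicator_of_mem hx, ENNReal.coe_toNNReal (ENNReal.div_ne_top (hufin x hx) (hv0 x hx))]
  have ha0 : ∀ x ∉ W, a x = 0 := fun x hx => by rw [ha, indicator_of_notMem hx]
  have hc : GaugeClass (headGauge p D) D a φ :=
    { measurable_weight := (hu.measurable.div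
        (hv.measurable.comp hφm)).ennreal_toNNReal.indicator hWm
      measurable_map := hφm
      weight_le := fun x => by
        by_cases hx : x ∈ W
        · rw [haW x hx]
          refine ENNReal.div_le_of_le_mul ((huv x hx).trans ?_)
          gcongr
          have : ((2 * C : ℝ≥0∞)) ^ p⁻¹ = (((2 * C) ^ p⁻¹ : ℝ≥0) : ℝ≥0∞) := by
            rw [ENNReal.coe_rpow_of_nonneg _ (inv_nonneg.2 hp.le)]
            simp
          rw [this]
          exact_mod_cast le_max_right _ _
        · simp [ha0 x hx]
      lintegral_le := fun w hw => by
        have hD0 : (D : ℝ≥0∞) ≠ 0 := by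
          exact_mod_cast (lt_of_lt_of_le one_pos hD1).ne'
        have hvm : Measurable fun y => w y / v y ^ p := hw.div (hv.measurable.pow_const p)
        calc ∫⁻ x, headGauge p D (a x) * w (φ x) ∂halfLine
            = ∫⁻ x, W.indicator (fun x => (D : ℝ≥0∞)⁻¹ * (u x ^ p * (w (φ x) / v (φ x) ^ p))) x
                ∂halfLine := by
              refine lintegral_congr fun x => ?_
              by_cases hx : x ∈ W
              · rw [indicator_of_mem hx, headGauge, haW x hx, ENNReal.div_rpow_of_nonneg _ _ hp.le]
                simp only [div_eq_mul_inv]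
                ring
              · rw [indicator_of_notMem hx, ha0 x hx]
                simp [headGauge, hp]
          _ = (D : ℝ≥0∞)⁻¹ * ∫⁻ x in W, u x ^ p * (w (φ x) / v (φ x) ^ p) ∂halfLine := by
              rw [lintegral_indicator hWm, lintegral_const_mul]
              exact (hu.measurable.pow_const p).mul (hvm.comp hφm)
          _ ≤ (D : ℝ≥0∞)⁻¹ * (2 * C * ∫⁻ x, v x ^ p * (w x / v x ^ p) ∂halfLine) := by
              gcongr
              exact hφi _ hvm
          _ ≤ (D : ℝ≥0∞)⁻¹ * (D * ∫⁻ x, w x ∂halfLine) := by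
              gcongr
              · exact_mod_cast le_max_left (2 * C) ((2 * C) ^ p⁻¹)
              · exact ENNReal.mul_div_le
          _ = ∫⁻ x, w x ∂halfLine := by
              rw [← mul_assoc, ENNReal.inv_mul_cancel hD0 ENNReal.coe_ne_top, one_mul] }
  refine (hB.wcomp (isGauge_headGauge hp hD1) hc hK0 (hK _ _ hc)).mono ?_ le_rfl
  filter_upwards [ae_pos] with x hx0
  by_cases hxU : x ∈ U
  · rw [indicator_of_mem hxU]
    by_cases hux : u x = 0
    · simp [hux]
    · have hx : x ∈ W := ⟨hxU, hx0, hux⟩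
      rw [haW x hx, ENNReal.div_mul_cancel (hv0 x hx) (hvfin x hx)]
  · simp [hxU]

/-- Where u ≤ v the function v itself dominates. Elsewhere the transport moves points to the right,
so v(φ x) ≤ v x < u x and the weight u / (v ∘ φ) is at least 1. Its q-th power then also controls
the support term of the gauge. -/
theorem TailStable.exists_dom_indicator {E : QuasiBanachFunctionSpace 𝕜} {q : ℝ} (hq : 0 < q)
    (h : TailStable E q) {C : ℝ≥0} (hC : 1 ≤ C) :
    ∃ K, 0 ≤ K ∧ ∀ (u v : ℝ → ℝ≥0∞) (U : Set ℝ) (B : ℝ), Antitone u → Antitone v →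
      (∀ x, 0 < x → ∫⁻ s in Ioi x, u s ^ q < ∞) →
      (∀ x, 0 < x → ∫⁻ s in Ioi x, v s ^ q < ∞) → MeasurableSet U →
      (∀ x ∈ U, 0 < x → ∫⁻ s in Ioi x, u s ^ q ≤ C * ∫⁻ s in Ioi x, v s ^ q) →
      E.Dom v B → E.Dom (U.indicator u) (K * B) := by
  classical
  obtain ⟨A, hA0, hA⟩ := E.exists_dom_add
  -- 2 C comes from the transport, the outer 2 from 1 + a^q ≤ 2 a^q.
  set D : ℝ≥0 := 2 * (2 * C) with hD
  have h2C : 1 ≤ 2 * C := hC.trans (le_mul_of_one_le_left zero_le one_le_two)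
  have hD2 : 2 ≤ D := le_mul_of_one_le_right zero_le h2C
  obtain ⟨K, hK0, hK⟩ := h D hD2
  refine ⟨A * (1 + K), by positivity, fun u v U B hu hv huf hvf hUm hU hB => ?_⟩
  have hkanti : Antitone fun s => u s ^ q := fun x y hxy => ENNReal.rpow_le_rpow (hu hxy) hq.le
  have hlanti : Antitone fun s => v s ^ q := fun x y hxy => ENNReal.rpow_le_rpow (hv hxy) hq.le
  have htail : Antitone fun x => ∫⁻ s in Ioi x, u s ^ q := fun x y hxy =>
    lintegral_mono_set (Ioi_subset_Ioi hxy)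
  set W : Set ℝ := {x | x ∈ U ∧ 0 < x ∧ v x < u x ∧ ∫⁻ s in Ioi x, u s ^ q ≠ 0} with hW
  have hWm : MeasurableSet W := hUm.inter (measurableSet_Ioi.inter
    ((measurableSet_lt hv.measurable hu.measurable).inter
      (htail.measurable (measurableSet_singleton 0).compl)))
  obtain ⟨φ, hφm, hφ, hφi⟩ := exists_tail_transport hkanti hlanti huf hvf hC (U := W)
    (fun x hx => ⟨hx.2.1, hx.2.2.2, hU x hx.1 hx.2.1⟩)
  have hufin : ∀ x ∈ W, u x ≠ ∞ := fun x hx h0 =>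
    ne_top_of_tail_lt_top hkanti huf hx.2.1 (by simp [h0, hq])
  have hvfin : ∀ x ∈ W, v (φ x) ≠ ∞ := fun x hx h0 =>
    ne_top_of_tail_lt_top hlanti hvf (hx.2.1.trans_le (hφ x hx)) (by simp [h0, hq])
  have hvu : ∀ x ∈ W, v (φ x) ≤ u x := fun x hx => (hv (hφ x hx)).trans hx.2.2.1.le
  set Z : Set ℝ := W ∩ {x | v (φ x) ≠ 0} with hZ
  have hvφ : Measurable fun x => v (φ x) := hv.measurable.comp hφm
  have hZm : MeasurableSet Z := hWm.inter (hvφ (measurableSet_singleton 0).compl)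
  -- The transported measure is dominated by a multiple of v^q dx, which does not charge the zeros
  -- of v; so φ avoids them almost everywhere on W.
  have hWZ : ∀ᵐ x ∂halfLine, x ∈ W → x ∈ Z := by
    have hS : MeasurableSet {y | v y = 0} := hv.measurable (measurableSet_singleton 0)
    have hm : Measurable ({y | v y = 0}.indicator (1 : ℝ → ℝ≥0∞)) := measurable_one.indicator hS
    have h1 := hφi _ hm
    have h2 : ∀ x, v x ^ q * {y | v y = 0}.indicator (1 : ℝ → ℝ≥0∞) x = 0 := by
      intro x
      by_cases hx : v x = 0 <;> simp [indicator, hx, hq]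
    simp only [h2, lintegral_zero, mul_zero, nonpos_iff_eq_zero] at h1
    have h3 := (lintegral_eq_zero_iff ((hu.measurable.pow_const q).mul (hm.comp hφm))).1 h1
    rw [EventuallyEq, ae_restrict_iff' hWm] at h3
    filter_upwards [h3] with x hx hxW
    refine ⟨hxW, fun h0 => ?_⟩
    have h4 : u x ^ q * {y | v y = 0}.indicator (1 : ℝ → ℝ≥0∞) (φ x) = 0 := hx hxW
    rw [indicator_of_mem (show φ x ∈ {y | v y = 0} from h0), Pi.one_apply, mul_one] at h4
    have h5 : u x ≠ 0 := (zero_le.trans_lt hxW.2.2.1).ne'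
    simp [h5, hufin x hxW] at h4
  set a : ℝ → ℝ≥0 := Z.indicator fun x => (u x / v (φ x)).toNNReal with ha
  have haZ : ∀ x ∈ Z, (a x : ℝ≥0∞) = u x / v (φ x) := by
    intro x hx
    rw [ha, indicator_of_mem hx, ENNReal.coe_toNNReal (ENNReal.div_ne_top (hufin x hx.1) hx.2)]
  have ha0 : ∀ x ∉ Z, a x = 0 := fun x hx => by rw [ha, indicator_of_notMem hx]
  have hc : GaugeClass (tailGauge q D) ∞ a φ :=
    { measurable_weight := (hu.measurable.div hvφ).ennreal_toNNReal.indicator hZm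
      measurable_map := hφm
      weight_le := fun x => le_top
      lintegral_le := fun w hw => by
        have hD0 : (D : ℝ≥0∞) ≠ 0 := by
          exact_mod_cast (lt_of_lt_of_le two_pos hD2).ne'
        have hvm : Measurable fun y => w y / v y ^ q := hw.div (hv.measurable.pow_const q)
        calc ∫⁻ x, tailGauge q D (a x) * w (φ x) ∂halfLine
            ≤ ∫⁻ x, W.indicator
                (fun x => (2 * (D : ℝ≥0∞)⁻¹) * (u x ^ q * (w (φ x) / v (φ x) ^ q))) x
                ∂halfLine := by
              refine lintegral_mono fun x => ?_
              by_cases hx : x ∈ Z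
              · rw [indicator_of_mem hx.1, tailGauge, haZ x hx]
                have h1 : (1 : ℝ≥0∞) ≤ (u x / v (φ x)) ^ q := by
                  apply ENNReal.one_le_rpow _ hq
                  rw [ENNReal.le_div_iff_mul_le (.inl hx.2) (.inl (hvfin x hx.1)), one_mul]
                  exact hvu x hx.1
                have h2 : ((if a x = 0 then 0 else 1) + (u x / v (φ x)) ^ q : ℝ≥0∞) ≤
                    2 * (u x / v (φ x)) ^ q := by
                  rw [two_mul]
                  gcongr
                  split_ifs
                  · exact zero_le
                  · exact h1
                refine (mul_le_mul_left (ENNReal.div_le_div_right h2 _) _).trans (le_of_eq ?_)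
                rw [ENNReal.div_rpow_of_nonneg _ _ hq.le]
                simp only [div_eq_mul_inv]
                ring
              · rw [ha0 x hx]
                simp [tailGauge, hq]
          _ = (2 * (D : ℝ≥0∞)⁻¹) * ∫⁻ x in W, u x ^ q * (w (φ x) / v (φ x) ^ q) ∂halfLine := by
              rw [lintegral_indicator hWm, lintegral_const_mul]
              exact (hu.measurable.pow_const q).mul (hvm.comp hφm)
          _ ≤ (2 * (D : ℝ≥0∞)⁻¹) * (2 * C * ∫⁻ x, v x ^ q * (w x / v x ^ q) ∂halfLine) := by
              gcongr
              exact hφi _ hvm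
          _ ≤ (2 * (D : ℝ≥0∞)⁻¹) * (2 * C * ∫⁻ x, w x ∂halfLine) := by
              gcongr
              exact ENNReal.mul_div_le
          _ = ((D : ℝ≥0∞)⁻¹ * D) * ∫⁻ x, w x ∂halfLine := by
              rw [hD]
              push_cast
              ring
          _ = ∫⁻ x, w x ∂halfLine := by
              rw [ENNReal.inv_mul_cancel hD0 ENNReal.coe_ne_top, one_mul] }
  -- A vanishing tail at x forces u to vanish strictly to the right of x, so at most one point, the
  -- end of the support, is exceptional.
  have hzero : ∀ᵐ x ∂halfLine, ∫⁻ s in Ioi x, u s ^ q = 0 → u x = 0 := by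
    have hlt : ∀ x y, x < y → ∫⁻ s in Ioi x, u s ^ q = 0 → u y = 0 := by
      intro x y hxy h0
      have h1 := (ofReal_mul_le_lintegral_Ioc hkanti (x := y) x).trans
        (lintegral_mono_set Ioc_subset_Ioi_self)
      rw [h0, nonpos_iff_eq_zero, mul_eq_zero] at h1
      rcases h1 with h1 | h1
      · rw [ENNReal.ofReal_eq_zero] at h1
        linarith
      · exact (ENNReal.rpow_eq_zero_iff_of_pos hq).1 h1
    have hs : {x | ¬ (∫⁻ s in Ioi x, u s ^ q = 0 → u x = 0)}.Subsingleton := by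
      intro x hx y hy
      simp only [mem_ofPred_eq, Classical.not_imp] at hx hy
      rcases lt_trichotomy x y with hxy | hxy | hxy
      · exact absurd (hlt x y hxy hx.1) hy.2
      · exact hxy
      · exact absurd (hlt y x hxy hy.1) hx.2
    exact hs.measure_zero _
  refine (hA hB (hB.wcomp (isGauge_tailGauge hq hD2) hc hK0 (hK _ _ hc))).mono ?_
    (le_of_eq (by ring))
  filter_upwards [ae_pos, hWZ, hzero] with x hx0 hxWZ hxz
  by_cases hxU : x ∈ U
  · rw [indicator_of_mem hxU]
    by_cases hxv : u x ≤ v x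
    · exact hxv.trans le_self_add
    · by_cases h0 : ∫⁻ s in Ioi x, u s ^ q = 0
      · simp [hxz h0]
      · have hx : x ∈ Z := hxWZ ⟨hxU, hx0, not_le.1 hxv, h0⟩
        rw [haZ x hx, ENNReal.div_mul_cancel hx.2 (hvfin x hx.1)]
        exact le_add_self
  · simp [hxU]

/-! ### Gauge operators on the spaces L_r, and stability of interpolation spaces -/

theorem mem_LSpace_ofReal {p : ℝ} (hp : 0 < p) {f : Meas 𝕜} :
    f ∈ LSpace 𝕜 (ENNReal.ofReal p) ↔ ∫⁻ x, ‖f x‖ₑ ^ p ∂halfLine < ∞ := by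
  have h1 : f ∈ LSpace 𝕜 (ENNReal.ofReal p) ↔ eLpNorm f (ENNReal.ofReal p) halfLine < ∞ := Iff.rfl
  rw [h1, eLpNorm_lt_top_iff_lintegral_rpow_enorm_lt_top (by simpa using hp) ENNReal.ofReal_ne_top,
    ENNReal.toReal_ofReal hp.le]

theorem LNorm_ofReal {p : ℝ} (hp : 0 < p) (f : Meas 𝕜) :
    LNorm (ENNReal.ofReal p) f = (∫⁻ x, ‖f x‖ₑ ^ p ∂halfLine) ^ (1 / p) := by
  rw [LNorm, eLpNorm_eq_lintegral_rpow_enorm_toReal (by simpa using hp) ENNReal.ofReal_ne_top,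
    ENNReal.toReal_ofReal hp.le]

theorem LNorm_ofReal_le_iff {p : ℝ} (hp : 0 < p) (f g : Meas 𝕜) (C : ℝ≥0) :
    LNorm (ENNReal.ofReal p) g ≤ C * LNorm (ENNReal.ofReal p) f ↔
      ∫⁻ x, ‖g x‖ₑ ^ p ∂halfLine ≤ (C ^ p : ℝ≥0) * ∫⁻ x, ‖f x‖ₑ ^ p ∂halfLine := by
  rw [LNorm_ofReal hp, LNorm_ofReal hp, one_div, ENNReal.rpow_inv_le_iff hp,
    ENNReal.mul_rpow_of_nonneg _ _ hp.le, ENNReal.rpow_inv_rpow hp.ne',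
    ENNReal.coe_rpow_of_nonneg _ hp.le]

theorem mem_LSpace_top {f : Meas 𝕜} :
    f ∈ LSpace 𝕜 ∞ ↔ ∃ b : ℝ≥0, ∀ᵐ x ∂halfLine, ‖f x‖ₑ ≤ b := by
  have h1 : f ∈ LSpace 𝕜 ∞ ↔ eLpNorm f ∞ halfLine < ∞ := Iff.rfl
  rw [h1, eLpNorm_exponent_top]
  constructor
  · intro h
    refine ⟨(eLpNormEssSup f halfLine).toNNReal, ?_⟩
    rw [ENNReal.coe_toNNReal h.ne]
    exact enorm_ae_le_eLpNormEssSup f halfLine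
  · rintro ⟨b, hb⟩
    exact (essSup_le_of_ae_le _ hb).trans_lt ENNReal.coe_lt_top

theorem LNorm_top_le_iff {f : Meas 𝕜} {b : ℝ≥0∞} :
    LNorm ∞ f ≤ b ↔ ∀ᵐ x ∂halfLine, ‖f x‖ₑ ≤ b := by
  rw [LNorm, eLpNorm_exponent_top]
  constructor
  · intro h
    filter_upwards [enorm_ae_le_eLpNormEssSup f halfLine] with x hx
    exact hx.trans h
  · intro h
    exact essSup_le_of_ae_le _ h

theorem suppNorm_eq_distr (f : Meas 𝕜) : suppNorm f = distr (fun x => ‖f x‖ₑ) 0 := by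
  unfold suppNorm distr
  congr 1
  ext x
  simp [pos_iff_ne_zero]

theorem mem_L0Space {f : Meas 𝕜} : f ∈ L0Space 𝕜 ↔ distr (fun x => ‖f x‖ₑ) 0 < ∞ := by
  rw [← suppNorm_eq_distr]
  exact Iff.rfl

theorem IsInterpolationSpace.exists_boundedBy {E : QuasiBanachFunctionSpace 𝕜}
    {X Y : Submodule 𝕜 (Meas 𝕜)} {NX NY : Meas 𝕜 → ℝ≥0∞}
    (h : IsInterpolationSpace E X NX Y NY) (T : Meas 𝕜 →ₗ[𝕜] Meas 𝕜)
    (hX : ∃ C : ℝ≥0, ∀ f ∈ X, T f ∈ X ∧ NX (T f) ≤ C * NX f)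
    (hY : ∃ C : ℝ≥0, ∀ f ∈ Y, T f ∈ Y ∧ NY (T f) ≤ C * NY f) :
    ∃ K, E.BoundedBy T K := by
  obtain ⟨C, hC⟩ := hX
  obtain ⟨D, hD⟩ := hY
  have hV : ∀ f ∈ X ⊔ Y, T f ∈ X ⊔ Y := by
    intro f hf
    obtain ⟨x, hx, y, hy, rfl⟩ := Submodule.mem_sup.1 hf
    rw [map_add]
    exact Submodule.add_mem_sup (hC x hx).1 (hD y hy).1
  obtain ⟨K, hK⟩ := h.2.2 (T.restrict hV) ⟨C, fun f hf => hC f hf⟩ ⟨D, fun f hf => hD f hf⟩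
  refine ⟨K, fun f hf => ?_⟩
  obtain ⟨h1, h2⟩ := hK ⟨f, h.2.1 hf⟩ hf
  refine ⟨h1, ?_⟩
  have h3 : ENNReal.ofReal (E.qnorm (T f)) ≤ K * ENNReal.ofReal (E.qnorm f) := h2
  rw [← ENNReal.ofReal_coe_nnreal, ← ENNReal.ofReal_mul K.coe_nonneg] at h3
  exact (ENNReal.ofReal_le_ofReal_iff (mul_nonneg K.coe_nonneg (E.qnorm_nonneg f hf))).1 h3

section Bounds

variable {ω : ℝ≥0 → ℝ≥0∞} {M : ℝ≥0∞} {a : ℝ → ℝ≥0} {φ : ℝ → ℝ}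

theorem GaugeClass.lintegral_comp_le (h : GaugeClass ω M a φ) (hω : IsGauge ω M)
    {c : ℝ → ℝ≥0∞} {D : ℝ≥0}
    (hc : ∀ x, c x ≤ D * ω (a x)) {w : ℝ → ℝ≥0∞} (hw : Measurable w) :
    ∫⁻ x, c x * w (φ x) ∂halfLine ≤ D * ∫⁻ x, w x ∂halfLine := by
  calc ∫⁻ x, c x * w (φ x) ∂halfLine ≤ ∫⁻ x, D * (ω (a x) * w (φ x)) ∂halfLine := by
        refine lintegral_mono fun x => ?_
        rw [← mul_assoc]
        exact mul_le_mul_left (hc x) _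
    _ = D * ∫⁻ x, ω (a x) * w (φ x) ∂halfLine := lintegral_const_mul _
        ((hω.measurable.comp h.measurable_weight).mul (hw.comp h.measurable_map))
    _ ≤ D * ∫⁻ x, w x ∂halfLine :=
        mul_le_mul_right (h.lintegral_le w hw) _

theorem GaugeClass.bounded_LSpace (h : GaugeClass ω M a φ) (hω : IsGauge ω M) {r : ℝ} (hr : 0 < r)
    {D : ℝ≥0} (hc : ∀ x, (a x : ℝ≥0∞) ^ r ≤ D * ω (a x)) :
    ∃ C : ℝ≥0, ∀ f ∈ LSpace 𝕜 (ENNReal.ofReal r), wcomp a φ f ∈ LSpace 𝕜 (ENNReal.ofReal r) ∧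
      LNorm (ENNReal.ofReal r) (wcomp a φ f) ≤ C * LNorm (ENNReal.ofReal r) f := by
  refine ⟨D ^ r⁻¹, fun f hf => ?_⟩
  have h1 : ∫⁻ x, ‖wcomp a φ f x‖ₑ ^ r ∂halfLine ≤ D * ∫⁻ x, ‖f x‖ₑ ^ r ∂halfLine := by
    refine le_of_eq_of_le (lintegral_congr_ae ?_) (h.lintegral_comp_le hω hc
      ((measurable_enorm_coe f).pow_const r))
    filter_upwards [h.enorm_wcomp f] with x hx
    rw [hx, ENNReal.mul_rpow_of_nonneg _ _ hr.le]
  rw [mem_LSpace_ofReal hr] at hf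
  rw [mem_LSpace_ofReal hr, LNorm_ofReal_le_iff hr, NNReal.rpow_inv_rpow hr.ne']
  exact ⟨h1.trans_lt (ENNReal.mul_lt_top ENNReal.coe_lt_top hf), h1⟩

theorem GaugeClass.bounded_LSpace_top {D : ℝ≥0} (h : GaugeClass ω D a φ) (hω : IsGauge ω D) :
    ∃ C : ℝ≥0, ∀ f ∈ LSpace 𝕜 ∞, wcomp a φ f ∈ LSpace 𝕜 ∞ ∧
      LNorm ∞ (wcomp a φ f) ≤ C * LNorm ∞ f := by
  have key : ∀ (f : Meas 𝕜) (b : ℝ≥0∞), (∀ᵐ x ∂halfLine, ‖f x‖ₑ ≤ b) →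
      ∀ᵐ x ∂halfLine, ‖wcomp a φ f x‖ₑ ≤ D * b := by
    intro f b hb
    filter_upwards [h.enorm_wcomp f, h.ae_comp hω hb] with x h1 h2
    rw [h1]
    by_cases ha : a x = 0
    · simp [ha]
    · exact mul_le_mul' (h.weight_le x) (h2 ha)
  refine ⟨D, fun f hf => ⟨?_, LNorm_top_le_iff.2 (key f _ (LNorm_top_le_iff.1 le_rfl))⟩⟩
  obtain ⟨b, hb⟩ := mem_LSpace_top.1 hf
  exact mem_LSpace_top.2 ⟨D * b, by simpa using key f b hb⟩

theorem GaugeClass.bounded_L0Space (h : GaugeClass ω M a φ) (hω : IsGauge ω M)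
    {D : ℝ≥0} (hc : ∀ x, (if a x = 0 then 0 else 1) ≤ D * ω (a x)) :
    ∃ C : ℝ≥0, ∀ f ∈ L0Space 𝕜, wcomp a φ f ∈ L0Space 𝕜 ∧
      suppNorm (wcomp a φ f) ≤ C * suppNorm f := by
  have hm : ∀ f : Meas 𝕜, MeasurableSet {x | 0 < ‖f x‖ₑ} := fun f =>
    measurableSet_lt measurable_const (measurable_enorm_coe f)
  have key : ∀ f : Meas 𝕜, suppNorm (wcomp a φ f) ≤ D * suppNorm f := by
    intro f
    have h1 := h.lintegral_comp_le hω hc (w := {x | 0 < ‖f x‖ₑ}.indicator 1)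
      (measurable_one.indicator (hm f))
    rw [lintegral_indicator_one (hm f)] at h1
    rw [suppNorm_eq_distr, suppNorm_eq_distr]
    refine le_trans ?_ h1
    rw [distr, ← lintegral_indicator_one (hm _)]
    refine lintegral_mono_ae ?_
    filter_upwards [h.enorm_wcomp f] with x hx
    by_cases h0 : 0 < ‖wcomp a φ f x‖ₑ
    · have h2 := h0
      rw [hx] at h2
      have ha : a x ≠ 0 := fun h3 => by simp [h3] at h2
      have hf : 0 < ‖f (φ x)‖ₑ := by
        rw [pos_iff_ne_zero]
        exact fun h3 => by simp [h3] at h2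
      rw [indicator_of_mem (show x ∈ {x | 0 < ‖wcomp a φ f x‖ₑ} from h0),
        indicator_of_mem (show φ x ∈ {x | 0 < ‖f x‖ₑ} from hf), if_neg ha]
      simp
    · rw [indicator_of_notMem (show x ∉ {x | 0 < ‖wcomp a φ f x‖ₑ} from h0)]
      exact zero_le
  refine ⟨D, fun f hf => ⟨?_, key f⟩⟩
  exact (key f).trans_lt (ENNReal.mul_lt_top ENNReal.coe_lt_top hf)

end Bounds

theorem headGauge_bound {p : ℝ} {C : ℝ≥0} (hC : 1 ≤ C) (r : ℝ≥0) :
    (r : ℝ≥0∞) ^ p ≤ C * headGauge p C r := by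
  have hC0 : (C : ℝ≥0∞) ≠ 0 := by exact_mod_cast (lt_of_lt_of_le one_pos hC).ne'
  rw [headGauge, ENNReal.mul_div_cancel hC0 ENNReal.coe_ne_top]

/-- For bounded weights r^q ≤ C^(q-p) r^p, which makes the operators of the head class bounded on
L_q as well. -/
theorem headGauge_bound_of_lt {p q : ℝ} (hp : 0 < p) (hpq : p < q) {C : ℝ≥0} (hC : 1 ≤ C) {r : ℝ≥0}
    (hr : r ≤ C) : (r : ℝ≥0∞) ^ q ≤ (C ^ (q - p) * C : ℝ≥0) * headGauge p C r := by
  rcases eq_or_ne r 0 with rfl | hr0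
  · simp [hp.trans hpq]
  · have h1 : (r : ℝ≥0∞) ^ q = (r : ℝ≥0∞) ^ (q - p) * (r : ℝ≥0∞) ^ p := by
      rw [← ENNReal.rpow_add _ _ (by exact_mod_cast hr0) ENNReal.coe_ne_top]
      simp
    rw [h1, ENNReal.coe_mul, mul_assoc, ENNReal.coe_rpow_of_nonneg _ (sub_pos.2 hpq).le]
    refine mul_le_mul' (ENNReal.rpow_le_rpow (by exact_mod_cast hr) (sub_pos.2 hpq).le)
      (headGauge_bound hC r)

theorem tailGauge_bound (q : ℝ) {C : ℝ≥0} (hC : 2 ≤ C) (r : ℝ≥0) :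
    C * tailGauge q C r = (if r = 0 then 0 else 1) + (r : ℝ≥0∞) ^ q := by
  have hC0 : (C : ℝ≥0∞) ≠ 0 := by exact_mod_cast (lt_of_lt_of_le two_pos hC).ne'
  rw [tailGauge, ENNReal.mul_div_cancel hC0 ENNReal.coe_ne_top]

/-- For nonzero r one has r^p ≤ 1 + r^q, which makes the operators of the tail class bounded on L_p
as well. -/
theorem tailGauge_bound_of_lt {p q : ℝ} (hp : 0 < p) (hpq : p < q) {C : ℝ≥0} (hC : 2 ≤ C)
    (r : ℝ≥0) : (r : ℝ≥0∞) ^ p ≤ C * tailGauge q C r := by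
  rw [tailGauge_bound q hC]
  split_ifs with h
  · simp [h, hp]
  · rcases le_total r 1 with h1 | h1
    · refine le_trans ?_ le_self_add
      exact ENNReal.rpow_le_one (by exact_mod_cast h1) hp.le
    · refine le_trans ?_ le_add_self
      exact ENNReal.rpow_le_rpow_of_exponent_le (by exact_mod_cast h1) hpq.le

theorem headStable_of_interpolation_top {E : QuasiBanachFunctionSpace 𝕜} {p : ℝ} (hp : 0 < p)
    (h : IsInterpolationLpLq E (ENNReal.ofReal p) ∞) : HeadStable E p := fun _ hC =>
  exists_uniform_bound E (isGauge_headGauge hp hC) fun _ _ hc =>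
    h.exists_boundedBy (hc.toLinearMap 𝕜 (isGauge_headGauge hp hC))
      (hc.bounded_LSpace (isGauge_headGauge hp hC) hp fun _ => headGauge_bound hC _)
      (hc.bounded_LSpace_top (isGauge_headGauge hp hC))

theorem headStable_of_interpolation {E : QuasiBanachFunctionSpace 𝕜} {p q : ℝ} (hp : 0 < p)
    (hpq : p < q) (h : IsInterpolationLpLq E (ENNReal.ofReal p) (ENNReal.ofReal q)) :
    HeadStable E p := fun _ hC =>
  exists_uniform_bound E (isGauge_headGauge hp hC) fun _ _ hc =>
    h.exists_boundedBy (hc.toLinearMap 𝕜 (isGauge_headGauge hp hC))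
      (hc.bounded_LSpace (isGauge_headGauge hp hC) hp fun _ => headGauge_bound hC _)
      (hc.bounded_LSpace (isGauge_headGauge hp hC) (hp.trans hpq) fun x =>
        headGauge_bound_of_lt hp hpq hC (by exact_mod_cast hc.weight_le x))

theorem tailStable_of_interpolation_zero {E : QuasiBanachFunctionSpace 𝕜} {q : ℝ} (hq : 0 < q)
    (h : IsInterpolationL0Lq E (ENNReal.ofReal q)) : TailStable E q := fun C hC =>
  exists_uniform_bound E (isGauge_tailGauge hq hC) fun _ _ hc =>
    h.exists_boundedBy (hc.toLinearMap 𝕜 (isGauge_tailGauge hq hC))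
      (hc.bounded_L0Space (isGauge_tailGauge hq hC) (D := C) fun x => by
        rw [tailGauge_bound q hC]
        exact le_self_add)
      (hc.bounded_LSpace (isGauge_tailGauge hq hC) hq (D := C) fun x => by
        rw [tailGauge_bound q hC]
        exact le_add_self)

theorem tailStable_of_interpolation {E : QuasiBanachFunctionSpace 𝕜} {p q : ℝ} (hp : 0 < p)
    (hpq : p < q) (h : IsInterpolationLpLq E (ENNReal.ofReal p) (ENNReal.ofReal q)) :
    TailStable E q := fun C hC =>
  exists_uniform_bound E (isGauge_tailGauge (hp.trans hpq) hC) fun _ _ hc =>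
    h.exists_boundedBy (hc.toLinearMap 𝕜 (isGauge_tailGauge (hp.trans hpq) hC))
      (hc.bounded_LSpace (isGauge_tailGauge (hp.trans hpq) hC) hp
        fun _ => tailGauge_bound_of_lt hp hpq hC _)
      (hc.bounded_LSpace (isGauge_tailGauge (hp.trans hpq) hC) (hp.trans hpq) (D := C) fun x => by
        rw [tailGauge_bound q hC]
        exact le_add_self)

/-! ### Head and tail integrals, and splitting a function at a level -/

/-- The head integral of the `p`-th power of the rearrangement. -/
def head (u : ℝ → ℝ≥0∞) (p t : ℝ) : ℝ≥0∞ := ∫⁻ s in Ioc 0 t, rearr u s ^ p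

/-- The tail integral of the `q`-th power of the rearrangement. -/
def tail (u : ℝ → ℝ≥0∞) (q t : ℝ) : ℝ≥0∞ := ∫⁻ s in Ioi t, rearr u s ^ q

/-- The function `|f|` with extended nonnegative values. -/
abbrev absFun (f : Meas 𝕜) : ℝ → ℝ≥0∞ := fun x => ‖f x‖ₑ

theorem measurable_rearr_rpow (u : ℝ → ℝ≥0∞) (p : ℝ) : Measurable fun s => rearr u s ^ p :=
  (measurable_rearr u).pow_const p

theorem antitone_rearr_rpow (u : ℝ → ℝ≥0∞) {p : ℝ} (hp : 0 ≤ p) :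
    Antitone fun s => rearr u s ^ p :=
  fun _ _ h => ENNReal.rpow_le_rpow (rearr_antitone u h) hp

theorem head_mono (u : ℝ → ℝ≥0∞) (p : ℝ) : Monotone (head u p) := fun _ _ h =>
  lintegral_mono_set (Ioc_subset_Ioc_right h)

theorem tail_antitone (u : ℝ → ℝ≥0∞) (q : ℝ) : Antitone (tail u q) := fun _ _ h =>
  lintegral_mono_set (Ioi_subset_Ioi h)

theorem lintegral_halfLine_eq_add (k : ℝ → ℝ≥0∞) {t : ℝ} (ht : 0 ≤ t) :
    ∫⁻ s, k s ∂halfLine = (∫⁻ s in Ioc 0 t, k s) + ∫⁻ s in Ioi t, k s := by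
  rw [← lintegral_union measurableSet_Ioi (Set.disjoint_left.2 fun x hx hx' => not_le.2 hx' hx.2),
    Ioc_union_Ioi_eq_Ioi ht]

theorem head_le_lintegral {u : ℝ → ℝ≥0∞} (hu : Measurable u) {p : ℝ} (hp : 0 < p) (t : ℝ) :
    head u p t ≤ ∫⁻ x, u x ^ p ∂halfLine := by
  rw [← lintegral_rearr_rpow hu hp]
  exact lintegral_mono_set Ioc_subset_Ioi_self

theorem tail_le_lintegral {u : ℝ → ℝ≥0∞} (hu : Measurable u) {q : ℝ} (hq : 0 < q) {t : ℝ}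
    (ht : 0 ≤ t) : tail u q t ≤ ∫⁻ x, u x ^ q ∂halfLine := by
  rw [← lintegral_rearr_rpow hu hq]
  exact lintegral_mono_set (Ioi_subset_Ioi ht)

theorem head_le_of_ae_le {u : ℝ → ℝ≥0∞} {b : ℝ≥0∞} (h : ∀ᵐ x ∂halfLine, u x ≤ b) {p : ℝ}
    (hp : 0 ≤ p) (t : ℝ) : head u p t ≤ ENNReal.ofReal t * b ^ p := by
  calc head u p t ≤ ∫⁻ _ in Ioc 0 t, b ^ p :=
        lintegral_mono fun s => ENNReal.rpow_le_rpow (rearr_le_of_ae_le h s) hp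
    _ = ENNReal.ofReal t * b ^ p := by
        rw [setLIntegral_const, Real.volume_Ioc, sub_zero, mul_comm]

theorem ofReal_mul_rearr_le_head (u : ℝ → ℝ≥0∞) {p : ℝ} (hp : 0 ≤ p) (t : ℝ) :
    ENNReal.ofReal t * rearr u t ^ p ≤ head u p t := by
  simpa [head] using ofReal_mul_le_lintegral_Ioc (antitone_rearr_rpow u hp) (x := t) 0

theorem ofReal_mul_rearr_le_tail (u : ℝ → ℝ≥0∞) {q : ℝ} (hq : 0 ≤ q) (s t : ℝ) :
    ENNReal.ofReal (t - s) * rearr u t ^ q ≤ tail u q s :=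
  (ofReal_mul_le_lintegral_Ioc (antitone_rearr_rpow u hq) s).trans
    (lintegral_mono_set Ioc_subset_Ioi_self)

theorem rearr_ne_top_of_head {u : ℝ → ℝ≥0∞} {p t : ℝ} (hp : 0 < p) (ht : 0 < t)
    (h : head u p t < ∞) : rearr u t ≠ ∞ := by
  intro h0
  have := (ofReal_mul_rearr_le_head u hp.le t).trans_lt h
  rw [h0, ENNReal.top_rpow_of_pos hp, ENNReal.mul_top (by simpa using ht)] at this
  exact lt_irrefl _ this

theorem rearr_ne_top_of_tail {u : ℝ → ℝ≥0∞} {q s t : ℝ} (hq : 0 < q) (hst : s < t)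
    (h : tail u q s < ∞) : rearr u t ≠ ∞ := by
  intro h0
  have := (ofReal_mul_rearr_le_tail u hq.le s t).trans_lt h
  rw [h0, ENNReal.top_rpow_of_pos hq, ENNReal.mul_top (by simpa using hst)] at this
  exact lt_irrefl _ this

theorem add_rpow_le (a b : ℝ≥0∞) {p : ℝ} (hp : 0 ≤ p) :
    (a + b) ^ p ≤ (2 : ℝ≥0∞) ^ p * (a ^ p + b ^ p) := by
  have h1 : a + b ≤ 2 * max a b := by
    rw [two_mul]
    exact add_le_add (le_max_left _ _) (le_max_right _ _)
  refine (ENNReal.rpow_le_rpow h1 hp).trans ?_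
  rw [ENNReal.mul_rpow_of_nonneg _ _ hp]
  gcongr
  rcases le_total a b with h | h
  · rw [max_eq_right h]
    exact le_add_self
  · rw [max_eq_left h]
    exact le_self_add

theorem setLIntegral_comp_div {k : ℝ → ℝ≥0∞} (hk : Measurable k) {c : ℝ} (hc : 0 < c)
    {A B : Set ℝ} (hA : MeasurableSet A) (hB : MeasurableSet B) (hAB : ∀ s, s ∈ A ↔ s / c ∈ B) :
    ∫⁻ s in A, k (s / c) = ENNReal.ofReal c * ∫⁻ s in B, k s := by
  rw [← lintegral_indicator hA, ← lintegral_indicator hB, ← lintegral_comp_div (hk.indicator hB) hc]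
  refine lintegral_congr fun s => ?_
  by_cases hs : s ∈ A
  · rw [indicator_of_mem hs, indicator_of_mem ((hAB s).1 hs)]
  · rw [indicator_of_notMem hs, indicator_of_notMem fun h => hs ((hAB s).2 h)]

/-- The constant in the subadditivity estimates for head and tail integrals. -/
def sumConst (p : ℝ) : ℝ≥0 := 2 ^ p * 2

theorem coe_sumConst {p : ℝ} (hp : 0 ≤ p) : (sumConst p : ℝ≥0∞) = 2 ^ p * 2 := by
  rw [sumConst, ENNReal.coe_mul, ENNReal.coe_rpow_of_nonneg _ hp]
  rfl

theorem setLIntegral_rearr_add_le {u v w : ℝ → ℝ≥0∞} (h : ∀ᵐ x ∂halfLine, w x ≤ u x + v x)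
    {p : ℝ} (hp : 0 ≤ p) {A B : Set ℝ} (hA : MeasurableSet A) (hB : MeasurableSet B)
    (hAB : ∀ s, s ∈ A ↔ s / 2 ∈ B) (hA0 : A ⊆ Ioi 0) :
    ∫⁻ s in A, rearr w s ^ p ≤
      sumConst p * ((∫⁻ s in B, rearr u s ^ p) + ∫⁻ s in B, rearr v s ^ p) := by
  have hm : ∀ z : ℝ → ℝ≥0∞, Measurable fun s => rearr z (s / 2) ^ p := fun z =>
    (measurable_rearr_rpow z p).comp (measurable_id.div_const 2)
  calc ∫⁻ s in A, rearr w s ^ p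
      ≤ ∫⁻ s in A, 2 ^ p * (rearr u (s / 2) ^ p + rearr v (s / 2) ^ p) := by
        refine setLIntegral_mono' hA fun s hs => ?_
        exact (ENNReal.rpow_le_rpow (rearr_half_add_le h (le_of_lt (hA0 hs))) hp).trans
          (add_rpow_le _ _ hp)
    _ = 2 ^ p * ((2 * ∫⁻ s in B, rearr u s ^ p) + 2 * ∫⁻ s in B, rearr v s ^ p) := by
        have hm2 : Measurable fun s => rearr u (s / 2) ^ p + rearr v (s / 2) ^ p :=
          (hm u).add (hm v)
        rw [lintegral_const_mul _ hm2, lintegral_add_left (hm u),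
          setLIntegral_comp_div (measurable_rearr_rpow u p) two_pos hA hB hAB,
          setLIntegral_comp_div (measurable_rearr_rpow v p) two_pos hA hB hAB,
          ENNReal.ofReal_ofNat]
    _ = sumConst p * ((∫⁻ s in B, rearr u s ^ p) + ∫⁻ s in B, rearr v s ^ p) := by
        rw [coe_sumConst hp]
        ring

theorem head_add_le {u v w : ℝ → ℝ≥0∞} (h : ∀ᵐ x ∂halfLine, w x ≤ u x + v x) {p : ℝ}
    (hp : 0 ≤ p) {t : ℝ} (ht : 0 ≤ t) :
    head w p t ≤ sumConst p * (head u p t + head v p t) := by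
  have h1 := setLIntegral_rearr_add_le h hp (A := Ioc 0 t) (B := Ioc 0 (t / 2)) measurableSet_Ioc
    measurableSet_Ioc (fun s => by
      simp only [mem_Ioc]
      constructor <;> rintro ⟨h1, h2⟩ <;> constructor <;> linarith) Ioc_subset_Ioi_self
  refine h1.trans ?_
  have ht' : t / 2 ≤ t := by linarith
  gcongr
  · exact head_mono u p ht'
  · exact head_mono v p ht'

theorem tail_add_le {u v w : ℝ → ℝ≥0∞} (h : ∀ᵐ x ∂halfLine, w x ≤ u x + v x) {p : ℝ}
    (hp : 0 ≤ p) {t : ℝ} (ht : 0 ≤ t) :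
    tail w p t ≤ sumConst p * (tail u p (t / 2) + tail v p (t / 2)) :=
  setLIntegral_rearr_add_le h hp measurableSet_Ioi
    measurableSet_Ioi (fun s => by
      simp only [mem_Ioi]
      constructor <;> intro h1 <;> linarith) (Ioi_subset_Ioi ht)

/-- The part of `u` above the level `s`. -/
def upper (u : ℝ → ℝ≥0∞) (s : ℝ≥0∞) : ℝ → ℝ≥0∞ := {x | s < u x}.indicator u

/-- The part of `u` below the level `s`. -/
def lower (u : ℝ → ℝ≥0∞) (s : ℝ≥0∞) : ℝ → ℝ≥0∞ := {x | s < u x}ᶜ.indicator u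

theorem measurable_upper {u : ℝ → ℝ≥0∞} (hu : Measurable u) (s : ℝ≥0∞) : Measurable (upper u s) :=
  hu.indicator (measurableSet_lt measurable_const hu)

theorem measurable_lower {u : ℝ → ℝ≥0∞} (hu : Measurable u) (s : ℝ≥0∞) : Measurable (lower u s) :=
  hu.indicator (measurableSet_lt measurable_const hu).compl

theorem upper_le (u : ℝ → ℝ≥0∞) (s : ℝ≥0∞) (x : ℝ) : upper u s x ≤ u x :=
  indicator_le_self' (fun _ _ => zero_le) x

theorem lower_le (u : ℝ → ℝ≥0∞) (s : ℝ≥0∞) (x : ℝ) : lower u s x ≤ u x :=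
  indicator_le_self' (fun _ _ => zero_le) x

theorem lower_le_level (u : ℝ → ℝ≥0∞) (s : ℝ≥0∞) (x : ℝ) : lower u s x ≤ s := by
  by_cases hx : s < u x
  · simp [lower, hx]
  · rw [lower, indicator_of_mem (show x ∈ {x | s < u x}ᶜ from hx)]
    exact not_lt.1 hx

theorem distr_upper_zero_le (u : ℝ → ℝ≥0∞) (s : ℝ≥0∞) : distr (upper u s) 0 ≤ distr u s := by
  refine measure_mono fun x hx => ?_
  by_contra hcon
  have h1 : 0 < upper u s x := hx
  rw [upper, indicator_of_notMem hcon] at h1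
  exact lt_irrefl _ h1

/-- The set where u exceeds `rearr u t` has measure at most t, so the rearrangement of the upper
part vanishes beyond t. -/
theorem lintegral_upper_le {u : ℝ → ℝ≥0∞} (hu : Measurable u) {p : ℝ} (hp : 0 < p) {t : ℝ}
    (ht : 0 ≤ t) : ∫⁻ x, upper u (rearr u t) x ^ p ∂halfLine ≤ head u p t := by
  rw [← lintegral_rearr_rpow (measurable_upper hu _) hp, lintegral_halfLine_eq_add _ ht]
  have h1 : ∫⁻ s in Ioi t, rearr (upper u (rearr u t)) s ^ p = 0 := by
    rw [setLIntegral_congr_fun measurableSet_Ioi (g := 0), Pi.zero_def, lintegral_zero]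
    intro s hs
    have h2 : rearr (upper u (rearr u t)) s ≤ 0 := by
      rw [rearr_le_iff]
      exact (distr_upper_zero_le _ _).trans ((distr_rearr_self_le u t).trans
        (ENNReal.ofReal_le_ofReal (le_of_lt hs)))
    rw [nonpos_iff_eq_zero] at h2
    simp [h2, hp]
  rw [h1, add_zero]
  refine lintegral_mono fun s => ENNReal.rpow_le_rpow ?_ hp.le
  exact rearr_mono_ae (.of_forall (upper_le u _)) s

theorem lintegral_lower_le {u : ℝ → ℝ≥0∞} (hu : Measurable u) {q : ℝ} (hq : 0 < q) {t : ℝ}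
    (ht : 0 ≤ t) : ∫⁻ x, lower u (rearr u t) x ^ q ∂halfLine ≤
      ENNReal.ofReal t * rearr u t ^ q + tail u q t := by
  rw [← lintegral_rearr_rpow (measurable_lower hu _) hq, lintegral_halfLine_eq_add _ ht]
  refine add_le_add (head_le_of_ae_le (.of_forall (lower_le_level u _)) hq.le t) ?_
  refine lintegral_mono fun s => ENNReal.rpow_le_rpow ?_ hq.le
  exact rearr_mono_ae (.of_forall (lower_le u _)) s

theorem tail_le_rearr_mul (u : ℝ → ℝ≥0∞) {p q : ℝ} (hp : 0 < p) (hpq : p < q) (t : ℝ) :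
    tail u q t ≤ rearr u t ^ (q - p) * tail u p t := by
  rw [tail, tail, ← lintegral_const_mul _ (measurable_rearr_rpow u p)]
  refine setLIntegral_mono' measurableSet_Ioi fun s hs => ?_
  have h1 : rearr u s ^ q = rearr u s ^ (q - p) * rearr u s ^ p := by
    rw [← ENNReal.rpow_add_of_nonneg _ _ (sub_pos.2 hpq).le hp.le]
    simp
  rw [h1]
  gcongr
  exact rearr_antitone u (le_of_lt hs)

/-- Since u has finite values, the sets {u > s₀ + n} decrease to the empty set, and continuity from
above makes their measures tend to 0. Hence a finite tail at one point gives finite tails at every t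
> 0. -/
theorem rearr_ne_top_of_distr {u : ℝ → ℝ≥0∞} (hu : Measurable u) (hfin : ∀ x, u x ≠ ∞)
    {s₀ : ℝ≥0∞} (hs₀ : s₀ ≠ ∞) (h : distr u s₀ ≠ ∞) {t : ℝ} (ht : 0 < t) : rearr u t ≠ ∞ := by
  lift s₀ to ℝ≥0 using hs₀
  have h1 : Tendsto (fun n : ℕ => distr u (s₀ + n)) atTop
      (𝓝 (halfLine (⋂ n : ℕ, {x | s₀ + n < u x}))) := by
    refine tendsto_measure_iInter_atTop
      (fun n => (measurableSet_lt measurable_const hu).nullMeasurableSet) ?_ ⟨0, ?_⟩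
    · intro m n hmn x hx
      have hx' : (s₀ : ℝ≥0∞) + n < u x := hx
      refine lt_of_le_of_lt ?_ hx'
      gcongr
    · simpa [distr] using h
  have h2 : (⋂ n : ℕ, {x | (s₀ : ℝ≥0∞) + n < u x}) = ∅ := by
    ext x
    simp only [mem_iInter, mem_ofPred_eq, mem_empty_iff_false, iff_false, not_forall, not_lt]
    obtain ⟨n, hn⟩ := ENNReal.exists_nat_gt (hfin x)
    exact ⟨n, hn.le.trans le_add_self⟩
  rw [h2, measure_empty] at h1
  obtain ⟨n, hn⟩ := (h1.eventually (gt_mem_nhds (show (0 : ℝ≥0∞) < ENNReal.ofReal t by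
    simpa using ht))).exists
  refine ((rearr_le_iff.2 hn.le).trans_lt ?_).ne
  exact ENNReal.add_lt_top.2 ⟨ENNReal.coe_lt_top, ENNReal.natCast_lt_top n⟩

/-- The restriction of `f` to a measurable set. -/
def restr (S : Set ℝ) (hS : MeasurableSet S) (f : Meas 𝕜) : Meas 𝕜 :=
  AEEqFun.mk (S.indicator f) (f.stronglyMeasurable.indicator hS).aestronglyMeasurable

theorem absFun_restr {S : Set ℝ} (hS : MeasurableSet S) (f : Meas 𝕜) :
    ∀ᵐ x ∂halfLine, absFun (restr S hS f) x = S.indicator (absFun f) x := by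
  filter_upwards [AEEqFun.coeFn_mk (S.indicator f)
    (f.stronglyMeasurable.indicator hS).aestronglyMeasurable] with x hx
  rw [absFun, restr, hx]
  by_cases h : x ∈ S <;> simp [h]

theorem restr_add_restr_compl {S : Set ℝ} (hS : MeasurableSet S) (f : Meas 𝕜) :
    restr S hS f + restr Sᶜ hS.compl f = f := by
  apply AEEqFun.ext
  filter_upwards [AEEqFun.coeFn_add (restr S hS f) (restr Sᶜ hS.compl f),
    AEEqFun.coeFn_mk (S.indicator f) (f.stronglyMeasurable.indicator hS).aestronglyMeasurable,
    AEEqFun.coeFn_mk (Sᶜ.indicator f)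
      (f.stronglyMeasurable.indicator hS.compl).aestronglyMeasurable] with x h1 h2 h3
  rw [h1, Pi.add_apply, restr, restr, h2, h3]
  exact congrFun (indicator_self_add_compl S (f : ℝ → 𝕜)) x

theorem measurableSet_level (f : Meas 𝕜) (s : ℝ≥0∞) : MeasurableSet {x | s < absFun f x} :=
  measurableSet_lt measurable_const (measurable_enorm_coe f)

/-- The part of `f` where `|f|` is above the level `s`. -/
def upperPart (f : Meas 𝕜) (s : ℝ≥0∞) : Meas 𝕜 :=
  restr {x | s < absFun f x} (measurableSet_level f s) f

/-- The part of `f` where `|f|` is at most `s`. -/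
def lowerPart (f : Meas 𝕜) (s : ℝ≥0∞) : Meas 𝕜 :=
  restr {x | s < absFun f x}ᶜ (measurableSet_level f s).compl f

theorem upperPart_add_lowerPart (f : Meas 𝕜) (s : ℝ≥0∞) : upperPart f s + lowerPart f s = f :=
  restr_add_restr_compl _ f

theorem absFun_upperPart (f : Meas 𝕜) (s : ℝ≥0∞) :
    ∀ᵐ x ∂halfLine, absFun (upperPart f s) x = upper (absFun f) s x := absFun_restr _ f

theorem absFun_lowerPart (f : Meas 𝕜) (s : ℝ≥0∞) :
    ∀ᵐ x ∂halfLine, absFun (lowerPart f s) x = lower (absFun f) s x := absFun_restr _ f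

theorem lintegral_upperPart_le (f : Meas 𝕜) {p : ℝ} (hp : 0 < p) {t : ℝ} (ht : 0 ≤ t) :
    ∫⁻ x, ‖upperPart f (rearr (absFun f) t) x‖ₑ ^ p ∂halfLine ≤ head (absFun f) p t := by
  refine le_of_eq_of_le (lintegral_congr_ae ?_) (lintegral_upper_le (measurable_enorm_coe f) hp ht)
  filter_upwards [absFun_upperPart f (rearr (absFun f) t)] with x hx
  exact congrArg (· ^ p) hx

theorem lintegral_lowerPart_le (f : Meas 𝕜) {q : ℝ} (hq : 0 < q) {t : ℝ} (ht : 0 ≤ t) :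
    ∫⁻ x, ‖lowerPart f (rearr (absFun f) t) x‖ₑ ^ q ∂halfLine ≤
      ENNReal.ofReal t * rearr (absFun f) t ^ q + tail (absFun f) q t := by
  refine le_of_eq_of_le (lintegral_congr_ae ?_) (lintegral_lower_le (measurable_enorm_coe f) hq ht)
  filter_upwards [absFun_lowerPart f (rearr (absFun f) t)] with x hx
  exact congrArg (· ^ q) hx

theorem lowerPart_ae_le (f : Meas 𝕜) (s : ℝ≥0∞) : ∀ᵐ x ∂halfLine, ‖lowerPart f s x‖ₑ ≤ s := by
  filter_upwards [absFun_lowerPart f s] with x hx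
  exact hx.trans_le (lower_le_level _ _ _)

theorem suppNorm_upperPart_le (f : Meas 𝕜) {t : ℝ} :
    suppNorm (upperPart f (rearr (absFun f) t)) ≤ ENNReal.ofReal t := by
  rw [suppNorm_eq_distr]
  refine (distr_mono_ae ?_ 0).trans ((distr_upper_zero_le (absFun f) _).trans
    (distr_rearr_self_le _ t))
  filter_upwards [absFun_upperPart f (rearr (absFun f) t)] with x hx
  exact hx.le

theorem absFun_add_le (f g : Meas 𝕜) :
    ∀ᵐ x ∂halfLine, absFun (f + g) x ≤ absFun f x + absFun g x := by
  filter_upwards [AEEqFun.coeFn_add f g] with x hx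
  rw [absFun, hx]
  exact enorm_add_le _ _

theorem upperPart_mem_LSpace {f : Meas 𝕜} {p : ℝ} (hp : 0 < p) {t : ℝ} (ht : 0 ≤ t)
    (h : head (absFun f) p t < ∞) :
    upperPart f (rearr (absFun f) t) ∈ LSpace 𝕜 (ENNReal.ofReal p) :=
  (mem_LSpace_ofReal hp).2 ((lintegral_upperPart_le f hp ht).trans_lt h)

theorem upperPart_mem_L0Space (f : Meas 𝕜) (t : ℝ) :
    upperPart f (rearr (absFun f) t) ∈ L0Space 𝕜 :=
  (suppNorm_upperPart_le f).trans_lt ENNReal.ofReal_lt_top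

theorem lowerPart_mem_LSpace_top (f : Meas 𝕜) {s : ℝ≥0∞} (hs : s ≠ ∞) :
    lowerPart f s ∈ LSpace 𝕜 ∞ := by
  lift s to ℝ≥0 using hs
  exact mem_LSpace_top.2 ⟨s, lowerPart_ae_le f s⟩

theorem lowerPart_mem_LSpace {f : Meas 𝕜} {q : ℝ} (hq : 0 < q) {t : ℝ} (ht : 0 ≤ t)
    (hr : rearr (absFun f) t ≠ ∞) (h : tail (absFun f) q t < ∞) :
    lowerPart f (rearr (absFun f) t) ∈ LSpace 𝕜 (ENNReal.ofReal q) := by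
  refine (mem_LSpace_ofReal hq).2 ((lintegral_lowerPart_le f hq ht).trans_lt
    (ENNReal.add_lt_top.2 ⟨ENNReal.mul_lt_top ENNReal.ofReal_lt_top ?_, h⟩))
  exact ENNReal.rpow_lt_top_of_nonneg hq.le hr

/-- Cutting at the level `rearr (absFun f) t` provides the decomposition. With
`head_lt_top_of_mem_sup`, membership in L_p + L_∞ becomes finiteness of one head integral. -/
theorem mem_sup_top_of_head {f : Meas 𝕜} {p : ℝ} (hp : 0 < p) {t : ℝ} (ht : 0 < t)
    (h : head (absFun f) p t < ∞) : f ∈ LSpace 𝕜 (ENNReal.ofReal p) ⊔ LSpace 𝕜 ∞ := by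
  rw [← upperPart_add_lowerPart f (rearr (absFun f) t)]
  exact Submodule.add_mem_sup (upperPart_mem_LSpace hp ht.le h)
    (lowerPart_mem_LSpace_top f (rearr_ne_top_of_head hp ht h))

theorem head_lt_top_of_mem_sup {f : Meas 𝕜} {p : ℝ} (hp : 0 < p)
    (h : f ∈ LSpace 𝕜 (ENNReal.ofReal p) ⊔ LSpace 𝕜 ∞) {t : ℝ} (ht : 0 < t) :
    head (absFun f) p t < ∞ := by
  obtain ⟨x, hx, y, hy, rfl⟩ := Submodule.mem_sup.1 h
  obtain ⟨b, hb⟩ := mem_LSpace_top.1 hy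
  refine (head_add_le (absFun_add_le x y) hp.le ht.le).trans_lt
    (ENNReal.mul_lt_top ENNReal.coe_lt_top (ENNReal.add_lt_top.2 ⟨?_, ?_⟩))
  · exact (head_le_lintegral (measurable_enorm_coe x) hp t).trans_lt ((mem_LSpace_ofReal hp).1 hx)
  · exact (head_le_of_ae_le hb hp.le t).trans_lt (ENNReal.mul_lt_top ENNReal.ofReal_lt_top
      (ENNReal.rpow_lt_top_of_nonneg hp.le ENNReal.coe_ne_top))

theorem mem_sup_of_tail {f : Meas 𝕜} {q : ℝ} (hq : 0 < q) {t : ℝ} (ht : 0 < t)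
    (h : tail (absFun f) q t < ∞) : f ∈ L0Space 𝕜 ⊔ LSpace 𝕜 (ENNReal.ofReal q) := by
  -- The finite tail at t bounds the rearrangement only strictly to the right of t, so the cut is
  -- made at t + 1.
  have ht1 : t < t + 1 := lt_add_one t
  rw [← upperPart_add_lowerPart f (rearr (absFun f) (t + 1))]
  exact Submodule.add_mem_sup (upperPart_mem_L0Space f _) (lowerPart_mem_LSpace hq
    (ht.trans ht1).le (rearr_ne_top_of_tail hq ht1 h) ((tail_antitone _ q ht1.le).trans_lt h))

/-- The rearrangement of u vanishes from c on, so subadditivity gives μ(c + s, w) ≤ μ(s, v): a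
perturbation with small support merely shifts the rearrangement. -/
theorem tail_add_suppNorm_le {u v w : ℝ → ℝ≥0∞} (h : ∀ᵐ x ∂halfLine, w x ≤ u x + v x)
    (hv : Measurable v) {q c : ℝ} (hq : 0 < q) (hc : 0 ≤ c) (hu : distr u 0 ≤ ENNReal.ofReal c) :
    tail w q c ≤ ∫⁻ x, v x ^ q ∂halfLine := by
  rw [← lintegral_rearr_rpow hv hq]
  have h0 : rearr u c = 0 := by
    rw [← nonpos_iff_eq_zero, rearr_le_iff]
    exact hu
  have hle : ∀ s ∈ Ioi c, rearr w s ^ q ≤ rearr v (s - c) ^ q := by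
    intro s hs
    have hs' : 0 ≤ s - c := sub_nonneg.2 (le_of_lt hs)
    have h1 := rearr_add_le h hc hs'
    rw [h0, zero_add, add_sub_cancel] at h1
    exact ENNReal.rpow_le_rpow h1 hq.le
  refine (setLIntegral_mono' measurableSet_Ioi hle).trans ?_
  rw [← lintegral_indicator measurableSet_Ioi, ← lintegral_indicator measurableSet_Ioi,
    ← lintegral_sub_right_eq_self ((Ioi 0).indicator fun t => rearr v t ^ q) c]
  refine lintegral_mono fun s => ?_
  by_cases hs : s ∈ Ioi c
  · have hs' : s - c ∈ Ioi (0 : ℝ) := sub_pos.2 (show c < s from hs)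
    rw [indicator_of_mem hs, indicator_of_mem hs']
  · rw [indicator_of_notMem hs]
    exact zero_le

theorem rearr_ne_top_of_tail_ne_top {f : Meas 𝕜} {q : ℝ} (hq : 0 < q) {c : ℝ}
    (h : tail (absFun f) q c < ∞) {t : ℝ} (ht : 0 < t) : rearr (absFun f) t ≠ ∞ := by
  have h1 := rearr_ne_top_of_tail hq (lt_add_one c) h
  refine rearr_ne_top_of_distr (measurable_enorm_coe f) (fun x => enorm_ne_top) h1 ?_ ht
  exact ((distr_rearr_self_le _ _).trans_lt ENNReal.ofReal_lt_top).ne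

theorem tail_lt_top_of_tail {f : Meas 𝕜} {q : ℝ} (hq : 0 < q) {c : ℝ}
    (h : tail (absFun f) q c < ∞) {t : ℝ} (ht : 0 < t) : tail (absFun f) q t < ∞ := by
  rcases le_total c t with hct | htc
  · exact (tail_antitone _ q hct).trans_lt h
  · have h1 : tail (absFun f) q t ≤
        (∫⁻ s in Ioc t c, rearr (absFun f) s ^ q) + tail (absFun f) q c := by
      rw [tail, ← Ioc_union_Ioi_eq_Ioi htc]
      exact lintegral_union_le _ _ _
    refine h1.trans_lt (ENNReal.add_lt_top.2 ⟨?_, h⟩)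
    refine (lintegral_Ioc_le_ofReal_mul (antitone_rearr_rpow _ hq.le) t).trans_lt
      (ENNReal.mul_lt_top ENNReal.ofReal_lt_top ?_)
    exact ENNReal.rpow_lt_top_of_nonneg hq.le (rearr_ne_top_of_tail_ne_top hq h ht)

theorem tail_lt_top_of_mem_sup {f : Meas 𝕜} {q : ℝ} (hq : 0 < q)
    (h : f ∈ L0Space 𝕜 ⊔ LSpace 𝕜 (ENNReal.ofReal q)) {t : ℝ} (ht : 0 < t) :
    tail (absFun f) q t < ∞ := by
  obtain ⟨x, hx, y, hy, rfl⟩ := Submodule.mem_sup.1 h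
  have hx' := mem_L0Space.1 hx
  refine tail_lt_top_of_tail hq (c := (distr (absFun x) 0).toReal)
    ((tail_add_suppNorm_le (absFun_add_le x y) (measurable_enorm_coe y) hq ENNReal.toReal_nonneg
      ?_).trans_lt ((mem_LSpace_ofReal hq).1 hy)) ht
  rw [ENNReal.ofReal_toReal hx'.ne]

theorem absFun_absPow (f : Meas 𝕜) {p : ℝ} (hp : 0 ≤ p) :
    ∀ᵐ x ∂halfLine, absFun (absPow f p) x = absFun f x ^ p := by
  filter_upwards [AEEqFun.coeFn_compMeasurable (fun z : 𝕜 => ‖z‖ ^ p) (by fun_prop) f] with x hx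
  have h1 : absPow f p x = ‖f x‖ ^ p := hx
  rw [absFun, h1, ← ofReal_norm, Real.norm_of_nonneg (Real.rpow_nonneg (norm_nonneg _) p),
    ← ENNReal.ofReal_rpow_of_nonneg (norm_nonneg _) hp, ofReal_norm]

theorem rearrangement_absPow (f : Meas 𝕜) {p : ℝ} (hp : 0 < p) (t : ℝ) :
    rearrangement (absPow f p) t = rearr (absFun f) t ^ p := by
  rw [← rearr_rpow _ hp]
  apply le_antisymm
  · refine rearr_mono_ae ?_ t
    filter_upwards [absFun_absPow f hp.le] with x hx using hx.le
  · refine rearr_mono_ae ?_ t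
    filter_upwards [absFun_absPow f hp.le] with x hx using hx.ge

theorem head_absPow (f : Meas 𝕜) {p : ℝ} (hp : 0 < p) (t : ℝ) :
    head (absFun (absPow f p)) 1 t = head (absFun f) p t :=
  lintegral_congr fun s => by
    rw [ENNReal.rpow_one]
    exact rearrangement_absPow f hp s

theorem tail_absPow (f : Meas 𝕜) {p : ℝ} (hp : 0 < p) (t : ℝ) :
    tail (absFun (absPow f p)) 1 t = tail (absFun f) p t :=
  lintegral_congr fun s => by
    rw [ENNReal.rpow_one]
    exact rearrangement_absPow f hp s

theorem headMaj_absPow_iff {f g : Meas 𝕜} {p : ℝ} (hp : 0 < p) :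
    HeadMaj (absPow g p) (absPow f p) ↔
      g ∈ LSpace 𝕜 (ENNReal.ofReal p) ⊔ LSpace 𝕜 ∞ ∧
      f ∈ LSpace 𝕜 (ENNReal.ofReal p) ⊔ LSpace 𝕜 ∞ ∧
      ∀ t, 0 < t → head (absFun g) p t ≤ head (absFun f) p t := by
  have hmem : ∀ f : Meas 𝕜, absPow f p ∈ LSpace ℝ 1 ⊔ LSpace ℝ ∞ ↔
      f ∈ LSpace 𝕜 (ENNReal.ofReal p) ⊔ LSpace 𝕜 ∞ := by
    intro f
    rw [← ENNReal.ofReal_one]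
    constructor
    · intro h
      have h1 := head_lt_top_of_mem_sup one_pos h one_pos
      rw [head_absPow f hp] at h1
      exact mem_sup_top_of_head hp one_pos h1
    · intro h
      have h1 := head_lt_top_of_mem_sup hp h one_pos
      rw [← head_absPow f hp] at h1
      exact mem_sup_top_of_head one_pos one_pos h1
  unfold HeadMaj
  rw [hmem, hmem]
  simp_rw [rearrangement_absPow _ hp]
  rfl

theorem tailMaj_absPow_iff {f g : Meas 𝕜} {q : ℝ} (hq : 0 < q) :
    TailMaj (absPow g q) (absPow f q) ↔
      g ∈ L0Space 𝕜 ⊔ LSpace 𝕜 (ENNReal.ofReal q) ∧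
      f ∈ L0Space 𝕜 ⊔ LSpace 𝕜 (ENNReal.ofReal q) ∧
      ∀ t, 0 < t → tail (absFun g) q t ≤ tail (absFun f) q t := by
  have hmem : ∀ f : Meas 𝕜, absPow f q ∈ L0Space ℝ ⊔ LSpace ℝ 1 ↔
      f ∈ L0Space 𝕜 ⊔ LSpace 𝕜 (ENNReal.ofReal q) := by
    intro f
    rw [← ENNReal.ofReal_one]
    constructor
    · intro h
      have h1 := tail_lt_top_of_mem_sup one_pos h one_pos
      rw [tail_absPow f hq] at h1
      exact mem_sup_of_tail hq one_pos h1
    · intro h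
      have h1 := tail_lt_top_of_mem_sup hq h one_pos
      rw [← tail_absPow f hq] at h1
      exact mem_sup_of_tail one_pos one_pos h1
  unfold TailMaj
  rw [hmem, hmem]
  simp_rw [rearrangement_absPow _ hq]
  rfl

/-! ### Monotonicity with respect to majorization -/

/-- `E` is monotone with respect to head majorization of `p`-th powers. -/
def HeadMonotone (E : QuasiBanachFunctionSpace 𝕜) (p : ℝ) : Prop :=
  ∃ c : ℝ, 0 < c ∧ ∀ f ∈ E.carrier,
    ∀ g ∈ LSpace 𝕜 (ENNReal.ofReal p) ⊔ LSpace 𝕜 ∞,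
      HeadMaj (absPow g p) (absPow f p) → g ∈ E.carrier ∧ E.qnorm g ≤ c * E.qnorm f

/-- `E` is monotone with respect to tail majorization of `q`-th powers. -/
def TailMonotone (E : QuasiBanachFunctionSpace 𝕜) (q : ℝ) : Prop :=
  ∃ c : ℝ, 0 < c ∧ ∀ f ∈ E.carrier,
    ∀ g ∈ L0Space 𝕜 ⊔ LSpace 𝕜 (ENNReal.ofReal q),
      TailMaj (absPow g q) (absPow f q) → g ∈ E.carrier ∧ E.qnorm g ≤ c * E.qnorm f

theorem HeadStable.exists_dom_rearr {E : QuasiBanachFunctionSpace 𝕜} {p : ℝ} (hp : 0 < p)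
    (h : HeadStable E p) {C : ℝ≥0} (hC : 1 ≤ C) :
    ∃ K, 0 ≤ K ∧ ∀ f ∈ E.carrier, ∀ (g : Meas 𝕜) (U : Set ℝ),
      f ∈ LSpace 𝕜 (ENNReal.ofReal p) ⊔ LSpace 𝕜 ∞ →
      g ∈ LSpace 𝕜 (ENNReal.ofReal p) ⊔ LSpace 𝕜 ∞ → MeasurableSet U →
      (∀ t ∈ U, 0 < t → head (absFun g) p t ≤ C * head (absFun f) p t) →
      E.Dom (U.indicator (rearr (absFun g))) (K * E.qnorm f) := by
  obtain ⟨K₁, h₁, H₁⟩ := (h.symStable hp).exists_dom_rearr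
  obtain ⟨K₂, h₂, H₂⟩ := h.exists_dom_indicator hp hC
  refine ⟨K₂ * K₁, by positivity, fun f hf g U hfs hgs hU hle => ?_⟩
  have hff : ∀ t, 0 < t → head (absFun f) p t < ∞ := fun t ht => head_lt_top_of_mem_sup hp hfs ht
  have hgf : ∀ t, 0 < t → head (absFun g) p t < ∞ := fun t ht => head_lt_top_of_mem_sup hp hgs ht
  rw [mul_assoc]
  exact H₂ _ _ U _ (rearr_antitone _) (rearr_antitone _) hgf hff hU hle
    (H₁ f hf fun t ht => rearr_ne_top_of_head hp ht (hff t ht))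

theorem TailStable.exists_dom_rearr {E : QuasiBanachFunctionSpace 𝕜} {q : ℝ} (hq : 0 < q)
    (h : TailStable E q) {C : ℝ≥0} (hC : 1 ≤ C) :
    ∃ K, 0 ≤ K ∧ ∀ f ∈ E.carrier, ∀ (g : Meas 𝕜) (U : Set ℝ),
      f ∈ L0Space 𝕜 ⊔ LSpace 𝕜 (ENNReal.ofReal q) →
      g ∈ L0Space 𝕜 ⊔ LSpace 𝕜 (ENNReal.ofReal q) → MeasurableSet U →
      (∀ t ∈ U, 0 < t → tail (absFun g) q t ≤ C * tail (absFun f) q t) →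
      E.Dom (U.indicator (rearr (absFun g))) (K * E.qnorm f) := by
  obtain ⟨K₁, h₁, H₁⟩ := (h.symStable hq).exists_dom_rearr
  obtain ⟨K₂, h₂, H₂⟩ := h.exists_dom_indicator hq hC
  refine ⟨K₂ * K₁, by positivity, fun f hf g U hfs hgs hU hle => ?_⟩
  have hff : ∀ t, 0 < t → tail (absFun f) q t < ∞ := fun t ht => tail_lt_top_of_mem_sup hq hfs ht
  have hgf : ∀ t, 0 < t → tail (absFun g) q t < ∞ := fun t ht => tail_lt_top_of_mem_sup hq hgs ht
  rw [mul_assoc]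
  exact H₂ _ _ U _ (rearr_antitone _) (rearr_antitone _) hgf hff hU hle
    (H₁ f hf fun t ht => rearr_ne_top_of_tail_ne_top hq (hff t ht) ht)

theorem HeadStable.headMonotone {E : QuasiBanachFunctionSpace 𝕜} {p : ℝ} (hp : 0 < p)
    (h : HeadStable E p) : HeadMonotone E p := by
  obtain ⟨K₁, h₁, H₁⟩ := h.exists_dom_rearr hp le_rfl
  obtain ⟨K₂, h₂, H₂⟩ := (h.symStable hp).exists_mem_of_dom_rearr
  refine ⟨K₂ * K₁ + 1, by positivity, fun f hf g _ hgf => ?_⟩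
  obtain ⟨hgs, hfs, hle⟩ := (headMaj_absPow_iff hp).1 hgf
  have h3 := H₁ f hf g univ hfs hgs MeasurableSet.univ fun t _ ht => by simpa using hle t ht
  rw [indicator_univ] at h3
  obtain ⟨h4, h5⟩ := H₂ g _ h3
  refine ⟨h4, h5.trans ?_⟩
  nlinarith [E.qnorm_nonneg f hf]

theorem TailStable.tailMonotone {E : QuasiBanachFunctionSpace 𝕜} {q : ℝ} (hq : 0 < q)
    (h : TailStable E q) : TailMonotone E q := by
  obtain ⟨K₁, h₁, H₁⟩ := h.exists_dom_rearr hq le_rfl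
  obtain ⟨K₂, h₂, H₂⟩ := (h.symStable hq).exists_mem_of_dom_rearr
  refine ⟨K₂ * K₁ + 1, by positivity, fun f hf g _ hgf => ?_⟩
  obtain ⟨hgs, hfs, hle⟩ := (tailMaj_absPow_iff hq).1 hgf
  have h3 := H₁ f hf g univ hfs hgs MeasurableSet.univ fun t _ ht => by simpa using hle t ht
  rw [indicator_univ] at h3
  obtain ⟨h4, h5⟩ := H₂ g _ h3
  refine ⟨h4, h5.trans ?_⟩
  nlinarith [E.qnorm_nonneg f hf]

theorem absFun_coe_smul (c : ℝ≥0) (f : Meas 𝕜) :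
    ∀ᵐ x ∂halfLine, absFun (((c : ℝ) : 𝕜) • f) x = c * absFun f x := by
  filter_upwards [AEEqFun.coeFn_smul ((c : ℝ) : 𝕜) f] with x hx
  rw [absFun, hx, Pi.smul_apply, enorm_smul, ← ofReal_norm, RCLike.norm_ofReal, NNReal.abs_eq,
    ENNReal.ofReal_coe_nnreal]

theorem rearr_coe_smul_le (c : ℝ≥0) (f : Meas 𝕜) (t : ℝ) :
    rearr (absFun (((c : ℝ) : 𝕜) • f)) t ≤ c * rearr (absFun f) t := by
  refine le_trans (rearr_mono_ae ?_ t) (rearr_const_mul_le (absFun f) c t)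
  filter_upwards [absFun_coe_smul c f] with x hx using hx.le

theorem setLIntegral_rearr_smul_le (c : ℝ≥0) (f : Meas 𝕜) {p : ℝ} (hp : 0 ≤ p) (A : Set ℝ) :
    ∫⁻ s in A, rearr (absFun (((c : ℝ) : 𝕜) • f)) s ^ p ≤
      (c : ℝ≥0∞) ^ p * ∫⁻ s in A, rearr (absFun f) s ^ p := by
  rw [← lintegral_const_mul _ (measurable_rearr_rpow _ p)]
  refine lintegral_mono fun s => ?_
  rw [← ENNReal.mul_rpow_of_nonneg _ _ hp]
  exact ENNReal.rpow_le_rpow (rearr_coe_smul_le c f s) hp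

/-- Scaling a monotonicity estimate: if `L ^ (-1/p) • g` is controlled by `f`, so is `g`. -/
theorem scaled_mem {E : QuasiBanachFunctionSpace 𝕜} {c : ℝ} {f g : Meas 𝕜} {r : ℝ≥0} (hr : r ≠ 0)
    (h : (((r⁻¹ : ℝ≥0) : ℝ) : 𝕜) • g ∈ E.carrier ∧
      E.qnorm ((((r⁻¹ : ℝ≥0) : ℝ) : 𝕜) • g) ≤ c * E.qnorm f) :
    g ∈ E.carrier ∧ E.qnorm g ≤ r * (c * E.qnorm f) := by
  have hg : g = ((r : ℝ) : 𝕜) • ((((r⁻¹ : ℝ≥0) : ℝ) : 𝕜) • g) := by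
    have hr' : ((r : ℝ) : 𝕜) ≠ 0 := by exact_mod_cast hr
    rw [smul_smul]
    push_cast
    rw [mul_inv_cancel₀ hr', one_smul]
  refine ⟨?_, ?_⟩
  · rw [hg]
    exact E.carrier.smul_mem _ h.1
  · rw [hg, E.qnorm_smul _ _ h.1, RCLike.norm_ofReal, NNReal.abs_eq]
    exact mul_le_mul_of_nonneg_left h.2 r.2

theorem inv_rpow_inv_mul_le {L : ℝ≥0} (hL : L ≠ 0) {p : ℝ} (hp : 0 < p) {x y : ℝ≥0∞}
    (h : x ≤ L * y) : (((L ^ p⁻¹)⁻¹ : ℝ≥0) : ℝ≥0∞) ^ p * x ≤ y := by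
  have h1 : (((L ^ p⁻¹)⁻¹ : ℝ≥0) : ℝ≥0∞) ^ p = (L : ℝ≥0∞)⁻¹ := by
    rw [← ENNReal.coe_rpow_of_nonneg _ hp.le, NNReal.inv_rpow, NNReal.rpow_inv_rpow hp.ne',
      ENNReal.coe_inv hL]
  rw [h1]
  calc (L : ℝ≥0∞)⁻¹ * x ≤ (L : ℝ≥0∞)⁻¹ * (L * y) := by gcongr
    _ = y := by
      rw [← mul_assoc, ENNReal.inv_mul_cancel (by exact_mod_cast hL) ENNReal.coe_ne_top, one_mul]

theorem HeadMonotone.scaled {E : QuasiBanachFunctionSpace 𝕜} {p : ℝ} (hp : 0 < p)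
    (h : HeadMonotone E p) :
    ∃ c : ℝ, 0 < c ∧ ∀ f ∈ E.carrier, ∀ g : Meas 𝕜, ∀ L : ℝ≥0, L ≠ 0 →
      f ∈ LSpace 𝕜 (ENNReal.ofReal p) ⊔ LSpace 𝕜 ∞ →
      g ∈ LSpace 𝕜 (ENNReal.ofReal p) ⊔ LSpace 𝕜 ∞ →
      (∀ t, 0 < t → head (absFun g) p t ≤ L * head (absFun f) p t) →
      g ∈ E.carrier ∧ E.qnorm g ≤ (L ^ p⁻¹ : ℝ≥0) * (c * E.qnorm f) := by
  obtain ⟨c, hc, H⟩ := h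
  refine ⟨c, hc, fun f hf g L hL hfs hgs hle => ?_⟩
  have hr : L ^ p⁻¹ ≠ 0 := by simp [hL, hp.ne']
  have hgs' := Submodule.smul_mem _ ((((L ^ p⁻¹)⁻¹ : ℝ≥0) : ℝ) : 𝕜) hgs
  refine scaled_mem hr (H f hf _ hgs' ((headMaj_absPow_iff hp).2 ⟨hgs', hfs, fun t ht => ?_⟩))
  exact (setLIntegral_rearr_smul_le _ g hp.le _).trans (inv_rpow_inv_mul_le hL hp (hle t ht))

theorem TailMonotone.scaled {E : QuasiBanachFunctionSpace 𝕜} {q : ℝ} (hq : 0 < q)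
    (h : TailMonotone E q) :
    ∃ c : ℝ, 0 < c ∧ ∀ f ∈ E.carrier, ∀ g : Meas 𝕜, ∀ L : ℝ≥0, L ≠ 0 →
      f ∈ L0Space 𝕜 ⊔ LSpace 𝕜 (ENNReal.ofReal q) →
      g ∈ L0Space 𝕜 ⊔ LSpace 𝕜 (ENNReal.ofReal q) →
      (∀ t, 0 < t → tail (absFun g) q t ≤ L * tail (absFun f) q t) →
      g ∈ E.carrier ∧ E.qnorm g ≤ (L ^ q⁻¹ : ℝ≥0) * (c * E.qnorm f) := by
  obtain ⟨c, hc, H⟩ := h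
  refine ⟨c, hc, fun f hf g L hL hfs hgs hle => ?_⟩
  have hr : L ^ q⁻¹ ≠ 0 := by simp [hL, hq.ne']
  have hgs' := Submodule.smul_mem _ ((((L ^ q⁻¹)⁻¹ : ℝ≥0) : ℝ) : 𝕜) hgs
  refine scaled_mem hr (H f hf _ hgs' ((tailMaj_absPow_iff hq).2 ⟨hgs', hfs, fun t ht => ?_⟩))
  exact (setLIntegral_rearr_smul_le _ g hq.le _).trans (inv_rpow_inv_mul_le hL hq (hle t ht))

/-! ### Truncations, and the inclusions for head monotone spaces -/

/-- The Fatou property of the rearrangement: superlevel sets of an increasing supremum are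
increasing unions. -/
theorem rearr_le_iSup {u : ℝ → ℝ≥0∞} {v : ℕ → ℝ → ℝ≥0∞} (hv : ∀ x, Monotone fun n => v n x)
    (huv : ∀ᵐ x ∂halfLine, u x ≤ ⨆ n, v n x) (t : ℝ) : rearr u t ≤ ⨆ n, rearr (v n) t := by
  rw [rearr_le_iff]
  set s := ⨆ n, rearr (v n) t with hs
  have h1 : distr u s ≤ halfLine (⋃ n, {x | s < v n x}) := by
    refine measure_mono_ae ?_
    filter_upwards [huv] with x hx hxs
    have h2 : s < ⨆ n, v n x := lt_of_lt_of_le hxs hx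
    obtain ⟨n, hn⟩ := lt_iSup_iff.1 h2
    exact mem_iUnion.2 ⟨n, hn⟩
  refine h1.trans ?_
  have hmono : Monotone fun n => {x | s < v n x} := fun m n hmn x hx =>
    lt_of_lt_of_le (show s < v m x from hx) (hv x hmn)
  rw [hmono.measure_iUnion]
  exact iSup_le fun n => rearr_le_iff.1 (le_iSup (fun n => rearr (v n) t) n)

theorem setLIntegral_rearr_le_iSup {u : ℝ → ℝ≥0∞} {v : ℕ → ℝ → ℝ≥0∞}
    (hv : ∀ x, Monotone fun n => v n x) (huv : ∀ᵐ x ∂halfLine, u x ≤ ⨆ n, v n x) {p : ℝ}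
    (hp : 0 < p) (A : Set ℝ) :
    ∫⁻ s in A, rearr u s ^ p ≤ ⨆ n, ∫⁻ s in A, rearr (v n) s ^ p := by
  have hmono : ∀ s, Monotone fun n => rearr (v n) s := fun s m n hmn =>
    rearr_mono_ae (.of_forall fun x => hv x hmn) s
  rw [← lintegral_iSup (fun n => measurable_rearr_rpow _ p)
    (fun m n hmn s => ENNReal.rpow_le_rpow (hmono s hmn) hp.le)]
  refine lintegral_mono fun s => ?_
  refine (ENNReal.rpow_le_rpow (rearr_le_iSup hv huv s) hp.le).trans (le_of_eq ?_)
  exact (ENNReal.orderIsoRpow p hp).map_iSup _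

/-- The truncations of `u` to the sets `{u ≤ n} ∩ (-∞, n]`. -/
def truncSet (f : Meas 𝕜) (n : ℕ) : Set ℝ := {x | (n : ℝ≥0∞) < absFun f x}ᶜ ∩ Iic (n : ℝ)

theorem measurableSet_truncSet (f : Meas 𝕜) (n : ℕ) : MeasurableSet (truncSet f n) :=
  (measurableSet_level f n).compl.inter measurableSet_Iic

/-- The truncations of `f`, bounded functions with bounded support increasing to `f`. -/
def trunc (f : Meas 𝕜) (n : ℕ) : Meas 𝕜 := restr (truncSet f n) (measurableSet_truncSet f n) f

theorem monotone_truncSet (f : Meas 𝕜) : Monotone (truncSet f) := by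
  intro m n hmn x hx
  have h1 : (m : ℝ≥0∞) ≤ n := by exact_mod_cast hmn
  have h2 : (m : ℝ) ≤ n := by exact_mod_cast hmn
  exact ⟨fun h => hx.1 (show (m : ℝ≥0∞) < absFun f x from lt_of_le_of_lt h1 h),
    (show x ≤ m from hx.2).trans h2⟩

theorem exists_mem_truncSet (f : Meas 𝕜) (x : ℝ) : ∃ n, x ∈ truncSet f n := by
  obtain ⟨m, hm⟩ := ENNReal.exists_nat_gt (show absFun f x ≠ ∞ from enorm_ne_top)
  obtain ⟨k, hk⟩ := exists_nat_ge x
  refine ⟨max m k, ?_, ?_⟩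
  · have h1 : absFun f x ≤ ((max m k : ℕ) : ℝ≥0∞) := hm.le.trans (by exact_mod_cast le_max_left m k)
    exact not_lt.2 h1
  · exact hk.trans (by exact_mod_cast le_max_right m k)

theorem setLIntegral_rearr_le_iSup_trunc (f : Meas 𝕜) {p : ℝ} (hp : 0 < p) (A : Set ℝ) :
    ∫⁻ s in A, rearr (absFun f) s ^ p ≤ ⨆ n, ∫⁻ s in A, rearr (absFun (trunc f n)) s ^ p := by
  have h1 := setLIntegral_rearr_le_iSup (u := absFun f)
    (v := fun n => (truncSet f n).indicator (absFun f))
    (fun x m n hmn => indicator_le_indicator_of_subset (monotone_truncSet f hmn)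
      (fun _ => zero_le) x) (.of_forall fun x => ?_) hp A
  · refine h1.trans (iSup_mono fun n => lintegral_mono fun s => ENNReal.rpow_le_rpow ?_ hp.le)
    refine rearr_mono_ae ?_ s
    filter_upwards [absFun_restr (measurableSet_truncSet f n) f] with x hx using hx.ge
  · obtain ⟨n, hn⟩ := exists_mem_truncSet f x
    refine le_iSup_of_le n ?_
    rw [indicator_of_mem hn]

theorem trunc_mem {E : QuasiBanachFunctionSpace 𝕜} {f : Meas 𝕜} (hf : f ∈ E.carrier) (n : ℕ) :
    trunc f n ∈ E.carrier ∧ E.qnorm (trunc f n) ≤ E.qnorm f := by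
  refine QuasiBanachFunctionSpace.Dom.mem ((E.dom_self hf).mono ?_ le_rfl)
  filter_upwards [absFun_restr (measurableSet_truncSet f n) f] with x hx
  rw [show ‖trunc f n x‖ₑ = _ from hx]
  exact indicator_le_self' (fun _ _ => zero_le) x

theorem trunc_ae_le (f : Meas 𝕜) (n : ℕ) : ∀ᵐ x ∂halfLine, ‖trunc f n x‖ₑ ≤ (n : ℝ≥0) := by
  filter_upwards [absFun_restr (measurableSet_truncSet f n) f] with x hx
  rw [show ‖trunc f n x‖ₑ = _ from hx]
  by_cases h : x ∈ truncSet f n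
  · rw [indicator_of_mem h]
    have h1 : ¬ (n : ℝ≥0∞) < absFun f x := h.1
    rw [ENNReal.coe_natCast]
    exact not_lt.1 h1
  · simp [h]

theorem trunc_mem_LSpace_top (f : Meas 𝕜) (n : ℕ) : trunc f n ∈ LSpace 𝕜 ∞ :=
  mem_LSpace_top.2 ⟨n, trunc_ae_le f n⟩

theorem trunc_mem_L0Space (f : Meas 𝕜) (n : ℕ) : trunc f n ∈ L0Space 𝕜 := by
  rw [mem_L0Space]
  have h1 : distr (absFun (trunc f n)) 0 ≤ halfLine (Iic (n : ℝ)) := by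
    refine measure_mono_ae ?_
    filter_upwards [absFun_restr (measurableSet_truncSet f n) f] with x hx hx0
    by_contra hcon
    have h2 : 0 < absFun (trunc f n) x := hx0
    rw [show absFun (trunc f n) x = _ from hx,
      indicator_of_notMem fun h : x ∈ truncSet f n => hcon h.2] at h2
    exact lt_irrefl _ h2
  refine h1.trans_lt ?_
  rw [Measure.restrict_apply measurableSet_Iic, inter_comm, Ioi_inter_Iic, Real.volume_Ioc]
  exact ENNReal.ofReal_lt_top

/-- The indicator function of `(0, 1]`. -/
def unitFun (𝕜 : Type*) [RCLike 𝕜] : Meas 𝕜 := restr (Ioc 0 1) measurableSet_Ioc 1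

theorem absFun_unitFun : ∀ᵐ x ∂halfLine, absFun (unitFun 𝕜) x = (Ioc (0 : ℝ) 1).indicator 1 x := by
  filter_upwards [absFun_restr measurableSet_Ioc (1 : Meas 𝕜),
    AEEqFun.coeFn_one (α := ℝ) (β := 𝕜) (μ := halfLine)] with x hx h1
  rw [unitFun, hx]
  by_cases h : x ∈ Ioc (0 : ℝ) 1
  · rw [indicator_of_mem h, indicator_of_mem h, absFun, h1]
    simp
  · rw [indicator_of_notMem h, indicator_of_notMem h]

theorem halfLine_Ioc_zero_one : halfLine (Ioc (0 : ℝ) 1) = 1 := by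
  rw [Measure.restrict_apply measurableSet_Ioc,
    inter_eq_left.2 Ioc_subset_Ioi_self, Real.volume_Ioc]
  simp

theorem distr_unitFun_zero : distr (absFun (unitFun 𝕜)) 0 = 1 := by
  rw [← halfLine_Ioc_zero_one]
  refine measure_congr ?_
  filter_upwards [absFun_unitFun (𝕜 := 𝕜)] with x hx
  have h1 : ((0 : ℝ≥0∞) < absFun (unitFun 𝕜) x) = (x ∈ Ioc (0 : ℝ) 1) := by
    rw [hx]
    by_cases h : x ∈ Ioc (0 : ℝ) 1 <;> simp [indicator, h]
  exact h1

theorem unitFun_ne_zero : unitFun 𝕜 ≠ 0 := by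
  intro h
  have h1 := distr_unitFun_zero (𝕜 := 𝕜)
  rw [h, ← suppNorm_eq_distr] at h1
  have h2 : suppNorm (0 : Meas 𝕜) = 0 := by
    have h0 : ((0 : Meas 𝕜) : ℝ → 𝕜) =ᵐ[halfLine] 0 := AEEqFun.coeFn_zero
    exact ae_iff.1 h0
  rw [h2] at h1
  exact zero_ne_one h1

theorem unitFun_ae_le : ∀ᵐ x ∂halfLine, ‖unitFun 𝕜 x‖ₑ ≤ (1 : ℝ≥0) := by
  filter_upwards [absFun_unitFun (𝕜 := 𝕜)] with x hx
  rw [show ‖unitFun 𝕜 x‖ₑ = _ from hx]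
  by_cases h : x ∈ Ioc (0 : ℝ) 1 <;> simp [h]

theorem lintegral_unitFun {p : ℝ} (hp : 0 < p) : ∫⁻ x, ‖unitFun 𝕜 x‖ₑ ^ p ∂halfLine = 1 := by
  rw [← halfLine_Ioc_zero_one, ← lintegral_indicator_one measurableSet_Ioc]
  refine lintegral_congr_ae ?_
  filter_upwards [absFun_unitFun (𝕜 := 𝕜)] with x hx
  rw [show ‖unitFun 𝕜 x‖ₑ = _ from hx]
  by_cases h : x ∈ Ioc (0 : ℝ) 1 <;> simp [h, hp]

theorem exists_rearr_pos {f : Meas 𝕜} (hf : f ≠ 0) :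
    ∃ t : ℝ, 0 < t ∧ t ≤ 1 ∧ 0 < rearr (absFun f) t := by
  have h0 : 0 < distr (absFun f) 0 := by
    rw [← suppNorm_eq_distr, pos_iff_ne_zero]
    intro h
    apply hf
    apply AEEqFun.ext
    have h1 : (f : ℝ → 𝕜) =ᵐ[halfLine] 0 := ae_iff.2 h
    exact h1.trans AEEqFun.coeFn_zero.symm
  obtain ⟨t, ht0, ht⟩ := ENNReal.lt_iff_exists_nnreal_btwn.1 h0
  refine ⟨min t 1, lt_min (by exact_mod_cast ht0) one_pos, min_le_right _ _, ?_⟩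
  rw [lt_rearr_iff]
  refine (ENNReal.ofReal_le_ofReal (min_le_left _ _)).trans_lt ?_
  rwa [ENNReal.ofReal_coe_nnreal]

theorem head_one_pos {f : Meas 𝕜} (hf : f ≠ 0) {p : ℝ} (hp : 0 < p) : head (absFun f) p 1 ≠ 0 := by
  obtain ⟨t, ht0, ht1, ht⟩ := exists_rearr_pos hf
  intro h
  have h1 := (ofReal_mul_rearr_le_head (absFun f) hp.le t).trans (head_mono _ p ht1)
  rw [h, nonpos_iff_eq_zero, mul_eq_zero, ENNReal.ofReal_eq_zero,
    ENNReal.rpow_eq_zero_iff_of_pos hp] at h1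
  rcases h1 with h1 | h1
  · linarith
  · exact absurd h1 (pos_iff_ne_zero.1 ht)

/-- The normalized head integrals of a decreasing function decrease. -/
theorem ofReal_mul_head_one_le (u : ℝ → ℝ≥0∞) {p : ℝ} (hp : 0 < p) {t : ℝ} (ht0 : 0 < t)
    (ht1 : t ≤ 1) : ENNReal.ofReal t * head u p 1 ≤ head u p t := by
  have h1 := setLIntegral_comp_div (measurable_rearr_rpow u p) (inv_pos.2 ht0)
    (A := Ioc 0 1) (B := Ioc 0 t) measurableSet_Ioc measurableSet_Ioc (fun s => by
      rw [div_inv_eq_mul]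
      simp only [mem_Ioc, mul_pos_iff_of_pos_right ht0, mul_le_iff_le_one_left ht0])
  calc ENNReal.ofReal t * head u p 1
      ≤ ENNReal.ofReal t * ∫⁻ s in Ioc 0 1, rearr u (s / t⁻¹) ^ p := by
        gcongr
        refine setLIntegral_mono' measurableSet_Ioc fun s hs => ENNReal.rpow_le_rpow ?_ hp.le
        refine rearr_antitone u ?_
        rw [div_inv_eq_mul]
        exact mul_le_of_le_one_right hs.1.le ht1
    _ = head u p t := by
        rw [h1, ← mul_assoc, ← ENNReal.ofReal_mul ht0.le, mul_inv_cancel₀ ht0.ne',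
          ENNReal.ofReal_one, one_mul]
        rfl

/-- For t ≤ 1 the head of the bounded function h grows at most linearly, while that of f is at least
t times its value at 1; for t ≥ 1 the head of h is at most A and that of f at least its value at 1.
-/
theorem head_le_div_mul_head {f h : Meas 𝕜} {p : ℝ} (hp : 0 < p) {b : ℝ≥0} {A : ℝ≥0∞}
    (hb : ∀ᵐ x ∂halfLine, ‖h x‖ₑ ≤ b) (hA : ∫⁻ x, ‖h x‖ₑ ^ p ∂halfLine ≤ A)
    (hAb : (b : ℝ≥0∞) ^ p ≤ A) (hf0 : head (absFun f) p 1 ≠ 0) (hf1 : head (absFun f) p 1 ≠ ∞)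
    {t : ℝ} (ht : 0 < t) :
    head (absFun h) p t ≤ A / head (absFun f) p 1 * head (absFun f) p t := by
  have hcancel : A / head (absFun f) p 1 * head (absFun f) p 1 = A :=
    ENNReal.div_mul_cancel hf0 hf1
  rcases le_total t 1 with h1 | h1
  · calc head (absFun h) p t ≤ ENNReal.ofReal t * (b : ℝ≥0∞) ^ p := head_le_of_ae_le hb hp.le t
      _ ≤ ENNReal.ofReal t * (A / head (absFun f) p 1 * head (absFun f) p 1) := by
          rw [hcancel]
          gcongr
      _ = A / head (absFun f) p 1 * (ENNReal.ofReal t * head (absFun f) p 1) := by ring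
      _ ≤ A / head (absFun f) p 1 * head (absFun f) p t := by
          gcongr
          exact ofReal_mul_head_one_le _ hp ht h1
  · calc head (absFun h) p t ≤ A :=
          (head_le_lintegral (measurable_enorm_coe h) hp t).trans hA
      _ = A / head (absFun f) p 1 * head (absFun f) p 1 := hcancel.symm
      _ ≤ A / head (absFun f) p 1 * head (absFun f) p t := by
          gcongr
          exact head_mono _ p h1

/-- As the H n are unbounded, these estimates would force the quasi-norm of the nonzero element u to
vanish. -/
theorem not_forall_qnorm_le {E : QuasiBanachFunctionSpace 𝕜} {u : Meas 𝕜} (hu : u ≠ 0) {p B : ℝ}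
    (hp : 0 < p) {H : ℕ → ℝ≥0∞} (hsup : ⨆ n, H n = ∞) :
    ¬ ∀ n, H n ≠ 0 → u ∈ E.carrier ∧ E.qnorm u ≤ ((H n)⁻¹.toNNReal ^ p⁻¹ : ℝ≥0) * B := by
  intro h
  have hex : ∀ M : ℝ≥0, ∃ n, (M : ℝ≥0∞) < H n := fun M =>
    lt_iSup_iff.1 (hsup ▸ ENNReal.coe_lt_top)
  obtain ⟨n₀, hn₀⟩ := hex 0
  have huE : u ∈ E.carrier := (h n₀ (by simpa using hn₀.ne')).1
  have hq : 0 < E.qnorm u := lt_of_le_of_ne (E.qnorm_nonneg u huE)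
    fun h0 => hu ((E.qnorm_eq_zero_iff u huE).1 h0.symm)
  -- Chosen so that m times the quasi-norm of u exceeds |B|.
  set m : ℝ≥0 := (|B| / E.qnorm u + 1).toNNReal with hm
  have hm' : (m : ℝ) = |B| / E.qnorm u + 1 := Real.coe_toNNReal _ (by positivity)
  have hm0 : 0 < m := by
    rw [← NNReal.coe_pos, hm']
    positivity
  obtain ⟨n, hn⟩ := hex (m ^ p)
  have h1 := (h n (zero_le.trans_lt hn).ne').2
  have h2 : (H n)⁻¹.toNNReal ^ p⁻¹ ≤ m⁻¹ := by
    have h3 : (H n)⁻¹ ≤ ((m⁻¹ ^ p : ℝ≥0) : ℝ≥0∞) := by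
      rw [NNReal.inv_rpow, ENNReal.coe_inv (by positivity)]
      exact ENNReal.inv_le_inv.2 hn.le
    have h4 := ENNReal.toNNReal_mono ENNReal.coe_ne_top h3
    rw [ENNReal.toNNReal_coe] at h4
    rw [NNReal.rpow_inv_le_iff hp]
    exact h4
  have h5 : E.qnorm u ≤ (m : ℝ)⁻¹ * |B| := by
    refine h1.trans ((mul_le_mul_of_nonneg_left (le_abs_self B) (NNReal.coe_nonneg _)).trans ?_)
    refine mul_le_mul_of_nonneg_right ?_ (abs_nonneg B)
    exact_mod_cast h2
  have h6 : (m : ℝ) * E.qnorm u ≤ |B| := by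
    rw [inv_mul_eq_div, le_div_iff₀ (by exact_mod_cast hm0)] at h5
    linarith
  rw [hm', add_mul, div_mul_cancel₀ _ hq.ne', one_mul] at h6
  linarith

theorem coe_toNNReal_inv_mul {x : ℝ≥0∞} (h0 : x ≠ 0) (h1 : x ≠ ∞) :
    (x⁻¹.toNNReal : ℝ≥0∞) = 1 / x ∧ x⁻¹.toNNReal ≠ 0 := by
  refine ⟨?_, ?_⟩
  · rw [ENNReal.coe_toNNReal (ENNReal.inv_ne_top.2 h0), one_div]
  · rw [ENNReal.toNNReal_ne_zero]
    exact ⟨ENNReal.inv_ne_zero.2 h1, ENNReal.inv_ne_top.2 h0⟩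

/-- If f in E had an infinite head, its truncations would have finite heads tending to infinity and
bounded quasi-norms. Each majorizes a multiple of the unit function, whose quasi-norm would then be
0. Truncation is essential because `HeadMaj` requires both functions to lie in L_1 + L_∞, so it says
nothing about f itself. -/
theorem HeadMonotone.le_sup {E : QuasiBanachFunctionSpace 𝕜} {p : ℝ} (hp : 0 < p)
    (h : HeadMonotone E p) : E.carrier ≤ LSpace 𝕜 (ENNReal.ofReal p) ⊔ LSpace 𝕜 ∞ := by
  obtain ⟨c, hc, H⟩ := h.scaled hp
  intro f hf
  by_contra hnot
  have hinf : head (absFun f) p 1 = ∞ := by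
    by_contra hne
    exact hnot (mem_sup_top_of_head hp one_pos (lt_top_iff_ne_top.2 hne))
  have hsup : ⨆ n, head (absFun (trunc f n)) p 1 = ∞ :=
    top_le_iff.1 (hinf ▸ setLIntegral_rearr_le_iSup_trunc f hp _)
  refine not_forall_qnorm_le (E := E) (unitFun_ne_zero (𝕜 := 𝕜)) (B := c * E.qnorm f) hp hsup
    fun n hn => ?_
  have hts : trunc f n ∈ LSpace 𝕜 (ENNReal.ofReal p) ⊔ LSpace 𝕜 ∞ :=
    Submodule.mem_sup_right (trunc_mem_LSpace_top f n)
  have hus : unitFun 𝕜 ∈ LSpace 𝕜 (ENNReal.ofReal p) ⊔ LSpace 𝕜 ∞ :=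
    Submodule.mem_sup_right (mem_LSpace_top.2 ⟨1, unitFun_ae_le⟩)
  have hfin : head (absFun (trunc f n)) p 1 ≠ ∞ := (head_lt_top_of_mem_sup hp hts one_pos).ne
  obtain ⟨e1, e2⟩ := coe_toNNReal_inv_mul hn hfin
  obtain ⟨h1, h2⟩ := H _ (trunc_mem hf n).1 _ _ e2 hts hus fun t ht => by
    rw [e1]
    exact head_le_div_mul_head hp unitFun_ae_le (lintegral_unitFun hp).le (by simp) hn hfin ht
  refine ⟨h1, h2.trans ?_⟩
  gcongr
  exact (trunc_mem hf n).2

theorem HeadMonotone.inf_le {E : QuasiBanachFunctionSpace 𝕜} (hE : E.carrier ≠ ⊥) {p : ℝ}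
    (hp : 0 < p) (h : HeadMonotone E p) :
    LSpace 𝕜 (ENNReal.ofReal p) ⊓ LSpace 𝕜 ∞ ≤ E.carrier := by
  obtain ⟨c, hc, H⟩ := h.scaled hp
  obtain ⟨f, hf, hf0⟩ := Submodule.exists_mem_ne_zero_of_ne_bot hE
  rintro g ⟨hg1, hg2⟩
  obtain ⟨b, hb⟩ := mem_LSpace_top.1 hg2
  have hg1' := (mem_LSpace_ofReal hp).1 hg1
  set A := max (∫⁻ x, ‖g x‖ₑ ^ p ∂halfLine) ((b : ℝ≥0∞) ^ p) with hA
  have hAfin : A ≠ ∞ := (max_lt hg1' (ENNReal.rpow_lt_top_of_nonneg hp.le ENNReal.coe_ne_top)).ne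
  have hfs := h.le_sup hp hf
  have h0 := head_one_pos hf0 hp
  have h1 := (head_lt_top_of_mem_sup hp hfs one_pos).ne
  have hL : ((A / head (absFun f) p 1).toNNReal : ℝ≥0∞) = A / head (absFun f) p 1 :=
    ENNReal.coe_toNNReal (ENNReal.div_ne_top hAfin h0)
  -- Adding 1 only ensures that the constant is nonzero, also when g = 0.
  refine (H f hf g ((A / head (absFun f) p 1).toNNReal + 1) (by positivity) hfs
    (Submodule.mem_sup_left hg1) fun t ht => ?_).1
  rw [ENNReal.coe_add, hL]
  refine (head_le_div_mul_head hp hb (le_max_left _ _) (le_max_right _ _) h0 h1 ht).trans ?_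
  gcongr
  exact le_self_add

/-! ### Bounded operators, and the couple (L_p, L_∞) -/

section Operators

variable {V : Submodule 𝕜 (Meas 𝕜)} {T : V →ₗ[𝕜] V}

theorem RestrictsToBounded.lintegral_le {p : ℝ} (hp : 0 < p)
    (h : RestrictsToBounded T (LSpace 𝕜 (ENNReal.ofReal p)) (LNorm (ENNReal.ofReal p))) :
    ∃ C : ℝ≥0, ∀ f : V, (f : Meas 𝕜) ∈ LSpace 𝕜 (ENNReal.ofReal p) →
      ∫⁻ x, ‖(T f : Meas 𝕜) x‖ₑ ^ p ∂halfLine ≤ C * ∫⁻ x, ‖(f : Meas 𝕜) x‖ₑ ^ p ∂halfLine := by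
  obtain ⟨C, hC⟩ := h
  exact ⟨C ^ p, fun f hf => (LNorm_ofReal_le_iff hp _ _ C).1 (hC f hf).2⟩

theorem RestrictsToBounded.ae_le (h : RestrictsToBounded T (LSpace 𝕜 ∞) (LNorm ∞)) :
    ∃ C : ℝ≥0, ∀ f : V, (f : Meas 𝕜) ∈ LSpace 𝕜 ∞ → ∀ b : ℝ≥0∞,
      (∀ᵐ x ∂halfLine, ‖(f : Meas 𝕜) x‖ₑ ≤ b) →
      ∀ᵐ x ∂halfLine, ‖(T f : Meas 𝕜) x‖ₑ ≤ C * b := by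
  obtain ⟨C, hC⟩ := h
  refine ⟨C, fun f hf b hb => LNorm_top_le_iff.1 ((hC f hf).2.trans ?_)⟩
  gcongr
  exact LNorm_top_le_iff.2 hb

theorem restrictsToBounded_of_qnorm_le {E : QuasiBanachFunctionSpace 𝕜} {K : ℝ} (hK : 0 ≤ K)
    (h : ∀ f : V, (f : Meas 𝕜) ∈ E.carrier →
      (T f : Meas 𝕜) ∈ E.carrier ∧ E.qnorm (T f : Meas 𝕜) ≤ K * E.qnorm (f : Meas 𝕜)) :
    RestrictsToBounded T E.carrier (fun f => ENNReal.ofReal (E.qnorm f)) := by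
  refine ⟨K.toNNReal, fun f hf => ⟨(h f hf).1, ?_⟩⟩
  change ENNReal.ofReal (E.qnorm (T f : Meas 𝕜)) ≤ ENNReal.ofReal K * ENNReal.ofReal (E.qnorm f)
  rw [← ENNReal.ofReal_mul hK]
  exact ENNReal.ofReal_le_ofReal (h f hf).2

theorem map_eq_add {f : V} {g h : Meas 𝕜} (hg : g ∈ V) (hh : h ∈ V) (hf : g + h = f) :
    (T f : Meas 𝕜) = T ⟨g, hg⟩ + T ⟨h, hh⟩ := by
  have : f = ⟨g, hg⟩ + ⟨h, hh⟩ := Subtype.ext hf.symm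
  rw [this, map_add]
  rfl

end Operators

/-- Split f at r = μ(t, f). The image of the upper part is controlled in L_p by the head of f; the
image of the lower part is at most D r, and t r^p is at most the head of f. -/
theorem exists_head_map_le {p : ℝ} (hp : 0 < p)
    {T : (LSpace 𝕜 (ENNReal.ofReal p) ⊔ LSpace 𝕜 ∞ : Submodule 𝕜 (Meas 𝕜)) →ₗ[𝕜]
      (LSpace 𝕜 (ENNReal.ofReal p) ⊔ LSpace 𝕜 ∞ : Submodule 𝕜 (Meas 𝕜))}
    (hX : RestrictsToBounded T (LSpace 𝕜 (ENNReal.ofReal p)) (LNorm (ENNReal.ofReal p)))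
    (hY : RestrictsToBounded T (LSpace 𝕜 ∞) (LNorm ∞)) :
    ∃ L : ℝ≥0, L ≠ 0 ∧ ∀ f t, 0 < t →
      head (absFun (T f : Meas 𝕜)) p t ≤ L * head (absFun (f : Meas 𝕜)) p t := by
  obtain ⟨C, hC⟩ := hX.lintegral_le hp
  obtain ⟨D, hD⟩ := hY.ae_le
  refine ⟨sumConst p * (C + D ^ p) + 1, by positivity, fun f t ht => ?_⟩
  have hfin := head_lt_top_of_mem_sup hp f.2 ht
  have hr := rearr_ne_top_of_head hp ht hfin
  set r := rearr (absFun (f : Meas 𝕜)) t with hrdef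
  have h1 := upperPart_mem_LSpace hp ht.le hfin
  have h2 := lowerPart_mem_LSpace_top (f : Meas 𝕜) hr
  have h3 := map_eq_add (T := T) (Submodule.mem_sup_left h1) (Submodule.mem_sup_right h2)
    (upperPart_add_lowerPart (f : Meas 𝕜) r)
  rw [h3]
  refine (head_add_le (absFun_add_le _ _) hp.le ht.le).trans ?_
  have h4 := (head_le_lintegral (measurable_enorm_coe (T ⟨_, Submodule.mem_sup_left h1⟩ : Meas 𝕜))
    hp t).trans ((hC ⟨_, Submodule.mem_sup_left h1⟩ h1).trans
      (mul_le_mul_right (lintegral_upperPart_le (f : Meas 𝕜) hp ht.le) _))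
  have h5 := head_le_of_ae_le (hD ⟨_, Submodule.mem_sup_right h2⟩ h2 r (lowerPart_ae_le _ _))
    hp.le t
  have h6 : ENNReal.ofReal t * (D * r) ^ p ≤ (D ^ p : ℝ≥0) * head (absFun (f : Meas 𝕜)) p t := by
    rw [ENNReal.mul_rpow_of_nonneg _ _ hp.le, ENNReal.coe_rpow_of_nonneg _ hp.le, mul_left_comm]
    gcongr
    exact ofReal_mul_rearr_le_head _ hp.le t
  calc _ ≤ (sumConst p : ℝ≥0∞) * (C * head (absFun (f : Meas 𝕜)) p t +
        (D ^ p : ℝ≥0) * head (absFun (f : Meas 𝕜)) p t) :=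
        mul_le_mul_right (add_le_add h4 (h5.trans h6)) _
    _ = ((sumConst p * (C + D ^ p) : ℝ≥0) : ℝ≥0∞) * head (absFun (f : Meas 𝕜)) p t := by
        push_cast
        ring
    _ ≤ _ := by
        gcongr
        exact le_self_add

theorem HeadMonotone.isInterpolation {E : QuasiBanachFunctionSpace 𝕜} (hE : E.carrier ≠ ⊥) {p : ℝ}
    (hp : 0 < p) (h : HeadMonotone E p) : IsInterpolationLpLq E (ENNReal.ofReal p) ∞ := by
  refine ⟨h.inf_le hE hp, h.le_sup hp, fun T hX hY => ?_⟩
  obtain ⟨c, hc, H⟩ := h.scaled hp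
  obtain ⟨L, hL, HL⟩ := exists_head_map_le hp hX hY
  refine restrictsToBounded_of_qnorm_le (K := (L ^ p⁻¹ : ℝ≥0) * c) (by positivity) fun f hf => ?_
  rw [mul_assoc]
  exact H f hf (T f) L hL f.2 (T f).2 fun t ht => HL f t ht

/-! ### Tail monotone spaces, and the couple (L_0, L_q) -/

theorem tail_eq_zero {u : ℝ → ℝ≥0∞} {q : ℝ} (hq : 0 < q) {t : ℝ}
    (h : distr u 0 ≤ ENNReal.ofReal t) : tail u q t = 0 := by
  rw [tail, setLIntegral_congr_fun measurableSet_Ioi (g := 0), Pi.zero_def, lintegral_zero]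
  intro s hs
  have h2 : rearr u s ≤ 0 := rearr_le_iff.2 (h.trans (ENNReal.ofReal_le_ofReal (le_of_lt hs)))
  rw [nonpos_iff_eq_zero] at h2
  simp [h2, hq]

theorem tail_le_div_mul_tail {f h : Meas 𝕜} {q : ℝ} (hq : 0 < q) {A : ℝ≥0∞} {c : ℝ}
    (hc : distr (absFun h) 0 ≤ ENNReal.ofReal c) (hA : ∫⁻ x, ‖h x‖ₑ ^ q ∂halfLine ≤ A)
    (hf0 : tail (absFun f) q c ≠ 0) (hf1 : tail (absFun f) q c ≠ ∞) {t : ℝ} (ht : 0 < t) :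
    tail (absFun h) q t ≤ A / tail (absFun f) q c * tail (absFun f) q t := by
  rcases le_total t c with h1 | h1
  · calc tail (absFun h) q t ≤ A :=
          (tail_le_lintegral (measurable_enorm_coe h) hq ht.le).trans hA
      _ = A / tail (absFun f) q c * tail (absFun f) q c := (ENNReal.div_mul_cancel hf0 hf1).symm
      _ ≤ A / tail (absFun f) q c * tail (absFun f) q t := by
          gcongr
          exact tail_antitone _ q h1
  · rw [tail_eq_zero hq (hc.trans (ENNReal.ofReal_le_ofReal h1))]
    exact zero_le

/-- The truncation argument of `HeadMonotone.le_sup`, with tails; here it matters that truncations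
have bounded support. -/
theorem TailMonotone.le_sup {E : QuasiBanachFunctionSpace 𝕜} {q : ℝ} (hq : 0 < q)
    (h : TailMonotone E q) : E.carrier ≤ L0Space 𝕜 ⊔ LSpace 𝕜 (ENNReal.ofReal q) := by
  obtain ⟨c, hc, H⟩ := h.scaled hq
  intro f hf
  by_contra hnot
  have hinf : tail (absFun f) q 1 = ∞ := by
    by_contra hne
    exact hnot (mem_sup_of_tail hq one_pos (lt_top_iff_ne_top.2 hne))
  have hsup : ⨆ n, tail (absFun (trunc f n)) q 1 = ∞ :=
    top_le_iff.1 (hinf ▸ setLIntegral_rearr_le_iSup_trunc f hq _)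
  refine not_forall_qnorm_le (E := E) (unitFun_ne_zero (𝕜 := 𝕜)) (B := c * E.qnorm f) hq hsup
    fun n hn => ?_
  have hts : trunc f n ∈ L0Space 𝕜 ⊔ LSpace 𝕜 (ENNReal.ofReal q) :=
    Submodule.mem_sup_left (trunc_mem_L0Space f n)
  have hus : unitFun 𝕜 ∈ L0Space 𝕜 ⊔ LSpace 𝕜 (ENNReal.ofReal q) :=
    Submodule.mem_sup_right ((mem_LSpace_ofReal hq).2
      (by rw [lintegral_unitFun hq]; exact ENNReal.one_lt_top))
  have hfin : tail (absFun (trunc f n)) q 1 ≠ ∞ := (tail_lt_top_of_mem_sup hq hts one_pos).ne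
  obtain ⟨e1, e2⟩ := coe_toNNReal_inv_mul hn hfin
  obtain ⟨h1, h2⟩ := H _ (trunc_mem hf n).1 _ _ e2 hts hus fun t ht => by
    rw [e1]
    exact tail_le_div_mul_tail hq (by rw [distr_unitFun_zero, ENNReal.ofReal_one])
      (lintegral_unitFun hq).le hn hfin ht
  refine ⟨h1, h2.trans ?_⟩
  gcongr
  exact (trunc_mem hf n).2

theorem halfLine_block_inter_cumul (k : ℕ) {u : ℝ → ℝ≥0∞} (hu : Measurable u) (s : ℝ≥0∞) :
    halfLine (block k ∩ {x | s < u (cumul (blockMeasure k) x)}) = distr u s := by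
  have hm : MeasurableSet {x | s < u x} := measurableSet_lt measurable_const hu
  have h1 := lintegral_cumul_block k (w := {x | s < u x}.indicator 1) (measurable_one.indicator hm)
  rw [lintegral_indicator_one hm] at h1
  have hm2 : MeasurableSet {x | s < u (cumul (blockMeasure k) x)} :=
    hm.preimage (measurable_cumul_block k)
  rw [distr, ← h1, inter_comm, ← Measure.restrict_apply hm2, ← lintegral_indicator_one hm2]
  rfl

/-- The copy of f on a block has the same distribution as f, hence is tail majorized by it. -/
theorem TailMonotone.dom_spread {E : QuasiBanachFunctionSpace 𝕜} {q : ℝ} (hq : 0 < q)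
    (h : TailMonotone E q) :
    ∃ c : ℝ, 0 < c ∧ ∀ f ∈ E.carrier, ∀ k,
      E.Dom ((block k).indicator fun x => absFun f (cumul (blockMeasure k) x))
        (c * E.qnorm f) := by
  have hsup := h.le_sup hq
  obtain ⟨c, hc, H⟩ := h
  refine ⟨c, hc, fun f hf k => ?_⟩
  have hG := gaugeClass_spread (isGauge_tailGauge hq le_rfl) k
  set g : Meas 𝕜 := wcomp ((block k).indicator 1) (cumul (blockMeasure k)) f with hg
  have hgae : ∀ᵐ x ∂halfLine,
      absFun g x = (block k).indicator (fun x => absFun f (cumul (blockMeasure k) x)) x := by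
    filter_upwards [hG.enorm_wcomp f] with x hx
    rw [absFun, hx]
    by_cases hxk : x ∈ block k <;> simp [hxk]
  have hd : ∀ s, distr (absFun g) s ≤ distr (absFun f) s := by
    intro s
    rw [← halfLine_block_inter_cumul k (measurable_enorm_coe f)]
    refine measure_mono_ae ?_
    filter_upwards [hgae] with x hx hxs
    have hxs' : s < absFun g x := hxs
    rw [hx] at hxs'
    by_cases hxk : x ∈ block k
    · rw [indicator_of_mem hxk] at hxs'
      exact ⟨hxk, hxs'⟩
    · rw [indicator_of_notMem hxk] at hxs'
      exact absurd hxs' not_lt_zero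
  have hr : ∀ t, tail (absFun g) q t ≤ tail (absFun f) q t := fun t =>
    lintegral_mono fun s => ENNReal.rpow_le_rpow
      (rearr_le_iff.2 ((hd _).trans (distr_rearr_self_le _ s))) hq.le
  have hfs := hsup hf
  have hgs : g ∈ L0Space 𝕜 ⊔ LSpace 𝕜 (ENNReal.ofReal q) :=
    mem_sup_of_tail hq one_pos ((hr 1).trans_lt (tail_lt_top_of_mem_sup hq hfs one_pos))
  obtain ⟨h1, h2⟩ := H f hf g hgs ((tailMaj_absPow_iff hq).2 ⟨hgs, hfs, fun t _ => hr t⟩)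
  refine (E.dom_self h1).mono ?_ h2
  filter_upwards [hgae] with x hx using hx.ge

/-- F dominates a sum of N disjoint copies of |f|, so its distribution function is at least N times
that of f and its rearrangement dominates the N-fold dilation. This absorbs the dilation lost when
the support of the upper part is enlarged by an operator. -/
theorem TailMonotone.exists_copies {E : QuasiBanachFunctionSpace 𝕜} {q : ℝ} (hq : 0 < q)
    (h : TailMonotone E q) (N : ℕ) (hN : N ≠ 0) :
    ∃ K : ℝ, 0 ≤ K ∧ ∀ f ∈ E.carrier, ∃ F ∈ E.carrier, E.qnorm F ≤ K * E.qnorm f ∧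
      ∀ s, 0 < s → tail (absFun f) q s ≤ tail (absFun F) q (N * s) := by
  obtain ⟨c, hc, H⟩ := h.dom_spread hq
  obtain ⟨A, hA0, hA⟩ := E.exists_dom_add
  have hdom : ∀ n : ℕ, ∃ K : ℝ, 0 ≤ K ∧ ∀ f ∈ E.carrier,
      E.Dom (fun x => ∑ k ∈ Finset.range n,
        (block k).indicator (fun x => absFun f (cumul (blockMeasure k) x)) x) (K * E.qnorm f) := by
    intro n
    induction n with
    | zero =>
      refine ⟨1, zero_le_one, fun f hf => (E.dom_self hf).mono (.of_forall fun x => ?_) (by simp)⟩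
      simp
    | succ n ih =>
      obtain ⟨K, hK0, hK⟩ := ih
      refine ⟨A * (K + c), by positivity, fun f hf => ?_⟩
      refine (hA (hK f hf) (H f hf n)).mono (.of_forall fun x => ?_) (le_of_eq (by ring))
      rw [Finset.sum_range_succ]
  obtain ⟨K, hK0, hK⟩ := hdom N
  refine ⟨K, hK0, fun f hf => ?_⟩
  obtain ⟨F, hF, hFK, hFle⟩ := hK f hf
  refine ⟨F, hF, hFK, fun s hs => ?_⟩
  have hm : ∀ (k : ℕ) (σ : ℝ≥0∞),
      MeasurableSet (block k ∩ {x | σ < absFun f (cumul (blockMeasure k) x)}) := fun k σ =>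
    (measurableSet_block k).inter (measurableSet_lt measurable_const
      ((measurable_enorm_coe f).comp (measurable_cumul_block k)))
  have hd : ∀ σ, N * distr (absFun f) σ ≤ distr (absFun F) σ := by
    intro σ
    have h1 : halfLine (⋃ k ∈ Finset.range N,
        block k ∩ {x | σ < absFun f (cumul (blockMeasure k) x)}) = N * distr (absFun f) σ := by
      rw [measure_biUnion_finset _ fun k _ => hm k σ]
      · simp_rw [halfLine_block_inter_cumul _ (measurable_enorm_coe f)]
        simp
      · intro i _ j _ hij
        exact (pairwise_disjoint_block hij).mono inter_subset_left inter_subset_left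
    rw [← h1]
    refine measure_mono_ae ?_
    filter_upwards [hFle] with x hx hxU
    obtain ⟨k, hkN, hxk, hxσ⟩ := mem_iUnion₂.1 hxU
    refine lt_of_lt_of_le ?_ hx
    refine lt_of_lt_of_le ?_ (Finset.single_le_sum (fun _ _ => zero_le) hkN)
    rw [indicator_of_mem hxk]
    exact hxσ
  have hN0 : (0 : ℝ) < N := by positivity
  have hr : ∀ τ, rearr (absFun f) (τ / N) ≤ rearr (absFun F) τ := by
    intro τ
    rw [rearr_le_iff, ENNReal.ofReal_div_of_pos hN0, ENNReal.ofReal_natCast,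
      ENNReal.le_div_iff_mul_le (.inl (by exact_mod_cast hN)) (.inl (ENNReal.natCast_ne_top N)),
      mul_comm]
    exact (hd _).trans (distr_rearr_self_le _ τ)
  have h2 := setLIntegral_comp_div (measurable_rearr_rpow (absFun f) q) hN0
    (A := Ioi (N * s)) (B := Ioi s) measurableSet_Ioi measurableSet_Ioi
    (fun x => by simp only [mem_Ioi, lt_div_iff₀ hN0, mul_comm])
  calc tail (absFun f) q s ≤ ENNReal.ofReal N * tail (absFun f) q s := by
        refine le_mul_of_one_le_left zero_le ?_
        rw [ENNReal.ofReal_natCast]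
        exact_mod_cast Nat.one_le_iff_ne_zero.2 hN
    _ = ∫⁻ x in Ioi (N * s), rearr (absFun f) (x / N) ^ q := h2.symm
    _ ≤ tail (absFun F) q (N * s) :=
        lintegral_mono fun x => ENNReal.rpow_le_rpow (hr x) hq.le

theorem exists_tail_pos {f : Meas 𝕜} (hf : f ≠ 0) {q : ℝ} (hq : 0 < q) :
    ∃ s : ℝ, 0 < s ∧ tail (absFun f) q s ≠ 0 := by
  obtain ⟨t, ht0, -, ht⟩ := exists_rearr_pos hf
  refine ⟨t / 2, by positivity, fun h => ?_⟩
  have h1 := ofReal_mul_rearr_le_tail (absFun f) hq.le (t / 2) t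
  rw [h, nonpos_iff_eq_zero, mul_eq_zero, ENNReal.ofReal_eq_zero,
    ENNReal.rpow_eq_zero_iff_of_pos hq] at h1
  rcases h1 with h1 | h1
  · linarith
  · exact ht.ne' h1

theorem TailMonotone.inf_le {E : QuasiBanachFunctionSpace 𝕜} (hE : E.carrier ≠ ⊥) {q : ℝ}
    (hq : 0 < q) (h : TailMonotone E q) :
    L0Space 𝕜 ⊓ LSpace 𝕜 (ENNReal.ofReal q) ≤ E.carrier := by
  obtain ⟨c, hc, H⟩ := h.scaled hq
  obtain ⟨f, hf, hf0⟩ := Submodule.exists_mem_ne_zero_of_ne_bot hE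
  rintro g ⟨hg1, hg2⟩
  have hg1' := (mem_L0Space.1 hg1).ne
  have hg2' := (mem_LSpace_ofReal hq).1 hg2
  obtain ⟨s, hs0, hs⟩ := exists_tail_pos hf0 hq
  -- The support of f may be shorter than that of g; N copies of f have a nonzero tail at N s, which
  -- exceeds the length of the support of g.
  obtain ⟨N, hN⟩ := exists_nat_ge ((distr (absFun g) 0).toReal / s + 1)
  have hN0 : N ≠ 0 := by
    rintro rfl
    have : 0 ≤ (distr (absFun g) 0).toReal / s := by positivity
    simp only [Nat.cast_zero] at hN
    linarith
  obtain ⟨K, -, hK⟩ := h.exists_copies hq N hN0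
  obtain ⟨F, hF, -, hFt⟩ := hK f hf
  have hFs := h.le_sup hq hF
  have hNs : 0 < N * s := by positivity
  have h0 : tail (absFun F) q (N * s) ≠ 0 :=
    ((pos_iff_ne_zero.2 hs).trans_le (hFt s hs0)).ne'
  have h1 := (tail_lt_top_of_mem_sup hq hFs hNs).ne
  have hc' : distr (absFun g) 0 ≤ ENNReal.ofReal (N * s) := by
    rw [← ENNReal.ofReal_toReal hg1']
    refine ENNReal.ofReal_le_ofReal ?_
    rw [← div_le_iff₀ hs0]
    linarith
  set A := ∫⁻ x, ‖g x‖ₑ ^ q ∂halfLine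
  have hL : ((A / tail (absFun F) q (N * s)).toNNReal : ℝ≥0∞) = A / tail (absFun F) q (N * s) :=
    ENNReal.coe_toNNReal (ENNReal.div_ne_top hg2'.ne h0)
  refine (H F hF g ((A / tail (absFun F) q (N * s)).toNNReal + 1) (by positivity) hFs
    (Submodule.mem_sup_left hg1) fun t ht => ?_).1
  rw [ENNReal.coe_add, hL]
  refine (tail_le_div_mul_tail hq hc' le_rfl h0 h1 ht).trans ?_
  gcongr
  exact le_self_add

/-- Split f at its level at t = 2 s. The image of the upper part has support of measure at most C t
and only shifts the rearrangement; the image of the lower part is controlled in L_q by t r^q +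
tail(f)(t), which is at most 3 tail(f)(s). -/
theorem exists_tail_map_le {q : ℝ} (hq : 0 < q)
    {T : (L0Space 𝕜 ⊔ LSpace 𝕜 (ENNReal.ofReal q) : Submodule 𝕜 (Meas 𝕜)) →ₗ[𝕜]
      (L0Space 𝕜 ⊔ LSpace 𝕜 (ENNReal.ofReal q) : Submodule 𝕜 (Meas 𝕜))}
    (hX : RestrictsToBounded T (L0Space 𝕜) suppNorm)
    (hY : RestrictsToBounded T (LSpace 𝕜 (ENNReal.ofReal q)) (LNorm (ENNReal.ofReal q))) :
    ∃ (L : ℝ≥0) (N : ℕ), L ≠ 0 ∧ N ≠ 0 ∧ ∀ f s, 0 < s →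
      tail (absFun (T f : Meas 𝕜)) q (N * s) ≤ L * tail (absFun (f : Meas 𝕜)) q s := by
  obtain ⟨C, hC⟩ := hX
  obtain ⟨D, hD⟩ := hY.lintegral_le hq
  -- The factor 2 gives C t ≤ N s; the added 1 keeps N nonzero.
  obtain ⟨N, hN⟩ := exists_nat_ge (2 * (C : ℝ) + 1)
  have hN0 : N ≠ 0 := by
    rintro rfl
    have := C.coe_nonneg
    simp only [Nat.cast_zero] at hN
    linarith
  refine ⟨3 * D + 1, N, by positivity, hN0, fun f s hs => ?_⟩
  -- Cutting to the right of s lets the tail at s control the level: (t - s) r^q is at most that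
  -- tail, and t = 2 (t - s).
  set t := 2 * s with ht
  have ht0 : 0 < t := by positivity
  have hr := rearr_ne_top_of_tail_ne_top hq (tail_lt_top_of_mem_sup hq f.2 hs) ht0
  set r := rearr (absFun (f : Meas 𝕜)) t with hrdef
  have h1 := upperPart_mem_L0Space (f : Meas 𝕜) t
  have h2 := lowerPart_mem_LSpace hq ht0.le hr (tail_lt_top_of_mem_sup hq f.2 ht0)
  have h3 := map_eq_add (T := T) (Submodule.mem_sup_left h1) (Submodule.mem_sup_right h2)
    (upperPart_add_lowerPart (f : Meas 𝕜) r)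
  have h4 : distr (absFun (T ⟨_, Submodule.mem_sup_left h1⟩ : Meas 𝕜)) 0 ≤
      ENNReal.ofReal (C * t) := by
    rw [← suppNorm_eq_distr, ENNReal.ofReal_mul C.coe_nonneg, ENNReal.ofReal_coe_nnreal]
    refine (hC _ h1).2.trans ?_
    gcongr
    exact suppNorm_upperPart_le _
  have hCt : (C : ℝ) * t ≤ N * s := by
    rw [ht]
    nlinarith
  refine (tail_antitone _ q hCt).trans ?_
  have h5 : tail (absFun (T f : Meas 𝕜)) q (C * t) ≤ D * (3 * tail (absFun (f : Meas 𝕜)) q s) := by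
    rw [h3]
    have h6 := tail_add_suppNorm_le
      (absFun_add_le (T ⟨_, Submodule.mem_sup_left h1⟩ : Meas 𝕜)
        (T ⟨_, Submodule.mem_sup_right h2⟩ : Meas 𝕜))
      (measurable_enorm_coe (T ⟨_, Submodule.mem_sup_right h2⟩ : Meas 𝕜)) hq (by positivity) h4
    refine h6.trans ((hD ⟨_, Submodule.mem_sup_right h2⟩ h2).trans (mul_le_mul_right ?_ _))
    refine (lintegral_lowerPart_le (f : Meas 𝕜) hq ht0.le).trans ?_
    have h6 : ENNReal.ofReal t * r ^ q ≤ 2 * tail (absFun (f : Meas 𝕜)) q s := by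
      have h7 := ofReal_mul_rearr_le_tail (absFun (f : Meas 𝕜)) hq.le s t
      have h8 : t - s = s := by rw [ht]; ring
      rw [h8] at h7
      rw [ht, ENNReal.ofReal_mul zero_le_two, ENNReal.ofReal_ofNat, mul_assoc]
      gcongr
    have h9 : tail (absFun (f : Meas 𝕜)) q t ≤ tail (absFun (f : Meas 𝕜)) q s :=
      tail_antitone _ q (by linarith)
    calc _ ≤ 2 * tail (absFun (f : Meas 𝕜)) q s + tail (absFun (f : Meas 𝕜)) q s :=
          add_le_add h6 h9
      _ = 3 * tail (absFun (f : Meas 𝕜)) q s := by ring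
  calc _ ≤ _ := h5
    _ = ((3 * D : ℝ≥0) : ℝ≥0∞) * tail (absFun (f : Meas 𝕜)) q s := by
        push_cast
        ring
    _ ≤ _ := by
        gcongr
        exact le_self_add

theorem TailMonotone.isInterpolation {E : QuasiBanachFunctionSpace 𝕜} (hE : E.carrier ≠ ⊥) {q : ℝ}
    (hq : 0 < q) (h : TailMonotone E q) : IsInterpolationL0Lq E (ENNReal.ofReal q) := by
  refine ⟨h.inf_le hE hq, h.le_sup hq, fun T hX hY => ?_⟩
  obtain ⟨c, hc, H⟩ := h.scaled hq
  obtain ⟨L, N, hL, hN, HL⟩ := exists_tail_map_le hq hX hY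
  obtain ⟨K, hK0, hK⟩ := h.exists_copies hq N hN
  have hN0 : (0 : ℝ) < N := by positivity
  refine restrictsToBounded_of_qnorm_le (K := (L ^ q⁻¹ : ℝ≥0) * (c * K)) (by positivity)
    fun f hf => ?_
  obtain ⟨F, hF, hFK, hFt⟩ := hK f hf
  obtain ⟨h1, h2⟩ := H F hF (T f) L hL (h.le_sup hq hF) (T f).2 fun t ht => by
    have h3 := HL f (t / N) (by positivity)
    have h4 := hFt (t / N) (by positivity)
    rw [mul_div_cancel₀ _ hN0.ne'] at h3 h4
    refine h3.trans ?_
    gcongr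
  refine ⟨h1, h2.trans ?_⟩
  rw [mul_assoc, mul_assoc]
  gcongr

/-! ### The couple (L_p, L_q) -/

/-- Hölder's inequality on (0, t) with exponent q / p. -/
theorem head_le_lintegral_rpow {u : ℝ → ℝ≥0∞} (hu : Measurable u) {p q : ℝ} (hp : 0 < p)
    (hpq : p < q) (t : ℝ) :
    head u p t ≤ (∫⁻ x, u x ^ q ∂halfLine) ^ (q / p)⁻¹ * ENNReal.ofReal t ^ (1 - (q / p)⁻¹) := by
  have hr : 1 < q / p := (one_lt_div hp).2 hpq
  have h1 := ENNReal.lintegral_mul_le_Lp_mul_Lq (volume.restrict (Ioc 0 t))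
    (Real.HolderConjugate.conjExponent hr) (measurable_rearr_rpow u p).aemeasurable
    (measurable_const (a := (1 : ℝ≥0∞))).aemeasurable
  have h2 : 1 / (q / p).conjExponent = 1 - (q / p)⁻¹ := by
    rw [one_div, (Real.HolderConjugate.conjExponent hr).one_sub_inv]
  simp only [Pi.mul_apply, mul_one, ENNReal.one_rpow, lintegral_const, one_mul,
    Measure.restrict_apply_univ, Real.volume_Ioc, sub_zero, h2, ← ENNReal.rpow_mul,
    mul_div_cancel₀ q hp.ne', one_div (q / p)] at h1
  refine h1.trans (mul_le_mul_left (ENNReal.rpow_le_rpow ?_ (by positivity)) _)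
  exact head_le_lintegral hu (hp.trans hpq) t

theorem ofReal_rpow_mul {t : ℝ} (ht : 0 < t) (a b : ℝ) :
    ENNReal.ofReal t ^ a * ENNReal.ofReal t ^ b = ENNReal.ofReal t ^ (a + b) :=
  (ENNReal.rpow_add _ _ (by simpa using ht) ENNReal.ofReal_ne_top).symm

/-- Beyond t one has μ^q ≤ μ(t)^(q-p) μ^p, and μ(t) is bounded by t μ(t)^p ≤ ∫ u^p. -/
theorem tail_le_lintegral_rpow {u : ℝ → ℝ≥0∞} (hu : Measurable u) {p q : ℝ} (hp : 0 < p)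
    (hpq : p < q) {t : ℝ} (ht : 0 < t) :
    tail u q t ≤ ENNReal.ofReal t ^ (1 - q / p) * (∫⁻ x, u x ^ p ∂halfLine) ^ (q / p) := by
  have hr : 1 < q / p := (one_lt_div hp).2 hpq
  set N := ∫⁻ x, u x ^ p ∂halfLine
  have h1 : (ENNReal.ofReal t * rearr u t ^ p) ^ (q / p - 1) ≤ N ^ (q / p - 1) :=
    ENNReal.rpow_le_rpow ((ofReal_mul_rearr_le_head u hp.le t).trans (head_le_lintegral hu hp t))
      (sub_pos.2 hr).le
  have h2 : p * (q / p - 1) = q - p := by field_simp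
  calc tail u q t ≤ rearr u t ^ (q - p) * tail u p t := tail_le_rearr_mul u hp hpq t
    _ = ENNReal.ofReal t ^ (1 - q / p) * (ENNReal.ofReal t * rearr u t ^ p) ^ (q / p - 1) *
          tail u p t := by
        rw [ENNReal.mul_rpow_of_nonneg _ _ (sub_pos.2 hr).le, ← ENNReal.rpow_mul, h2, ← mul_assoc,
          ofReal_rpow_mul ht]
        simp
    _ ≤ ENNReal.ofReal t ^ (1 - q / p) * N ^ (q / p - 1) * N :=
        mul_le_mul' (mul_le_mul_right h1 _) (tail_le_lintegral hu hp ht.le)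
    _ = ENNReal.ofReal t ^ (1 - q / p) * N ^ (q / p) := by
        conv_lhs => rw [mul_assoc, ← ENNReal.rpow_one N, ← ENNReal.rpow_mul, one_mul,
          ← ENNReal.rpow_add_of_nonneg _ _ (sub_pos.2 hr).le zero_le_one, sub_add_cancel]

theorem ofReal_mul_rearr_rpow_le (u : ℝ → ℝ≥0∞) {p q : ℝ} (hp : 0 < p) (hq : 0 < q) {t : ℝ}
    (ht : 0 < t) :
    ENNReal.ofReal t * rearr u t ^ q ≤ ENNReal.ofReal t ^ (1 - q / p) * head u p t ^ (q / p) := by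
  calc ENNReal.ofReal t * rearr u t ^ q
      = ENNReal.ofReal t ^ (1 - q / p) * (ENNReal.ofReal t * rearr u t ^ p) ^ (q / p) := by
        rw [ENNReal.mul_rpow_of_nonneg _ _ (by positivity), ← ENNReal.rpow_mul,
          mul_div_cancel₀ q hp.ne', ← mul_assoc, ofReal_rpow_mul ht]
        simp
    _ ≤ _ := by
        gcongr
        exact ofReal_mul_rearr_le_head u hp.le t

theorem LSpace_le_sup_top {p q : ℝ} (hp : 0 < p) (hpq : p < q) :
    LSpace 𝕜 (ENNReal.ofReal p) ⊔ LSpace 𝕜 (ENNReal.ofReal q) ≤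
      LSpace 𝕜 (ENNReal.ofReal p) ⊔ LSpace 𝕜 ∞ := by
  refine sup_le le_sup_left fun g hg => mem_sup_top_of_head hp one_pos ?_
  refine (head_le_lintegral_rpow (measurable_enorm_coe g) hp hpq 1).trans_lt ?_
  rw [ENNReal.ofReal_one, ENNReal.one_rpow, mul_one]
  have hq := hp.trans hpq
  exact ENNReal.rpow_lt_top_of_nonneg (by positivity) ((mem_LSpace_ofReal hq).1 hg).ne

theorem LSpace_le_sup_L0Space {p q : ℝ} (hp : 0 < p) (hpq : p < q) :
    LSpace 𝕜 (ENNReal.ofReal p) ⊔ LSpace 𝕜 (ENNReal.ofReal q) ≤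
      L0Space 𝕜 ⊔ LSpace 𝕜 (ENNReal.ofReal q) := by
  have hq := hp.trans hpq
  refine sup_le (fun g hg => mem_sup_of_tail hq one_pos ?_) le_sup_right
  refine (tail_le_lintegral_rpow (measurable_enorm_coe g) hp hpq one_pos).trans_lt ?_
  rw [ENNReal.ofReal_one, ENNReal.one_rpow, one_mul]
  exact ENNReal.rpow_lt_top_of_nonneg (by positivity) ((mem_LSpace_ofReal hp).1 hg).ne

theorem inf_sup_top_le_LSpace {p q : ℝ} (hp : 0 < p) (hq : 0 < q) :
    (L0Space 𝕜 ⊔ LSpace 𝕜 (ENNReal.ofReal q)) ⊓ (LSpace 𝕜 (ENNReal.ofReal p) ⊔ LSpace 𝕜 ∞) ≤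
      LSpace 𝕜 (ENNReal.ofReal p) ⊔ LSpace 𝕜 (ENNReal.ofReal q) := by
  rintro f ⟨h1, h2⟩
  have h3 := head_lt_top_of_mem_sup hp h2 one_pos
  rw [← upperPart_add_lowerPart f (rearr (absFun f) 1)]
  exact Submodule.add_mem_sup (upperPart_mem_LSpace hp zero_le_one h3)
    (lowerPart_mem_LSpace hq zero_le_one (rearr_ne_top_of_head hp one_pos h3)
      (tail_lt_top_of_mem_sup hq h1 one_pos))

theorem LSpace_inf_le_sup {p q : ℝ} (hp : 0 < p) (hq : 0 < q) :
    LSpace 𝕜 (ENNReal.ofReal p) ⊓ LSpace 𝕜 (ENNReal.ofReal q) ≤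
      (L0Space 𝕜 ⊓ LSpace 𝕜 (ENNReal.ofReal q)) ⊔ (LSpace 𝕜 (ENNReal.ofReal p) ⊓ LSpace 𝕜 ∞) := by
  rintro g ⟨h1, h2⟩
  have h1' := (mem_LSpace_ofReal hp).1 h1
  have h2' := (mem_LSpace_ofReal hq).1 h2
  have h3 := (head_le_lintegral (measurable_enorm_coe g) hq 1).trans_lt h2'
  have hr := rearr_ne_top_of_head hq one_pos h3
  rw [← upperPart_add_lowerPart g (rearr (absFun g) 1)]
  exact Submodule.add_mem_sup
    ⟨upperPart_mem_L0Space g 1, upperPart_mem_LSpace hq zero_le_one h3⟩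
    ⟨lowerPart_mem_LSpace hp zero_le_one hr
      ((tail_le_lintegral (measurable_enorm_coe g) hp zero_le_one).trans_lt h1'),
      lowerPart_mem_LSpace_top g hr⟩

section Comparison

variable {u v w : ℝ → ℝ≥0∞} {p q t : ℝ} {C D : ℝ≥0} {H J : ℝ≥0∞}

/-- H stands for the head of f at t, and t^(1 - q/p) H^(q/p) is the tail-like quantity of the same
scaling. Hölder turns the L_q bound for v back into a multiple of H, all powers of t cancelling. -/
theorem head_le_of_le_rpow_head (h : ∀ᵐ x ∂halfLine, w x ≤ u x + v x) (hu : Measurable u)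
    (hv : Measurable v) (hp : 0 < p) (hpq : p < q) (ht : 0 < t)
    (huH : ∫⁻ x, u x ^ p ∂halfLine ≤ C * H)
    (hvH : ∫⁻ x, v x ^ q ∂halfLine ≤ D * (ENNReal.ofReal t ^ (1 - q / p) * H ^ (q / p))) :
    head w p t ≤ (sumConst p * (C + D ^ (q / p)⁻¹) : ℝ≥0) * H := by
  have hr : 0 < q / p := div_pos (hp.trans hpq) hp
  have hr' : 0 ≤ (q / p)⁻¹ := by positivity
  have h1 : head v p t ≤ (D ^ (q / p)⁻¹ : ℝ≥0) * H := by
    calc head v p t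
        ≤ (∫⁻ x, v x ^ q ∂halfLine) ^ (q / p)⁻¹ * ENNReal.ofReal t ^ (1 - (q / p)⁻¹) :=
          head_le_lintegral_rpow hv hp hpq t
      _ ≤ (D * (ENNReal.ofReal t ^ (1 - q / p) * H ^ (q / p))) ^ (q / p)⁻¹ *
            ENNReal.ofReal t ^ (1 - (q / p)⁻¹) := by gcongr
      _ = (D ^ (q / p)⁻¹ : ℝ≥0) * H *
            (ENNReal.ofReal t ^ ((1 - q / p) * (q / p)⁻¹) *
              ENNReal.ofReal t ^ (1 - (q / p)⁻¹)) := by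
          rw [ENNReal.mul_rpow_of_nonneg _ _ hr', ENNReal.mul_rpow_of_nonneg _ _ hr',
            ENNReal.coe_rpow_of_nonneg _ hr', ← ENNReal.rpow_mul, ← ENNReal.rpow_mul,
            mul_inv_cancel₀ hr.ne', ENNReal.rpow_one]
          ring
      _ = (D ^ (q / p)⁻¹ : ℝ≥0) * H := by
          have h2 : (1 - q / p) * (q / p)⁻¹ + (1 - (q / p)⁻¹) = 0 := by
            rw [sub_mul, mul_inv_cancel₀ hr.ne']
            ring
          rw [ofReal_rpow_mul ht, h2, ENNReal.rpow_zero, mul_one]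
  calc head w p t ≤ sumConst p * (head u p t + head v p t) := head_add_le h hp.le ht.le
    _ ≤ sumConst p * (C * H + (D ^ (q / p)⁻¹ : ℝ≥0) * H) := by
        gcongr
        exact (head_le_lintegral hu hp t).trans huH
    _ = _ := by
        push_cast
        ring

/-- The counterpart when the tail J of f dominates t^(1 - q/p) H^(q/p): the L_p bound for u gives
tail decay. The power of 1/2 arises because subadditivity evaluates the tails at t / 2. -/
theorem tail_le_of_rpow_head_le (h : ∀ᵐ x ∂halfLine, w x ≤ u x + v x) (hu : Measurable u)
    (hv : Measurable v) (hp : 0 < p) (hpq : p < q) (ht : 0 < t)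
    (huH : ∫⁻ x, u x ^ p ∂halfLine ≤ C * H) (hvJ : ∫⁻ x, v x ^ q ∂halfLine ≤ D * J)
    (hHJ : ENNReal.ofReal t ^ (1 - q / p) * H ^ (q / p) ≤ J) :
    tail w q t ≤ (sumConst q * ((1 / 2) ^ (1 - q / p) * C ^ (q / p) + D) : ℝ≥0) * J := by
  have hr : 0 ≤ q / p := (div_pos (hp.trans hpq) hp).le
  have hq := hp.trans hpq
  have ht2 : 0 < t / 2 := by positivity
  have h2 : ENNReal.ofReal (t / 2) ^ (1 - q / p) =
      ((1 / 2) ^ (1 - q / p) : ℝ≥0) * ENNReal.ofReal t ^ (1 - q / p) := by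
    rw [ENNReal.coe_rpow_of_ne_zero (by norm_num), ← ENNReal.mul_rpow_of_ne_top ENNReal.coe_ne_top
      ENNReal.ofReal_ne_top]
    congr 1
    rw [div_eq_mul_one_div, mul_comm, ENNReal.ofReal_mul (by norm_num)]
    congr 1
    rw [← ENNReal.ofReal_coe_nnreal]
    simp
  have h1 : tail u q (t / 2) ≤ ((1 / 2) ^ (1 - q / p) * C ^ (q / p) : ℝ≥0) * J := by
    calc tail u q (t / 2)
        ≤ ENNReal.ofReal (t / 2) ^ (1 - q / p) * (∫⁻ x, u x ^ p ∂halfLine) ^ (q / p) :=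
          tail_le_lintegral_rpow hu hp hpq ht2
      _ ≤ ENNReal.ofReal (t / 2) ^ (1 - q / p) * (C * H) ^ (q / p) := by gcongr
      _ = ((1 / 2) ^ (1 - q / p) * C ^ (q / p) : ℝ≥0) *
            (ENNReal.ofReal t ^ (1 - q / p) * H ^ (q / p)) := by
          rw [h2, ENNReal.mul_rpow_of_nonneg _ _ hr, ENNReal.coe_mul,
            ENNReal.coe_rpow_of_nonneg _ hr]
          ring
      _ ≤ _ := by gcongr
  calc tail w q t ≤ sumConst q * (tail u q (t / 2) + tail v q (t / 2)) :=
        tail_add_le h hq.le ht.le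
    _ ≤ sumConst q * (((1 / 2) ^ (1 - q / p) * C ^ (q / p) : ℝ≥0) * J + D * J) := by
        gcongr
        exact (tail_le_lintegral hv hq ht2.le).trans hvJ
    _ = _ := by
        simp only [ENNReal.coe_mul, ENNReal.coe_add]
        ring

end Comparison

/-- With H, J the head and tail of f at t and f split at μ(t, f), the p-th power integral of the
upper part is at most H, and the q-th power integral of the lower part at most t^(1 - q/p) H^(q/p) +
J. Whichever term of this sum is larger decides which estimate holds. -/
theorem exists_head_or_tail_map_le {p q : ℝ} (hp : 0 < p) (hpq : p < q)
    {T : (LSpace 𝕜 (ENNReal.ofReal p) ⊔ LSpace 𝕜 (ENNReal.ofReal q) : Submodule 𝕜 (Meas 𝕜)) →ₗ[𝕜]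
      (LSpace 𝕜 (ENNReal.ofReal p) ⊔ LSpace 𝕜 (ENNReal.ofReal q) : Submodule 𝕜 (Meas 𝕜))}
    (hX : RestrictsToBounded T (LSpace 𝕜 (ENNReal.ofReal p)) (LNorm (ENNReal.ofReal p)))
    (hY : RestrictsToBounded T (LSpace 𝕜 (ENNReal.ofReal q)) (LNorm (ENNReal.ofReal q))) :
    ∃ L : ℝ≥0, 1 ≤ L ∧ ∀ f t, 0 < t →
      head (absFun (T f : Meas 𝕜)) p t ≤ L * head (absFun (f : Meas 𝕜)) p t ∨
      tail (absFun (T f : Meas 𝕜)) q t ≤ L * tail (absFun (f : Meas 𝕜)) q t := by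
  have hq := hp.trans hpq
  obtain ⟨C, hC⟩ := hX.lintegral_le hp
  obtain ⟨D, hD⟩ := hY.lintegral_le hq
  set L₁ : ℝ≥0 := sumConst p * (C + (2 * D) ^ (q / p)⁻¹)
  set L₂ : ℝ≥0 := sumConst q * ((1 / 2) ^ (1 - q / p) * C ^ (q / p) + 2 * D)
  have hL₁ : L₁ ≤ L₁ + L₂ + 1 := by rw [add_assoc]; exact le_self_add
  have hL₂ : L₂ ≤ L₁ + L₂ + 1 := by rw [add_assoc, add_left_comm]; exact le_self_add
  refine ⟨L₁ + L₂ + 1, le_add_self, fun f t ht => ?_⟩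
  have hfin := head_lt_top_of_mem_sup hp (LSpace_le_sup_top hp hpq f.2) ht
  have hfin' := tail_lt_top_of_mem_sup hq (LSpace_le_sup_L0Space hp hpq f.2) ht
  have hr := rearr_ne_top_of_head hp ht hfin
  set r := rearr (absFun (f : Meas 𝕜)) t with hrdef
  have h1 := upperPart_mem_LSpace hp ht.le hfin
  have h2 := lowerPart_mem_LSpace hq ht.le hr hfin'
  have h3 := map_eq_add (T := T) (Submodule.mem_sup_left h1) (Submodule.mem_sup_right h2)
    (upperPart_add_lowerPart (f : Meas 𝕜) r)
  have hu := measurable_enorm_coe (T ⟨_, Submodule.mem_sup_left h1⟩ : Meas 𝕜)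
  have hv := measurable_enorm_coe (T ⟨_, Submodule.mem_sup_right h2⟩ : Meas 𝕜)
  have hadd := absFun_add_le (T ⟨_, Submodule.mem_sup_left h1⟩ : Meas 𝕜)
    (T ⟨_, Submodule.mem_sup_right h2⟩ : Meas 𝕜)
  rw [← h3] at hadd
  have h4 := (hC ⟨_, Submodule.mem_sup_left h1⟩ h1).trans
    (mul_le_mul_right (lintegral_upperPart_le (f : Meas 𝕜) hp ht.le) _)
  have h5 := (hD ⟨_, Submodule.mem_sup_right h2⟩ h2).trans
    (mul_le_mul_right ((lintegral_lowerPart_le (f : Meas 𝕜) hq ht.le).trans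
      (add_le_add_left (ofReal_mul_rearr_rpow_le (absFun (f : Meas 𝕜)) hp hq ht) _)) _)
  have hdouble : ∀ {a b : ℝ≥0∞}, a ≤ b → (D : ℝ≥0∞) * (a + b) ≤ (2 * D : ℝ≥0) * b := by
    intro a b hab
    calc (D : ℝ≥0∞) * (a + b) ≤ D * (b + b) := by gcongr
      _ = _ := by
        push_cast
        ring
  rcases le_total (tail (absFun (f : Meas 𝕜)) q t)
    (ENNReal.ofReal t ^ (1 - q / p) * head (absFun (f : Meas 𝕜)) p t ^ (q / p)) with h | h
  · left
    refine (head_le_of_le_rpow_head hadd hu hv hp hpq ht h4 (h5.trans ?_)).trans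
      (mul_le_mul_left (ENNReal.coe_le_coe.2 hL₁) _)
    rw [add_comm]
    exact hdouble h
  · right
    exact (tail_le_of_rpow_head_le hadd hu hv hp hpq ht h4 (h5.trans (hdouble h)) h).trans
      (mul_le_mul_left (ENNReal.coe_le_coe.2 hL₂) _)

/-- The half-line is covered by the set where the head estimate for Tf holds and the set where the
tail estimate holds. On each, μ(Tf) is dominated in E by the corresponding transport; adding the two
pieces and undoing the rearrangement gives Tf. -/
theorem isInterpolationLpLq_of_headStable_of_tailStable {E : QuasiBanachFunctionSpace 𝕜} {p q : ℝ}
    (hp : 0 < p) (hpq : p < q) (hhead : HeadStable E p) (htail : TailStable E q)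
    (hinf₀ : L0Space 𝕜 ⊓ LSpace 𝕜 (ENNReal.ofReal q) ≤ E.carrier)
    (hinf : LSpace 𝕜 (ENNReal.ofReal p) ⊓ LSpace 𝕜 ∞ ≤ E.carrier)
    (hsup₀ : E.carrier ≤ L0Space 𝕜 ⊔ LSpace 𝕜 (ENNReal.ofReal q))
    (hsup : E.carrier ≤ LSpace 𝕜 (ENNReal.ofReal p) ⊔ LSpace 𝕜 ∞) :
    IsInterpolationLpLq E (ENNReal.ofReal p) (ENNReal.ofReal q) := by
  have hq := hp.trans hpq
  refine ⟨(LSpace_inf_le_sup hp hq).trans (sup_le hinf₀ hinf),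
    (le_inf hsup₀ hsup).trans (inf_sup_top_le_LSpace hp hq), fun T hX hY => ?_⟩
  obtain ⟨L, hL, HL⟩ := exists_head_or_tail_map_le hp hpq hX hY
  obtain ⟨K₁, hK₁, H₁⟩ := hhead.exists_dom_rearr hp hL
  obtain ⟨K₂, hK₂, H₂⟩ := htail.exists_dom_rearr hq hL
  obtain ⟨K, hK, H⟩ := (hhead.symStable hp).exists_mem_of_dom_rearr
  obtain ⟨A, hA0, hA⟩ := E.exists_dom_add
  refine restrictsToBounded_of_qnorm_le (K := K * (A * (K₁ + K₂))) (by positivity) fun f hf => ?_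
  set g : Meas 𝕜 := (T f : Meas 𝕜) with hg
  have hgV := (T f).2
  set U := {t | head (absFun g) p t ≤ L * head (absFun (f : Meas 𝕜)) p t}
  set V := {t | tail (absFun g) q t ≤ L * tail (absFun (f : Meas 𝕜)) q t}
  have hU : MeasurableSet U := measurableSet_le (head_mono _ p).measurable
    ((head_mono _ p).measurable.const_mul _)
  have hV : MeasurableSet V := measurableSet_le (tail_antitone _ q).measurable
    ((tail_antitone _ q).measurable.const_mul _)
  have h1 := H₁ f hf g U (hsup hf) (LSpace_le_sup_top hp hpq hgV) hU fun t ht _ => ht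
  have h2 := H₂ f hf g V (hsup₀ hf) (LSpace_le_sup_L0Space hp hpq hgV) hV fun t ht _ => ht
  have h3 : E.Dom (rearr (absFun g)) (A * (K₁ + K₂) * E.qnorm (f : Meas 𝕜)) := by
    refine (hA h1 h2).mono ?_ (le_of_eq (by ring))
    filter_upwards [ae_restrict_mem measurableSet_Ioi] with t ht
    rcases HL f t ht with h | h
    · rw [indicator_of_mem (show t ∈ U from h)]
      exact le_self_add
    · rw [indicator_of_mem (show t ∈ V from h)]
      exact le_add_self
  rw [mul_assoc]
  exact H g _ h3

end LpInterpolation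

end

theorem mainTheorem1 {𝕜 : Type*} [RCLike 𝕜]
    (E : LpInterpolation.QuasiBanachFunctionSpace 𝕜) (hE : E.carrier ≠ ⊥)
    (p q : ℝ) (hp : 0 < p) (hpq : p < q) :
    (LpInterpolation.IsInterpolationLpLq E (ENNReal.ofReal p) ∞ ↔
      ∃ c : ℝ, 0 < c ∧ ∀ f ∈ E.carrier,
        ∀ g ∈ LpInterpolation.LSpace 𝕜 (ENNReal.ofReal p) ⊔ LpInterpolation.LSpace 𝕜 ∞,
          LpInterpolation.HeadMaj (LpInterpolation.absPow g p) (LpInterpolation.absPow f p) →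
            g ∈ E.carrier ∧ E.qnorm g ≤ c * E.qnorm f) ∧
    (LpInterpolation.IsInterpolationL0Lq E (ENNReal.ofReal q) ↔
      ∃ c : ℝ, 0 < c ∧ ∀ f ∈ E.carrier,
        ∀ g ∈ LpInterpolation.L0Space 𝕜 ⊔ LpInterpolation.LSpace 𝕜 (ENNReal.ofReal q),
          LpInterpolation.TailMaj (LpInterpolation.absPow g q) (LpInterpolation.absPow f q) →
            g ∈ E.carrier ∧ E.qnorm g ≤ c * E.qnorm f) ∧
    (LpInterpolation.IsInterpolationL0Lq E (ENNReal.ofReal q) ∧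
        LpInterpolation.IsInterpolationLpLq E (ENNReal.ofReal p) ∞ ↔
      LpInterpolation.IsInterpolationLpLq E (ENNReal.ofReal p) (ENNReal.ofReal q)) := by
  have hq := hp.trans hpq
  refine ⟨⟨fun h => (LpInterpolation.headStable_of_interpolation_top hp h).headMonotone hp,
    fun h => LpInterpolation.HeadMonotone.isInterpolation hE hp h⟩,
    ⟨fun h => (LpInterpolation.tailStable_of_interpolation_zero hq h).tailMonotone hq,
    fun h => LpInterpolation.TailMonotone.isInterpolation hE hq h⟩, fun h => ?_, fun h => ⟨?_, ?_⟩⟩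
  · exact LpInterpolation.isInterpolationLpLq_of_headStable_of_tailStable hp hpq
      (LpInterpolation.headStable_of_interpolation_top hp h.2)
      (LpInterpolation.tailStable_of_interpolation_zero hq h.1) h.1.1 h.2.1 h.1.2.1 h.2.2.1
  · exact ((LpInterpolation.tailStable_of_interpolation hp hpq h).tailMonotone
      hq).isInterpolation hE hq
  · exact ((LpInterpolation.headStable_of_interpolation hp hpq h).headMonotone
      hp).isInterpolation hE hp
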